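/- Let $t\in\mathbb{C}$. For $k,l\in\mathbb{N}$ let $P_{even}(k,l)$ be the set of partitions of $\{1,\dots,k,1',\dots,l'\}$ all of whose blocks have an even number of elements; picture $1,\dots,k$ as a lower and $1',\dots,l'$ as an upper row of vertices. The reflection category $\underline{\mathrm{Rep}}_0(H_t)$ has objects $[n]$, $n\in\mathbb{N}$, and $\mathrm{Hom}([k],[l])=\mathbb{C}P_{even}(k,l)$; the composition is the bilinear extension of $q\circ p=t^{l(q,p)}\,qp$, where $qp$ is obtained by stacking $q$ on top of $p$ and deleting the middle row, and $l(q,p)$ is the number of connected components of the stack that lie entirely in the middle row; the identity of $[n]$ is $\{\{1,1'\},\dots,\{n,n'\}\}$; the tensor product is $[n]\otimes[m]=[n+m]$ with the bilinear extension of horizontal concatenation on morphisms; the swap $[m]\otimes[n]\to[n]\otimes[m]$ is the permutation partition that moves the first $m$ points past the last $n$ points. It is a strict $\mathbb{C}$-linear symmetric monoidal category. Let $\mathrm{Par}_t$ be the strict $\mathbb{C}$-linear monoidal category generated by one object $W$ and the morphisms $\alpha: W\otimes W\to W\otimes W$ (neutralizer), $\beta: W\otimes W\to\mathbf{1}$ (cap),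 $\delta:\mathbf{1}\to W\otimes W$ (cup), $\gamma: W\otimes W\to W\otimes W$ (crossing), subject to the following relations (with $1=\mathrm{id}_W$) and to all relations obtained from them by reflecting the pictures horizontally and/or vertically (exchanging left and right, and/or reversing compositions and exchanging $\beta$ and $\delta$): $$\alpha\alpha=\alpha,\quad (1\otimes\alpha)(\alpha\otimes1)=(\alpha\otimes1)(1\otimes\alpha),\quad \beta\delta=t,\quad (1\otimes\beta)(\delta\otimes1)=1=(\beta\otimes1)(1\otimes\delta),$$ $$\alpha\delta=\delta,\quad (1\otimes\alpha)(\delta\otimes1)=(\alpha\otimes1)(1\otimes\delta),$$ $$\gamma\gamma=1\otimes1,\quad (\gamma\otimes1)(1\otimes\gamma)(\gamma\otimes1)=(1\otimes\gamma)(\gamma\otimes1)(1\otimes\gamma),$$ $$\beta\gamma=\beta,\quad \alpha\gamma=\alpha,\quad (1\otimes\alpha)(\gamma\otimes1)(1\otimes\gamma)=(\gamma\otimes1)(1\otimes\gamma)(\alpha\otimes1),\quad (1\otimes\beta)(\gamma\otimes1)(1\otimes\gamma)=\beta\otimes1.$$ Theorem. In both categories $c\mapsto c\cdot\mathrm{id}_{\mathbf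 1}$ is a bijection $\mathbb{C}\to\mathrm{End}(\mathbf{1})$. The category $\mathrm{Par}_t$ has a symmetry whose component $W\otimes W\to W\otimes W$ is $\gamma$, and with this symmetry there is an isomorphism of $\mathbb{C}$-linear symmetric monoidal categories $\tilde G:\mathrm{Par}_t\to\underline{\mathrm{Rep}}_0(H_t)$ (an isomorphism of categories that is $\mathbb{C}$-linear, strictly monoidal and compatible with the symmetries) such that $\tilde G(W^{\otimes k})=[k]$ for all $k$, and $$\tilde G(\alpha)=\{\{1,2,1',2'\}\},\quad \tilde G(\beta)=\{\{1,2\}\},\quad \tilde G(\delta)=\{\{1',2'\}\},\quad \tilde G(\gamma)=\{\{1,2'\},\{2,1'\}\}.$$ -/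

import Mathlib

open CategoryTheory MonoidalCategory

namespace PartitionDiagram

/-! ### Partitions and even partitions -/

/-- `P(k,l)`: partitions of `{1,…,k,1',…,l'}`, as equivalence relations.  The summand `Fin k` is the
lower row of vertices, the summand `Fin l` the upper one. -/
abbrev Partition (k l : ℕ) : Type := Setoid (Fin k ⊕ Fin l)

variable {k l m n k' l' m' n' : ℕ}

/-- All blocks have an even number of vertices. -/
def Partition.IsEven (p : Partition k l) : Prop := ∀ B ∈ p.classes, Even B.ncard

/-- The equivalence relation on the three rows of vertices (lower, middle, upper) that is generated
by `p` on the two lower rows and `q` on the two upper rows: the stacking of `q` on top of `p`. -/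
def Partition.stack (p : Partition k l) (q : Partition l m) :
    Setoid (Fin k ⊕ (Fin l ⊕ Fin m)) :=
  p.map (Sum.map id Sum.inl) ⊔ q.map Sum.inr

/-- Vertical concatenation `qp`: stack `q` on top of `p` and forget the middle row. -/
abbrev Partition.vcomp (p : Partition k l) (q : Partition l m) : Partition k m :=
  (p.stack q).comap (Sum.map id Sum.inr)

/-- The number `l(q,p)` of loops: components of the stacking that lie in the middle row. -/
noncomputable def Partition.loops (p : Partition k l) (q : Partition l m) : ℕ :=
  {B ∈ (p.stack q).classes | ∀ v ∈ B, ∃ j : Fin l, v = Sum.inr (Sum.inl j)}.ncard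

/-- The vertices of `p ⊗ q`, sorted into those of the left factor and those of the right factor. -/
def splitVertices (k l k' l' : ℕ) :
    Fin (k + k') ⊕ Fin (l + l') → (Fin k ⊕ Fin l) ⊕ (Fin k' ⊕ Fin l') :=
  Sum.elim
    (fun i => Sum.map Sum.inl Sum.inl (finSumFinEquiv.symm i))
    (fun j => Sum.map Sum.inr Sum.inr (finSumFinEquiv.symm j))

/-- Horizontal concatenation `p ⊗ q`: `q` is placed to the right of `p`. -/
abbrev Partition.hcomp (p : Partition k l) (q : Partition k' l') : Partition (k + k') (l + l') :=
  Setoid.comap (splitVertices k l k' l')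
    { r := Sum.LiftRel p.r q.r
      iseqv :=
        { refl := by
            rintro (a | a)
            · exact .inl (p.refl a)
            · exact .inr (q.refl a)
          symm := by
            rintro _ _ (⟨h⟩ | ⟨h⟩)
            · exact .inl (p.symm h)
            · exact .inr (q.symm h)
          trans := by
            rintro _ _ _ (⟨h⟩ | ⟨h⟩) (⟨h'⟩ | ⟨h'⟩)
            · exact .inl (p.trans h h')
            · exact .inr (q.trans h h') } }

/-- The partition with the blocks `{i, σ(i)'}`. -/
abbrev Partition.perm (σ : Fin k ≃ Fin l) : Partition k l := Setoid.ker (Sum.elim σ id)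

/-! ### Two-colourings

Partitions with a number of loops embed in matrices over `ℕ` indexed by the two-colourings of the
rows.  This gives the laws of vertical and horizontal concatenation. -/

/-- The colouring `x` of the lower and `y` of the upper row is constant on the blocks. -/
def Partition.Resp (p : Partition k l) (x : Fin k → Bool) (y : Fin l → Bool) : Prop :=
  p ≤ Setoid.ker (Sum.elim x y)

lemma Partition.ext_resp {p q : Partition k l} (h : ∀ x y, p.Resp x y ↔ q.Resp x y) : p = q := by
  classical
  have key : ∀ p q : Partition k l, (∀ x y, q.Resp x y → p.Resp x y) → p ≤ q := by
    intro p q h a b hab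
    let c : Fin k ⊕ Fin l → Bool := fun v => decide (q a v)
    have hc : q.Resp (c ∘ Sum.inl) (c ∘ Sum.inr) := by
      intro u v huv
      rw [Setoid.ker_def, Sum.elim_comp_inl_inr]
      simp only [c, decide_eq_decide]
      exact ⟨fun h => q.trans' h huv, fun h => q.trans' h (q.symm' huv)⟩
    have := h _ _ hc hab
    rw [Setoid.ker_def, Sum.elim_comp_inl_inr] at this
    simp only [c, decide_eq_decide] at this
    exact this.1 (q.refl' a)
  exact le_antisymm (key _ _ fun x y => (h x y).2) (key _ _ fun x y => (h x y).1)

lemma stack_le_iff (p : Partition k l) (q : Partition l m) (x : Fin k → Bool) (y : Fin l → Bool)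
    (z : Fin m → Bool) :
    p.stack q ≤ Setoid.ker (Sum.elim x (Sum.elim y z)) ↔ p.Resp x y ∧ q.Resp y z := by
  have hm : ∀ {α β : Type} (r : Setoid α) (f : α → β) (s : Setoid β),
      r.map f ≤ s ↔ ∀ a b, r a b → s (f a) (f b) := by
    intro α β r f s
    constructor
    · intro h a b hab
      exact h (Setoid.le_comap_map (r := r) (f := f) hab)
    · intro h
      refine Setoid.eqvGen_le ?_
      rintro _ _ ⟨a, b, hab, rfl, rfl⟩
      exact h a b hab
  unfold Partition.stack
  rw [sup_le_iff, hm, hm]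
  constructor
  · rintro ⟨h1, h2⟩
    refine ⟨fun {a b} hab => ?_, fun {a b} hab => ?_⟩
    · have := h1 a b hab
      rcases a with a | a <;> rcases b with b | b <;> simpa [Setoid.ker_def] using this
    · have := h2 a b hab
      rcases a with a | a <;> rcases b with b | b <;> simpa [Setoid.ker_def] using this
  · rintro ⟨h1, h2⟩
    refine ⟨fun a b hab => ?_, fun a b hab => ?_⟩
    · have := h1 hab
      rcases a with a | a <;> rcases b with b | b <;> simpa [Setoid.ker_def] using this
    · have := h2 hab
      rcases a with a | a <;> rcases b with b | b <;> simpa [Setoid.ker_def] using this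

/-- The entry of the matrix of the partition `p` with `c` loops. -/
noncomputable def mat (c : ℕ) (p : Partition k l) (x : Fin k → Bool) (y : Fin l → Bool) : ℕ :=
  open Classical in if p.Resp x y then 2 ^ c else 0

lemma mat_inj {c d : ℕ} {p q : Partition k l} (h : ∀ x y, mat c p x y = mat d q x y) :
    c = d ∧ p = q := by
  classical
  constructor
  · have := h (fun _ => true) (fun _ => true)
    have hp : ∀ p : Partition k l, p.Resp (fun _ => true) (fun _ => true) := by
      intro p a b _
      rw [Setoid.ker_def]
      rcases a with a | a <;> rcases b with b | b <;> rfl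
    simp only [mat, hp, if_true] at this
    exact Nat.pow_right_injective le_rfl this
  · refine Partition.ext_resp fun x y => ?_
    have := h x y
    unfold mat at this
    have h2c : ∀ e : ℕ, 2 ^ e ≠ 0 := fun e => by positivity
    by_cases h1 : p.Resp x y <;> by_cases h2 : q.Resp x y
    · simp [h1, h2]
    · simp [h1, h2] at this
    · rw [if_neg h1, if_pos h2] at this
      exact absurd this.symm (h2c d)
    · simp [h1, h2]

/-- Colourings of the middle row that extend a colouring of the outer rows. -/
lemma card_middle (p : Partition k l) (q : Partition l m) (x : Fin k → Bool) (z : Fin m → Bool) :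
    (open Classical in
      (∑ y : Fin l → Bool, if p.Resp x y ∧ q.Resp y z then (1 : ℕ) else 0)) =
      mat (p.loops q) (p.vcomp q) x z := by
  classical
  set J := p.stack q with hJ
  unfold mat
  simp_rw [← stack_le_iff p q]
  by_cases hr : (p.vcomp q).Resp x z
  swap
  · rw [if_neg hr]
    refine Finset.sum_eq_zero fun y _ => if_neg fun hy => hr ?_
    intro a b hab
    have := hy (x := Sum.map id Sum.inr a) (y := Sum.map id Sum.inr b) hab
    rcases a with a | a <;> rcases b with b | b <;> simpa [Setoid.ker_def] using this
  rw [if_pos hr, ← Finset.sum_filter, Finset.sum_const, smul_eq_mul, mul_one]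
  let Lo : Set (Set (Fin k ⊕ (Fin l ⊕ Fin m))) :=
    {B ∈ J.classes | ∀ v ∈ B, ∃ j : Fin l, v = Sum.inr (Sum.inl j)}
  let cls : Fin l → Set (Fin k ⊕ (Fin l ⊕ Fin m)) := fun j => {v | J v (Sum.inr (Sum.inl j))}
  have hmid : ∀ j, cls j ∉ Lo → ∃ u : Fin k ⊕ Fin m, J (Sum.map id Sum.inr u) (Sum.inr (Sum.inl j)) := by
    intro j hj
    by_contra hcon
    push Not at hcon
    refine hj ⟨⟨_, rfl⟩, ?_⟩
    rintro (v | v | v) hv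
    · exact absurd hv (hcon (Sum.inl v))
    · exact ⟨v, rfl⟩
    · exact absurd hv (hcon (Sum.inr v))
  have hrep : ∀ B : Lo, ∃ j : Fin l, B.1 = cls j := by
    rintro ⟨B, ⟨v, rfl⟩, hB⟩
    obtain ⟨j, rfl⟩ := hB v (J.refl' v)
    exact ⟨j, rfl⟩
  choose rep hrep using hrep
  choose out hout using hmid
  let G : (Lo → Bool) → (Fin l → Bool) := fun φ j =>
    if h : cls j ∈ Lo then φ ⟨_, h⟩ else Sum.elim x z (out j h)
  have hcls : ∀ i j, J (Sum.inr (Sum.inl i)) (Sum.inr (Sum.inl j)) → cls i = cls j := by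
    intro i j hij
    ext v
    exact ⟨fun h => J.trans' h hij, fun h => J.trans' h (J.symm' hij)⟩
  have houtout : ∀ u v : Fin k ⊕ Fin m, J (Sum.map id Sum.inr u) (Sum.map id Sum.inr v) →
      Sum.elim x z u = Sum.elim x z v := fun u v h => hr h
  have helim : ∀ (y : Fin l → Bool) (u : Fin k ⊕ Fin m),
      Sum.elim x (Sum.elim y z) (Sum.map id Sum.inr u) = Sum.elim x z u := by
    rintro y (u | u) <;> rfl
  have hGmem : ∀ φ, J ≤ Setoid.ker (Sum.elim x (Sum.elim (G φ) z)) := by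
    have hmix : ∀ φ j (u : Fin k ⊕ Fin m), J (Sum.map id Sum.inr u) (Sum.inr (Sum.inl j)) →
        Sum.elim x z u = G φ j := by
      intro φ j u hu
      have hj : cls j ∉ Lo := by
        rintro ⟨-, h⟩
        obtain ⟨i, hi⟩ := h _ hu
        rcases u with u | u <;> simp at hi
      simp only [G, dif_neg hj]
      exact houtout _ _ (J.trans' hu (J.symm' (hout j hj)))
    have hmm : ∀ φ i j, J (Sum.inr (Sum.inl i)) (Sum.inr (Sum.inl j)) → G φ i = G φ j := by
      intro φ i j hij
      have := hcls i j hij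
      by_cases hj : cls j ∈ Lo
      · have hi : cls i ∈ Lo := this ▸ hj
        simp only [G, dif_pos hj, dif_pos hi]
        congr 1
        exact Subtype.ext this
      · exact (hmix φ i (out j hj) (J.trans' (hout j hj) (J.symm' hij))).symm.trans
          (hmix φ j (out j hj) (hout j hj))
    rintro φ (a | a | a) (b | b | b) hab <;> rw [Setoid.ker_def]
    · exact houtout (Sum.inl a) (Sum.inl b) hab
    · exact hmix φ b (Sum.inl a) hab
    · exact houtout (Sum.inl a) (Sum.inr b) hab
    · exact (hmix φ a (Sum.inl b) (J.symm' hab)).symm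
    · exact hmm φ a b hab
    · exact (hmix φ a (Sum.inr b) (J.symm' hab)).symm
    · exact houtout (Sum.inr a) (Sum.inl b) hab
    · exact hmix φ b (Sum.inr a) hab
    · exact houtout (Sum.inr a) (Sum.inr b) hab
  have hcard : Fintype.card (Lo → Bool) =
      (Finset.univ.filter fun y : Fin l → Bool =>
        J ≤ Setoid.ker (Sum.elim x (Sum.elim y z))).card := by
    rw [← Finset.card_univ]
    refine Finset.card_bij (fun φ _ => G φ) (fun φ _ => by simpa using hGmem φ) ?_ ?_
    · intro φ _ ψ _ h
      funext B
      have h1 := congrFun h (rep B)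
      have hB : cls (rep B) ∈ Lo := hrep B ▸ B.2
      simp only [G, dif_pos hB] at h1
      have : (⟨_, hB⟩ : Lo) = B := Subtype.ext (hrep B).symm
      rwa [this] at h1
    · intro y hy
      simp only [Finset.mem_filter, Finset.mem_univ, true_and] at hy
      refine ⟨fun B => y (rep B), Finset.mem_univ _, ?_⟩
      funext j
      by_cases hj : cls j ∈ Lo
      · simp only [G, dif_pos hj]
        have h1 : cls j = cls (rep ⟨_, hj⟩) := hrep ⟨_, hj⟩
        have h2 : Sum.inr (Sum.inl j) ∈ cls (rep ⟨_, hj⟩) := h1 ▸ J.refl' _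
        exact (hy h2).symm
      · simp only [G, dif_neg hj]
        have := hy (hout j hj)
        rw [Setoid.ker_def, helim] at this
        exact this
  rw [← hcard, Fintype.card_fun, Fintype.card_bool, ← Nat.card_eq_fintype_card]
  rfl

lemma mat_vcomp (c d : ℕ) (p : Partition k l) (q : Partition l m) (x : Fin k → Bool)
    (z : Fin m → Bool) :
    mat (c + d + p.loops q) (p.vcomp q) x z = ∑ y, mat c p x y * mat d q y z := by
  classical
  have h : mat (c + d + p.loops q) (p.vcomp q) x z =
      2 ^ (c + d) * mat (p.loops q) (p.vcomp q) x z := by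
    unfold mat
    split_ifs <;> ring
  rw [h, ← card_middle, Finset.mul_sum]
  refine Finset.sum_congr rfl fun y _ => ?_
  unfold mat
  by_cases h1 : p.Resp x y <;> by_cases h2 : q.Resp y z <;> simp [h1, h2, pow_add]

lemma resp_hcomp (p : Partition k l) (q : Partition k' l') (x : Fin (k + k') → Bool)
    (y : Fin (l + l') → Bool) :
    (p.hcomp q).Resp x y ↔
      p.Resp (x ∘ Fin.castAdd k') (y ∘ Fin.castAdd l') ∧
        q.Resp (x ∘ Fin.natAdd k) (y ∘ Fin.natAdd l) := by
  have hsurj : ∀ v, ∃ w, splitVertices k l k' l' w = v := by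
    rintro ((v | v) | (v | v))
    · exact ⟨Sum.inl (Fin.castAdd _ v), by simp [splitVertices]⟩
    · exact ⟨Sum.inr (Fin.castAdd _ v), by simp [splitVertices]⟩
    · exact ⟨Sum.inl (Fin.natAdd _ v), by simp [splitVertices]⟩
    · exact ⟨Sum.inr (Fin.natAdd _ v), by simp [splitVertices]⟩
  have hcol : ∀ w, Sum.elim x y w =
      Sum.elim (Sum.elim (x ∘ Fin.castAdd k') (y ∘ Fin.castAdd l'))
        (Sum.elim (x ∘ Fin.natAdd k) (y ∘ Fin.natAdd l)) (splitVertices k l k' l' w) := by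
    rintro (w | w)
    · refine Fin.addCases (fun i => ?_) (fun i => ?_) w <;> simp [splitVertices]
    · refine Fin.addCases (fun i => ?_) (fun i => ?_) w <;> simp [splitVertices]
  constructor
  · intro h
    constructor
    · intro a b hab
      obtain ⟨u, hu⟩ := hsurj (Sum.inl a)
      obtain ⟨v, hv⟩ := hsurj (Sum.inl b)
      have : (p.hcomp q) u v := by
        change Sum.LiftRel _ _ _ _
        rw [hu, hv]
        exact .inl hab
      have := h this
      rw [Setoid.ker_def, hcol, hcol, hu, hv] at this
      exact this
    · intro a b hab
      obtain ⟨u, hu⟩ := hsurj (Sum.inr a)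
      obtain ⟨v, hv⟩ := hsurj (Sum.inr b)
      have : (p.hcomp q) u v := by
        change Sum.LiftRel _ _ _ _
        rw [hu, hv]
        exact .inr hab
      have := h this
      rw [Setoid.ker_def, hcol, hcol, hu, hv] at this
      exact this
  · rintro ⟨h1, h2⟩ a b hab
    change Sum.LiftRel _ _ _ _ at hab
    rw [Setoid.ker_def, hcol, hcol]
    generalize splitVertices k l k' l' a = u at hab
    generalize splitVertices k l k' l' b = v at hab
    rcases hab with ⟨h⟩ | ⟨h⟩
    · exact h1 h
    · exact h2 h

lemma mat_hcomp (c d : ℕ) (p : Partition k l) (q : Partition k' l') (x : Fin (k + k') → Bool)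
    (y : Fin (l + l') → Bool) :
    mat (c + d) (p.hcomp q) x y =
      mat c p (x ∘ Fin.castAdd k') (y ∘ Fin.castAdd l') *
        mat d q (x ∘ Fin.natAdd k) (y ∘ Fin.natAdd l) := by
  classical
  unfold mat
  simp only [resp_hcomp]
  by_cases h1 : p.Resp (x ∘ Fin.castAdd k') (y ∘ Fin.castAdd l') <;>
    by_cases h2 : q.Resp (x ∘ Fin.natAdd k) (y ∘ Fin.natAdd l) <;> simp [h1, h2, pow_add]

lemma resp_perm (σ : Fin k ≃ Fin l) (x : Fin k → Bool) (y : Fin l → Bool) :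
    (Partition.perm σ).Resp x y ↔ x = y ∘ σ := by
  constructor
  · intro h
    funext i
    exact h (x := Sum.inl i) (y := Sum.inr (σ i)) (by simp [Setoid.ker_def])
  · rintro rfl a b hab
    rw [Partition.perm, Setoid.ker_def] at hab
    rw [Setoid.ker_def]
    have : ∀ v, Sum.elim (y ∘ σ) y v = y (Sum.elim σ id v) := by rintro (v | v) <;> rfl
    rw [this, this, hab]

lemma mat_perm (σ : Fin k ≃ Fin l) (x : Fin k → Bool) (y : Fin l → Bool) :
    mat 0 (Partition.perm σ) x y = if x = y ∘ σ then 1 else 0 := by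
  classical
  unfold mat
  by_cases h : x = y ∘ σ
  · rw [if_pos ((resp_perm σ x y).2 h), if_pos h, pow_zero]
  · rw [if_neg (fun h' => h ((resp_perm σ x y).1 h')), if_neg h]

lemma isEven_iff (p : Partition k l) :
    p.IsEven ↔ ∀ x y, p.Resp x y →
      Even ((Finset.univ.filter fun i => x i = true).card +
        (Finset.univ.filter fun j => y j = true).card) := by
  classical
  have hsum : ∀ c : Fin k ⊕ Fin l → Bool,
      (Finset.univ.filter fun v => c v = true).card =
      (Finset.univ.filter fun i => c (Sum.inl i) = true).card +
        (Finset.univ.filter fun j => c (Sum.inr j) = true).card := by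
    intro c
    simp only [Finset.card_filter, Fintype.sum_sum_type]
  constructor
  · intro h x y hxy
    have : (Finset.univ.filter fun v => Sum.elim x y v = true).card =
        (Finset.univ.filter fun i => x i = true).card +
          (Finset.univ.filter fun j => y j = true).card := hsum (Sum.elim x y)
    rw [← this]
    rw [Finset.card_eq_sum_card_fiberwise (f := fun v => (Quotient.mk p v)) (t := Finset.univ)
      (fun _ _ => Finset.mem_coe.2 (Finset.mem_univ _))]
    refine Finset.even_sum _ fun c _ => ?_
    induction c using Quotient.inductionOn with
    | h v =>
      by_cases hv : Sum.elim x y v = true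
      · have h1 := h {u | p u v} ⟨v, rfl⟩
        rw [Set.ncard_eq_toFinset_card'] at h1
        refine (congrArg Even (congrArg Finset.card ?_)).mpr h1
        ext u
        simp only [Finset.mem_filter, Finset.mem_univ, true_and, Set.mem_toFinset,
          Set.mem_ofPred_eq]
        constructor
        · rintro ⟨-, h⟩
          exact Quotient.exact h
        · intro h
          refine ⟨?_, Quotient.sound h⟩
          have := hxy h
          rw [Setoid.ker_def] at this
          rw [this, hv]
      · convert Even.zero
        rw [Finset.card_eq_zero, Finset.filter_eq_empty_iff]
        intro u hu h
        apply hv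
        have := hxy (Quotient.exact h)
        rw [Setoid.ker_def] at this
        rw [← this]
        simpa using hu
  · rintro h B ⟨v, rfl⟩
    let c : Fin k ⊕ Fin l → Bool := fun u => decide (p u v)
    have h1 := h (c ∘ Sum.inl) (c ∘ Sum.inr) (by
      intro a b hab
      rw [Setoid.ker_def, Sum.elim_comp_inl_inr]
      simp only [c, decide_eq_decide]
      exact ⟨fun h => p.trans' (p.symm' hab) h, fun h => p.trans' hab h⟩)
    have h2 := hsum c
    simp only [Function.comp_apply] at h1
    rw [← h2] at h1
    rw [Set.ncard_eq_toFinset_card']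
    refine (congrArg Even (congrArg Finset.card ?_)).mpr h1
    ext u
    simp [c]

lemma isEven_vcomp {p : Partition k l} {q : Partition l m} (hp : p.IsEven) (hq : q.IsEven) :
    (p.vcomp q).IsEven := by
  classical
  rw [isEven_iff] at *
  intro x z h
  have h1 : mat (p.loops q) (p.vcomp q) x z ≠ 0 := by simp [mat, h]
  rw [← card_middle] at h1
  obtain ⟨y, -, hy⟩ := Finset.exists_ne_zero_of_sum_ne_zero h1
  have hy : p.Resp x y ∧ q.Resp y z := by
    by_contra hc
    exact hy (if_neg hc)
  have h2 := hp x y hy.1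
  have h3 := hq y z hy.2
  rw [Nat.even_iff] at *
  omega

lemma isEven_hcomp {p : Partition k l} {q : Partition k' l'} (hp : p.IsEven) (hq : q.IsEven) :
    (p.hcomp q).IsEven := by
  classical
  rw [isEven_iff] at *
  intro x y h
  rw [resp_hcomp] at h
  have h2 := hp _ _ h.1
  have h3 := hq _ _ h.2
  have hs : ∀ {a b : ℕ} (w : Fin (a + b) → Bool),
      (Finset.univ.filter fun i => w i = true).card =
      (Finset.univ.filter fun i => (w ∘ Fin.castAdd b) i = true).card +
        (Finset.univ.filter fun j => (w ∘ Fin.natAdd a) j = true).card := by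
    intro a b w
    simp only [Finset.card_filter, Fin.sum_univ_add, Function.comp_apply]
  rw [hs x, hs y]
  rw [Nat.even_iff] at *
  omega

lemma isEven_perm (σ : Fin k ≃ Fin l) : (Partition.perm σ).IsEven := by
  classical
  rw [isEven_iff]
  intro x y h
  rw [resp_perm] at h
  subst h
  have : (Finset.univ.filter fun i => (y ∘ σ) i = true).card =
      (Finset.univ.filter fun j => y j = true).card := by
    simp only [Finset.card_filter, Function.comp_apply]
    exact Equiv.sum_comp σ fun j => if y j = true then 1 else 0
  rw [this]
  exact ⟨_, rfl⟩

/-- The partition with one block. -/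
abbrev Partition.block (k l : ℕ) : Partition k l := ⊤

lemma isEven_block (h : Even (k + l)) : (Partition.block k l).IsEven := by
  rintro B ⟨v, rfl⟩
  have : {x | Partition.block k l x v} = Set.univ :=
    Set.eq_univ_of_forall fun _ => trivial
  rw [this, Set.ncard_univ]
  simpa using h

end PartitionDiagram

namespace PartitionDiagram

variable {k l m n k' l' m' n' : ℕ}

/-- `P_even(k,l)`. -/
def EvenPartition (k l : ℕ) : Type := {p : Partition k l // p.IsEven}

namespace EvenPartition

noncomputable def vcomp (p : EvenPartition k l) (q : EvenPartition l m) : EvenPartition k m :=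
  ⟨p.1.vcomp q.1, isEven_vcomp p.2 q.2⟩

noncomputable def hcomp (p : EvenPartition k l) (q : EvenPartition k' l') :
    EvenPartition (k + k') (l + l') :=
  ⟨p.1.hcomp q.1, isEven_hcomp p.2 q.2⟩

def perm (σ : Fin k ≃ Fin l) : EvenPartition k l := ⟨Partition.perm σ, isEven_perm σ⟩

/-- The partition with one block, for an even number of vertices. -/
def block (k l : ℕ) (h : Even (k + l)) : EvenPartition k l := ⟨Partition.block k l, isEven_block h⟩

noncomputable def loops (p : EvenPartition k l) (q : EvenPartition l m) : ℕ := p.1.loops q.1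

end EvenPartition

/-! ### Linear combinations of even partitions -/

/-- `ℂ P_even(k,l)`. -/
abbrev EvenLin (k l : ℕ) : Type := EvenPartition k l →₀ ℂ

/-- The bilinear extension of `(p, q) ↦ t ^ l(q,p) • qp`. -/
noncomputable def vcompLin (t : ℂ) (k l m : ℕ) : EvenLin k l →ₗ[ℂ] EvenLin l m →ₗ[ℂ] EvenLin k m :=
  Finsupp.linearCombination ℂ fun p => Finsupp.linearCombination ℂ fun q =>
    Finsupp.single (p.vcomp q) (t ^ p.loops q)

/-- The bilinear extension of horizontal concatenation. -/
noncomputable def hcompLin (k l k' l' : ℕ) :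
    EvenLin k l →ₗ[ℂ] EvenLin k' l' →ₗ[ℂ] EvenLin (k + k') (l + l') :=
  Finsupp.linearCombination ℂ fun p => Finsupp.linearCombination ℂ fun q =>
    Finsupp.single (p.hcomp q) 1

noncomputable def permLin (σ : Fin k ≃ Fin l) : EvenLin k l :=
  Finsupp.single (EvenPartition.perm σ) 1

lemma vcompLin_single (t : ℂ) (p : EvenPartition k l) (q : EvenPartition l m) (a b : ℂ) :
    vcompLin t k l m (Finsupp.single p a) (Finsupp.single q b) =
      Finsupp.single (p.vcomp q) (a * b * t ^ p.loops q) := by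
  simp only [vcompLin, Finsupp.linearCombination_single, LinearMap.smul_apply, Finsupp.smul_single,
    smul_eq_mul, mul_assoc]

lemma hcompLin_single (p : EvenPartition k l) (q : EvenPartition k' l') (a b : ℂ) :
    hcompLin k l k' l' (Finsupp.single p a) (Finsupp.single q b) =
      Finsupp.single (p.hcomp q) (a * b) := by
  simp only [hcompLin, Finsupp.linearCombination_single, LinearMap.smul_apply, Finsupp.smul_single,
    smul_eq_mul, mul_one]

lemma mat_vcomp_zero (p : Partition k l) (q : Partition l m) (x : Fin k → Bool)
    (z : Fin m → Bool) :
    mat (p.loops q) (p.vcomp q) x z = ∑ y, mat 0 p x y * mat 0 q y z := by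
  rw [← mat_vcomp, zero_add, zero_add]

lemma mat_perm_vcomp (σ : Fin k ≃ Fin l) (q : Partition l m) (x : Fin k → Bool)
    (z : Fin m → Bool) :
    mat ((Partition.perm σ).loops q) ((Partition.perm σ).vcomp q) x z =
      mat 0 q (x ∘ σ.symm) z := by
  rw [mat_vcomp_zero, Finset.sum_eq_single (x ∘ σ.symm)]
  · rw [mat_perm, if_pos (by funext i; simp), one_mul]
  · intro y _ hy
    rw [mat_perm, if_neg, zero_mul]
    rintro rfl
    exact hy (by funext i; simp)
  · intro h
    exact absurd (Finset.mem_univ _) h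

lemma mat_vcomp_perm (p : Partition k l) (σ : Fin l ≃ Fin m) (x : Fin k → Bool)
    (z : Fin m → Bool) :
    mat (p.loops (Partition.perm σ)) (p.vcomp (Partition.perm σ)) x z = mat 0 p x (z ∘ σ) := by
  rw [mat_vcomp_zero, Finset.sum_eq_single (z ∘ σ)]
  · rw [mat_perm, if_pos rfl, mul_one]
  · intro y _ hy
    rw [mat_perm, if_neg hy, mul_zero]
  · intro h
    exact absurd (Finset.mem_univ _) h

lemma vcomp_assoc_aux (p : Partition k l) (q : Partition l m) (r : Partition m n) :
    p.loops q + (p.vcomp q).loops r = q.loops r + p.loops (q.vcomp r) ∧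
      (p.vcomp q).vcomp r = p.vcomp (q.vcomp r) := by
  apply mat_inj
  intro x w
  have h1 := mat_vcomp (p.loops q) 0 (p.vcomp q) r x w
  have h2 := mat_vcomp 0 (q.loops r) p (q.vcomp r) x w
  rw [add_zero] at h1
  rw [zero_add] at h2
  rw [h1, h2]
  simp_rw [mat_vcomp_zero, Finset.sum_mul, Finset.mul_sum]
  rw [Finset.sum_comm]
  simp_rw [mul_assoc]

lemma interchange_aux (p : Partition k l) (q : Partition l m) (p' : Partition k' l')
    (q' : Partition l' m') :
    p.loops q + p'.loops q' = (p.hcomp p').loops (q.hcomp q') ∧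
      (p.vcomp q).hcomp (p'.vcomp q') = (p.hcomp p').vcomp (q.hcomp q') := by
  apply mat_inj
  intro x z
  rw [mat_hcomp, mat_vcomp_zero, mat_vcomp_zero, mat_vcomp_zero, Finset.sum_mul_sum]
  have h : ∀ (p : Partition k l) (q : Partition k' l') x y, mat 0 (p.hcomp q) x y = _ :=
    fun p q x y => mat_hcomp 0 0 p q x y
  have h' : ∀ (p : Partition l m) (q : Partition l' m') x y, mat 0 (p.hcomp q) x y = _ :=
    fun p q x y => mat_hcomp 0 0 p q x y
  simp_rw [h, h']
  rw [← Finset.sum_product', Finset.univ_product_univ,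
    ← Equiv.sum_comp (Fin.appendEquiv l l')]
  refine Finset.sum_congr rfl fun y _ => ?_
  have e1 : (Fin.appendEquiv l l' y) ∘ Fin.castAdd l' = y.1 := by
    funext i; simp [Fin.appendEquiv]
  have e2 : (Fin.appendEquiv l l' y) ∘ Fin.natAdd l = y.2 := by
    funext i; simp [Fin.appendEquiv]
  rw [e1, e2]
  ring

/-- The permutation of `Fin (k + k')` given by `σ` on the left and by `τ` on the right. -/
def sumPerm (σ : Fin k ≃ Fin l) (τ : Fin k' ≃ Fin l') : Fin (k + k') ≃ Fin (l + l') :=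
  finSumFinEquiv.symm.trans ((Equiv.sumCongr σ τ).trans finSumFinEquiv)

@[simp] lemma sumPerm_castAdd (σ : Fin k ≃ Fin l) (τ : Fin k' ≃ Fin l') (i : Fin k) :
    sumPerm σ τ (Fin.castAdd k' i) = Fin.castAdd l' (σ i) := by
  simp [sumPerm]

@[simp] lemma sumPerm_natAdd (σ : Fin k ≃ Fin l) (τ : Fin k' ≃ Fin l') (i : Fin k') :
    sumPerm σ τ (Fin.natAdd k i) = Fin.natAdd l (τ i) := by
  simp [sumPerm]

lemma sumPerm_refl : sumPerm (Equiv.refl (Fin k)) (Equiv.refl (Fin l)) = Equiv.refl _ := by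
  ext i
  refine Fin.addCases (fun i => ?_) (fun i => ?_) i <;> simp

lemma perm_hcomp (σ : Fin k ≃ Fin l) (τ : Fin k' ≃ Fin l') :
    (Partition.perm σ).hcomp (Partition.perm τ) = Partition.perm (sumPerm σ τ) := by
  refine Partition.ext_resp fun x y => ?_
  rw [resp_hcomp, resp_perm, resp_perm, resp_perm]
  constructor
  · rintro ⟨h1, h2⟩
    funext i
    refine Fin.addCases (fun i => ?_) (fun i => ?_) i
    · simpa using congrFun h1 i
    · simpa using congrFun h2 i
  · rintro rfl
    constructor <;> funext i <;> simp

lemma perm_vcomp (σ : Fin k ≃ Fin l) (τ : Fin l ≃ Fin m) :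
    (Partition.perm σ).loops (Partition.perm τ) = 0 ∧
      (Partition.perm σ).vcomp (Partition.perm τ) = Partition.perm (σ.trans τ) := by
  apply mat_inj
  intro x z
  rw [mat_vcomp_perm, mat_perm, mat_perm]
  rfl

lemma natural_aux (p : Partition k l) (p' : Partition k' l') (σ : Fin k ≃ Fin k')
    (τ : Fin l ≃ Fin l') (h : ∀ x y, p.Resp (x ∘ σ) (y ∘ τ) ↔ p'.Resp x y) :
    p.loops (Partition.perm τ) = (Partition.perm σ).loops p' ∧
      p.vcomp (Partition.perm τ) = (Partition.perm σ).vcomp p' := by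
  classical
  apply mat_inj
  intro x y
  rw [mat_vcomp_perm, mat_perm_vcomp]
  have := h (x ∘ σ.symm) y
  have e : (x ∘ σ.symm) ∘ σ = x := by funext i; simp
  rw [e] at this
  unfold mat
  by_cases h1 : p'.Resp (x ∘ σ.symm) y
  · rw [if_pos h1, if_pos (this.2 h1)]
  · rw [if_neg h1, if_neg (fun h' => h1 (this.1 h'))]

lemma single_congr {p q : EvenPartition k l} {a b : ℂ} (h : p.1 = q.1) (h' : a = b) :
    (Finsupp.single p a : EvenLin k l) = Finsupp.single q b := by
  rw [Subtype.ext h, h']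

lemma vcompLin_assoc (t : ℂ) (f : EvenLin k l) (g : EvenLin l m) (h : EvenLin m n) :
    vcompLin t k m n (vcompLin t k l m f g) h = vcompLin t k l n f (vcompLin t l m n g h) := by
  induction f using Finsupp.induction_linear with
  | zero => simp
  | add f f' hf hf' => simp [hf, hf']
  | single p a =>
    induction g using Finsupp.induction_linear with
    | zero => simp
    | add f f' hf hf' => simp [hf, hf']
    | single q b =>
      induction h using Finsupp.induction_linear with
      | zero => simp
      | add f f' hf hf' => simp [hf, hf']
      | single r c =>
        obtain ⟨h1, h2⟩ := vcomp_assoc_aux p.1 q.1 r.1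
        simp only [vcompLin_single]
        refine single_congr h2 ?_
        have h3 : p.loops q + (p.vcomp q).loops r = q.loops r + p.loops (q.vcomp r) := h1
        calc _ = a * b * c * t ^ (p.loops q + (p.vcomp q).loops r) := by ring
          _ = _ := by rw [h3]; ring

lemma natural_permLin (t : ℂ) (p : EvenPartition k l) (p' : EvenPartition k' l') (a : ℂ)
    (σ : Fin k ≃ Fin k') (τ : Fin l ≃ Fin l')
    (h : ∀ x y, p.1.Resp (x ∘ σ) (y ∘ τ) ↔ p'.1.Resp x y) :
    vcompLin t k l l' (Finsupp.single p a) (permLin τ) =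
      vcompLin t k k' l' (permLin σ) (Finsupp.single p' a) := by
  obtain ⟨h1, h2⟩ := natural_aux p.1 p'.1 σ τ h
  rw [permLin, permLin, vcompLin_single, vcompLin_single]
  refine single_congr h2 ?_
  change a * 1 * t ^ p.1.loops (Partition.perm τ) = 1 * a * t ^ (Partition.perm σ).loops p'.1
  rw [h1]
  ring

lemma permLin_vcomp (t : ℂ) (σ : Fin k ≃ Fin l) (τ : Fin l ≃ Fin m) :
    vcompLin t k l m (permLin σ) (permLin τ) = permLin (σ.trans τ) := by
  obtain ⟨h1, h2⟩ := perm_vcomp σ τ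
  rw [permLin, permLin, vcompLin_single]
  refine single_congr h2 ?_
  change 1 * 1 * t ^ (Partition.perm σ).loops (Partition.perm τ) = 1
  rw [h1]
  simp

lemma permLin_hcomp (σ : Fin k ≃ Fin l) (τ : Fin k' ≃ Fin l') :
    hcompLin k l k' l' (permLin σ) (permLin τ) = permLin (sumPerm σ τ) := by
  rw [permLin, permLin, hcompLin_single]
  exact single_congr (perm_hcomp σ τ) (one_mul _)

lemma refl_vcompLin (t : ℂ) (f : EvenLin k l) :
    vcompLin t k k l (permLin (Equiv.refl _)) f = f := by
  induction f using Finsupp.induction_linear with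
  | zero => simp
  | add f f' hf hf' => simp [hf, hf']
  | single p a =>
    have h : (Partition.perm (Equiv.refl _)).loops p.1 = 0 ∧
        (Partition.perm (Equiv.refl _)).vcomp p.1 = p.1 := by
      apply mat_inj
      intro x z
      rw [mat_perm_vcomp]
      rfl
    rw [permLin, vcompLin_single]
    refine single_congr h.2 ?_
    change 1 * a * t ^ (Partition.perm (Equiv.refl _)).loops p.1 = a
    rw [h.1]
    simp

lemma vcompLin_refl (t : ℂ) (f : EvenLin k l) :
    vcompLin t k l l f (permLin (Equiv.refl _)) = f := by
  induction f using Finsupp.induction_linear with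
  | zero => simp
  | add f f' hf hf' => simp [hf, hf']
  | single p a =>
    rw [natural_permLin t p p a (Equiv.refl _) (Equiv.refl _) (fun _ _ => Iff.rfl), refl_vcompLin]

lemma interchangeLin (t : ℂ) (f : EvenLin k l) (g : EvenLin l m) (f' : EvenLin k' l')
    (g' : EvenLin l' m') :
    vcompLin t _ _ _ (hcompLin k l k' l' f f') (hcompLin l m l' m' g g') =
      hcompLin k m k' m' (vcompLin t k l m f g) (vcompLin t k' l' m' f' g') := by
  induction f using Finsupp.induction_linear with
  | zero => simp
  | add f f' hf hf' => simp [hf, hf']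
  | single p a =>
    induction g using Finsupp.induction_linear with
    | zero => simp
    | add f f' hf hf' => simp [hf, hf']
    | single q b =>
      induction f' using Finsupp.induction_linear with
      | zero => simp
      | add f f' hf hf' => simp [hf, hf']
      | single p' c =>
        induction g' using Finsupp.induction_linear with
        | zero => simp
        | add f f' hf hf' => simp [hf, hf']
        | single q' d =>
          obtain ⟨h1, h2⟩ := interchange_aux p.1 q.1 p'.1 q'.1
          simp only [vcompLin_single, hcompLin_single]
          refine single_congr h2.symm ?_
          change a * c * (b * d) * t ^ (p.1.hcomp p'.1).loops (q.1.hcomp q'.1) =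
            a * b * t ^ p.1.loops q.1 * (c * d * t ^ p'.1.loops q'.1)
          rw [← h1]
          ring

lemma assocLin (t : ℂ) (f : EvenLin k l) (g : EvenLin k' l') (h : EvenLin m n) :
    vcompLin t _ _ _ (hcompLin _ _ _ _ (hcompLin _ _ _ _ f g) h)
        (permLin (finCongr (Nat.add_assoc l l' n))) =
      vcompLin t _ _ _ (permLin (finCongr (Nat.add_assoc k k' m)))
        (hcompLin _ _ _ _ f (hcompLin _ _ _ _ g h)) := by
  induction f using Finsupp.induction_linear with
  | zero => simp
  | add f f' hf hf' => simp [hf, hf']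
  | single p a =>
    induction g using Finsupp.induction_linear with
    | zero => simp
    | add f f' hf hf' => simp [hf, hf']
    | single q b =>
      induction h using Finsupp.induction_linear with
      | zero => simp
      | add f f' hf hf' => simp [hf, hf']
      | single r c =>
        simp only [hcompLin_single]
        rw [mul_assoc]
        apply natural_permLin
        intro x y
        simp only [EvenPartition.hcomp, resp_hcomp, and_assoc]
        refine and_congr ?_ (and_congr ?_ ?_) <;> refine iff_of_eq ?_ <;>
          congr 1 <;> funext i <;> simp only [Function.comp_apply] <;> congr 1 <;>
          apply Fin.ext <;> simp [Nat.add_assoc]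

lemma leftUnitLin (t : ℂ) (f : EvenLin k l) :
    vcompLin t _ _ _ (hcompLin _ _ _ _ (permLin (Equiv.refl (Fin 0))) f)
        (permLin (finCongr (Nat.zero_add l))) =
      vcompLin t _ _ _ (permLin (finCongr (Nat.zero_add k))) f := by
  induction f using Finsupp.induction_linear with
  | zero => simp
  | add f f' hf hf' => simp [hf, hf']
  | single p a =>
    rw [permLin, hcompLin_single, one_mul]
    apply natural_permLin
    intro x y
    simp only [EvenPartition.hcomp, EvenPartition.perm, resp_hcomp, resp_perm]
    rw [and_iff_right (Subsingleton.elim _ _)]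
    refine iff_of_eq ?_
    congr 1 <;> funext i <;> simp only [Function.comp_apply] <;> congr 1 <;>
      apply Fin.ext <;> simp

lemma rightUnitLin (t : ℂ) (f : EvenLin k l) :
    vcompLin t _ _ _ (hcompLin _ _ _ _ f (permLin (Equiv.refl (Fin 0))))
        (permLin (finCongr (Nat.add_zero l))) =
      vcompLin t _ _ _ (permLin (finCongr (Nat.add_zero k))) f := by
  induction f using Finsupp.induction_linear with
  | zero => simp
  | add f f' hf hf' => simp only [map_add, LinearMap.add_apply, hf, hf']
  | single p a =>
    rw [permLin, hcompLin_single, mul_one]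
    apply natural_permLin
    intro x y
    simp only [EvenPartition.hcomp, EvenPartition.perm, resp_hcomp, resp_perm]
    rw [and_iff_left (Subsingleton.elim _ _)]
    refine iff_of_eq ?_
    congr 1

lemma braidLin (t : ℂ) (f : EvenLin k l) (g : EvenLin k' l') :
    vcompLin t _ _ _ (hcompLin _ _ _ _ f g) (permLin (finAddFlip (m := l) (n := l'))) =
      vcompLin t _ _ _ (permLin (finAddFlip (m := k) (n := k'))) (hcompLin _ _ _ _ g f) := by
  induction f using Finsupp.induction_linear with
  | zero => simp
  | add f f' hf hf' => simp [hf, hf']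
  | single p a =>
    induction g using Finsupp.induction_linear with
    | zero => simp
    | add f f' hf hf' => simp [hf, hf']
    | single q b =>
      simp only [hcompLin_single]
      rw [mul_comm]
      apply natural_permLin
      intro x y
      simp only [EvenPartition.hcomp, resp_hcomp]
      rw [and_comm]
      refine and_congr ?_ ?_ <;> refine iff_of_eq ?_ <;>
        congr 1 <;> funext i <;> simp

lemma flip_flip (t : ℂ) (m n : ℕ) :
    vcompLin t _ _ _ (permLin (finAddFlip (m := m) (n := n)))
      (permLin (finAddFlip (m := n) (n := m))) = permLin (Equiv.refl _) := by
  rw [permLin_vcomp]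
  refine congrArg permLin ?_
  ext i
  refine Fin.addCases (fun i => ?_) (fun i => ?_) i <;> simp

lemma hexLin (t : ℂ) (a b c : ℕ) :
    vcompLin t _ _ _ (permLin (finCongr (Nat.add_assoc a b c)))
      (vcompLin t _ _ _ (permLin (finAddFlip (m := a) (n := b + c)))
        (permLin (finCongr (Nat.add_assoc b c a)))) =
    vcompLin t _ _ _ (hcompLin _ _ _ _ (permLin (finAddFlip (m := a) (n := b)))
        (permLin (Equiv.refl (Fin c))))
      (vcompLin t _ _ _ (permLin (finCongr (Nat.add_assoc b a c)))
        (hcompLin _ _ _ _ (permLin (Equiv.refl (Fin b)))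
          (permLin (finAddFlip (m := a) (n := c))))) := by
  simp only [permLin_hcomp, permLin_vcomp]
  refine congrArg permLin (Equiv.ext fun i => ?_)
  refine Fin.addCases (fun i => Fin.addCases (fun i => ?_) (fun i => ?_) i) (fun i => ?_) i
  rotate_left
  · have e1 : Fin.cast (Nat.add_assoc a b c) (Fin.castAdd c (Fin.castAdd b i)) =
        Fin.castAdd (b + c) i := Fin.ext (by simp)
    have e2 : Fin.cast (Nat.add_assoc b a c) (Fin.castAdd c (Fin.natAdd b i)) =
        Fin.natAdd b (Fin.castAdd c i) := Fin.ext (by simp)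
    apply Fin.ext
    simp [e1, e2, add_assoc]
  · have e1 : Fin.cast (Nat.add_assoc a b c) (Fin.castAdd c (Fin.natAdd a i)) =
        Fin.natAdd a (Fin.castAdd c i) := Fin.ext (by simp)
    have e2 : Fin.cast (Nat.add_assoc b a c) (Fin.castAdd c (Fin.castAdd a i)) =
        Fin.castAdd (a + c) i := Fin.ext (by simp)
    apply Fin.ext
    simp [e1, e2]
  · have e1 : Fin.cast (Nat.add_assoc a b c) (Fin.natAdd (a + b) i) =
        Fin.natAdd a (Fin.natAdd b i) := Fin.ext (by simp [add_assoc])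
    have e2 : Fin.cast (Nat.add_assoc b a c) (Fin.natAdd (b + a) i) =
        Fin.natAdd b (Fin.natAdd a i) := Fin.ext (by simp [add_assoc])
    apply Fin.ext
    simp [e1, e2]

lemma hexLin' (t : ℂ) (a b c : ℕ) :
    vcompLin t _ _ _ (permLin (finCongr (Nat.add_assoc a b c).symm))
      (vcompLin t _ _ _ (permLin (finAddFlip (m := a + b) (n := c)))
        (permLin (finCongr (Nat.add_assoc c a b).symm))) =
    vcompLin t _ _ _ (hcompLin _ _ _ _ (permLin (Equiv.refl (Fin a)))
        (permLin (finAddFlip (m := b) (n := c))))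
      (vcompLin t _ _ _ (permLin (finCongr (Nat.add_assoc a c b).symm))
        (hcompLin _ _ _ _ (permLin (finAddFlip (m := a) (n := c)))
          (permLin (Equiv.refl (Fin b))))) := by
  simp only [permLin_hcomp, permLin_vcomp]
  refine congrArg permLin (Equiv.ext fun i => ?_)
  refine Fin.addCases (fun i => ?_) (fun i => Fin.addCases (fun i => ?_) (fun i => ?_) i) i
  · have e1 : Fin.cast (Nat.add_assoc a b c).symm (Fin.castAdd (b + c) i) =
        Fin.castAdd c (Fin.castAdd b i) := Fin.ext (by simp)
    have e2 : Fin.cast (Nat.add_assoc a c b).symm (Fin.castAdd (c + b) i) =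
        Fin.castAdd b (Fin.castAdd c i) := Fin.ext (by simp)
    apply Fin.ext
    simp [e1, e2]
  · have e1 : Fin.cast (Nat.add_assoc a b c).symm (Fin.natAdd a (Fin.castAdd c i)) =
        Fin.castAdd c (Fin.natAdd a i) := Fin.ext (by simp)
    have e2 : Fin.cast (Nat.add_assoc a c b).symm (Fin.natAdd a (Fin.natAdd c i)) =
        Fin.natAdd (a + c) i := Fin.ext (by simp [add_assoc])
    apply Fin.ext
    simp [e1, e2, add_assoc]
  · have e1 : Fin.cast (Nat.add_assoc a b c).symm (Fin.natAdd a (Fin.natAdd b i)) =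
        Fin.natAdd (a + b) i := Fin.ext (by simp [add_assoc])
    have e2 : Fin.cast (Nat.add_assoc a c b).symm (Fin.natAdd a (Fin.castAdd b i)) =
        Fin.castAdd b (Fin.natAdd a i) := Fin.ext (by simp)
    apply Fin.ext
    simp [e1, e2]

/-! ### Strict monoidal structures -/

lemma eqToHom_tensor_id {C : Type} [Category.{0} C] [MonoidalCategoryStruct C]
    (hid : ∀ X Y : C, MonoidalCategoryStruct.tensorHom (𝟙 X) (𝟙 Y) =
      𝟙 (MonoidalCategoryStruct.tensorObj X Y)) {X X' : C} (h : X = X') (Y : C) :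
    MonoidalCategoryStruct.tensorHom (eqToHom h) (𝟙 Y) =
      eqToHom (congrArg (fun X => MonoidalCategoryStruct.tensorObj X Y) h) := by
  subst h
  exact hid _ _

lemma id_tensor_eqToHom {C : Type} [Category.{0} C] [MonoidalCategoryStruct C]
    (hid : ∀ X Y : C, MonoidalCategoryStruct.tensorHom (𝟙 X) (𝟙 Y) =
      𝟙 (MonoidalCategoryStruct.tensorObj X Y)) {Y Y' : C} (h : Y = Y') (X : C) :
    MonoidalCategoryStruct.tensorHom (𝟙 X) (eqToHom h) =
      eqToHom (congrArg (fun Y => MonoidalCategoryStruct.tensorObj X Y) h) := by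
  subst h
  exact hid _ _


lemma vcompLin_add_left (t : ℂ) (f f' : EvenLin k l) (g : EvenLin l m) :
    vcompLin t k l m (f + f') g = vcompLin t k l m f g + vcompLin t k l m f' g := by
  rw [map_add, LinearMap.add_apply]

lemma vcompLin_smul_left (t : ℂ) (r : ℂ) (f : EvenLin k l) (g : EvenLin l m) :
    vcompLin t k l m (r • f) g = r • vcompLin t k l m f g := by
  rw [map_smul, LinearMap.smul_apply]

/-! ### The reflection category -/

/-- The category `Rep₀(H_t)`; the object `⟨k⟩` is `[k]`. -/
structure ReflectionCat (t : ℂ) : Type where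
  rank : ℕ

namespace ReflectionCat

variable {t : ℂ}

noncomputable instance : Category (ReflectionCat t) where
  Hom X Y := EvenLin X.rank Y.rank
  id X := permLin (Equiv.refl (Fin X.rank))
  comp {X Y Z} f g := vcompLin t X.rank Y.rank Z.rank f g
  id_comp f := refl_vcompLin t f
  comp_id f := vcompLin_refl t f
  assoc f g h := vcompLin_assoc t f g h

/-- The even partition `p`, as a morphism. -/
noncomputable def ofPartition (p : EvenPartition k l) :
    (⟨k⟩ : ReflectionCat t) ⟶ ⟨l⟩ :=
  (Finsupp.single p 1 : EvenLin k l)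

noncomputable instance (X Y : ReflectionCat t) : AddCommGroup (X ⟶ Y) :=
  inferInstanceAs (AddCommGroup (EvenLin X.rank Y.rank))

noncomputable instance (X Y : ReflectionCat t) : Module ℂ (X ⟶ Y) :=
  inferInstanceAs (Module ℂ (EvenLin X.rank Y.rank))

lemma add_comp' (X Y Z : ReflectionCat t) (f f' : X ⟶ Y) (g : Y ⟶ Z) :
    (f + f') ≫ g = f ≫ g + f' ≫ g := vcompLin_add_left t f f' g

lemma comp_add' (X Y Z : ReflectionCat t) (f : X ⟶ Y) (g g' : Y ⟶ Z) :
    f ≫ (g + g') = f ≫ g + f ≫ g' := (vcompLin t X.rank Y.rank Z.rank f).map_add g g'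

lemma smul_comp' (X Y Z : ReflectionCat t) (r : ℂ) (f : X ⟶ Y) (g : Y ⟶ Z) :
    (r • f) ≫ g = r • f ≫ g := vcompLin_smul_left t r f g

lemma comp_smul' (X Y Z : ReflectionCat t) (f : X ⟶ Y) (r : ℂ) (g : Y ⟶ Z) :
    f ≫ (r • g) = r • f ≫ g := (vcompLin t X.rank Y.rank Z.rank f).map_smul r g

noncomputable instance : Preadditive (ReflectionCat t) where
  homGroup _ _ := inferInstance
  add_comp := add_comp'
  comp_add := comp_add'

noncomputable instance : Linear ℂ (ReflectionCat t) where
  homModule _ _ := inferInstance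
  smul_comp := smul_comp'
  comp_smul := comp_smul'

/-- The tensor product is strictly associative and strictly unital: the structural isomorphisms are
the identities `eqToIso`. -/
noncomputable instance : MonoidalCategoryStruct (ReflectionCat t) where
  tensorObj X Y := ⟨X.rank + Y.rank⟩
  tensorHom {X₁ Y₁ X₂ Y₂} f g := hcompLin X₁.rank Y₁.rank X₂.rank Y₂.rank f g
  whiskerLeft X {Y₁ Y₂} f := hcompLin X.rank X.rank Y₁.rank Y₂.rank (𝟙 X) f
  whiskerRight {X₁ X₂} f Y := hcompLin X₁.rank X₂.rank Y.rank Y.rank f (𝟙 Y)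
  tensorUnit := ⟨0⟩
  associator X Y Z := eqToIso (congrArg mk (Nat.add_assoc X.rank Y.rank Z.rank))
  leftUnitor X := eqToIso (congrArg mk (Nat.zero_add X.rank))
  rightUnitor X := eqToIso (congrArg mk (Nat.add_zero X.rank))

lemma eqToHom_eq {k l : ℕ} (h : k = l) :
    eqToHom (congrArg (mk (t := t)) h) = (permLin (finCongr h) : EvenLin k l) := by
  subst h
  rfl

lemma tensor_id (X Y : ReflectionCat t) :
    MonoidalCategoryStruct.tensorHom (𝟙 X) (𝟙 Y) = 𝟙 (MonoidalCategoryStruct.tensorObj X Y) :=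
  (permLin_hcomp _ _).trans (congrArg permLin sumPerm_refl)

noncomputable instance : MonoidalCategory (ReflectionCat t) :=
  MonoidalCategory.ofTensorHom
    (id_tensorHom_id := tensor_id)
    (id_tensorHom := fun _ _ _ _ => rfl)
    (tensorHom_id := fun _ _ => rfl)
    (tensorHom_comp_tensorHom := fun f₁ f₂ g₁ g₂ => interchangeLin t f₁ g₁ f₂ g₂)
    (associator_naturality := fun {X₁ X₂ X₃ Y₁ Y₂ Y₃} f₁ f₂ f₃ => by
      have h := assocLin t f₁ f₂ f₃
      rw [← eqToHom_eq (t := t), ← eqToHom_eq (t := t)] at h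
      exact h)
    (leftUnitor_naturality := fun f => by
      have h := leftUnitLin t f
      rw [← eqToHom_eq (t := t), ← eqToHom_eq (t := t)] at h
      exact h)
    (rightUnitor_naturality := fun f => by
      have h := rightUnitLin t f
      rw [← eqToHom_eq (t := t), ← eqToHom_eq (t := t)] at h
      exact h)
    (pentagon := fun W X Y Z => by
      simp only [MonoidalCategoryStruct.associator, eqToIso.hom, eqToHom_tensor_id tensor_id,
        id_tensor_eqToHom tensor_id, eqToHom_trans])
    (triangle := fun X Y => by
      simp only [MonoidalCategoryStruct.associator, MonoidalCategoryStruct.leftUnitor,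
        MonoidalCategoryStruct.rightUnitor, eqToIso.hom, eqToHom_tensor_id tensor_id,
        id_tensor_eqToHom tensor_id, eqToHom_trans])

instance : MonoidalPreadditive (ReflectionCat t) where
  whiskerLeft_zero := (hcompLin _ _ _ _ _).map_zero
  zero_whiskerRight {X _ _} := LinearMap.map_zero₂ (hcompLin _ _ _ _) (𝟙 X : EvenLin _ _)
  whiskerLeft_add f g := (hcompLin _ _ _ _ _).map_add f g
  add_whiskerRight {X _ _} f g :=
    LinearMap.map_add₂ (hcompLin _ _ _ _) f g (𝟙 X : EvenLin _ _)

instance : MonoidalLinear ℂ (ReflectionCat t) where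
  whiskerLeft_smul _ _ _ r f := (hcompLin _ _ _ _ _).map_smul r f
  smul_whiskerRight r _ _ f X :=
    LinearMap.map_smul₂ (hcompLin _ _ _ _) r f (𝟙 X : EvenLin _ _)

/-- The swap `[m] ⊗ [n] → [n] ⊗ [m]` is the permutation partition that moves the first `m` points
past the last `n` points. -/
noncomputable instance : SymmetricCategory (ReflectionCat t) where
  braiding X Y :=
    { hom := (permLin (finAddFlip (m := X.rank) (n := Y.rank)) : EvenLin _ _)
      inv := (permLin (finAddFlip (m := Y.rank) (n := X.rank)) : EvenLin _ _)
      hom_inv_id := flip_flip t _ _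
      inv_hom_id := flip_flip t _ _ }
  braiding_naturality_right X {Y Z} f := braidLin t (𝟙 X) f
  braiding_naturality_left f Z := braidLin t f (𝟙 Z)
  hexagon_forward X Y Z := by
    have h := hexLin t X.rank Y.rank Z.rank
    rw [← eqToHom_eq (t := t), ← eqToHom_eq (t := t), ← eqToHom_eq (t := t)] at h
    exact h
  hexagon_reverse X Y Z := by
    have h := hexLin' t X.rank Y.rank Z.rank
    rw [← eqToHom_eq (t := t), ← eqToHom_eq (t := t), ← eqToHom_eq (t := t)] at h
    exact h
  symmetry X Y := flip_flip t _ _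

end ReflectionCat

end PartitionDiagram

namespace PartitionDiagram

/-! ### The presented category -/

/-- Formal morphisms `W^{⊗k} → W^{⊗l}`: expressions built from identities and the four generators by
composition, tensor products and linear combinations.  The first factor of `comp` is the one that is
applied first (the lower one in a picture).  A tensor product carries proofs that its
source and target are the tensor products of those of its factors, so that
`(f ⊗ g) ⊗ h` and `f ⊗ (g ⊗ h)` have the same type. -/
inductive Word : ℕ → ℕ → Type
  | id (k : ℕ) : Word k k
  | comp {k l m : ℕ} (f : Word k l) (g : Word l m) : Word k m
  | tensor {a b a' b' k l : ℕ} (f : Word a b) (g : Word a' b') (hk : k = a + a')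
      (hl : l = b + b') : Word k l
  | zero (k l : ℕ) : Word k l
  | add {k l : ℕ} (f g : Word k l) : Word k l
  | smul {k l : ℕ} (c : ℂ) (f : Word k l) : Word k l
  | neutralizer : Word 2 2
  | cap : Word 2 0
  | cup : Word 0 2
  | cross : Word 2 2

namespace Word

/-- Reflection of a picture that exchanges top and bottom. -/
def flipV : {k l : ℕ} → Word k l → Word l k
  | _, _, id k => id k
  | _, _, comp f g => comp (flipV g) (flipV f)
  | _, _, tensor f g hk hl => tensor (flipV f) (flipV g) hl hk
  | _, _, zero k l => zero l k
  | _, _, add f g => add (flipV f) (flipV g)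
  | _, _, smul c f => smul c (flipV f)
  | _, _, neutralizer => neutralizer
  | _, _, cap => cup
  | _, _, cup => cap
  | _, _, cross => cross

/-- Reflection of a picture that exchanges left and right. -/
def flipH : {k l : ℕ} → Word k l → Word k l
  | _, _, id k => id k
  | _, _, comp f g => comp (flipH f) (flipH g)
  | _, _, tensor f g hk hl =>
      tensor (flipH g) (flipH f) (hk.trans (Nat.add_comm _ _)) (hl.trans (Nat.add_comm _ _))
  | _, _, zero k l => zero k l
  | _, _, add f g => add (flipH f) (flipH g)
  | _, _, smul c f => smul c (flipH f)
  | _, _, neutralizer => neutralizer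
  | _, _, cap => cap
  | _, _, cup => cup
  | _, _, cross => cross

/-- `f ⊗ id_W`, for `f : W^{⊗a} → W^{⊗b}`. -/
def strandRight {a b : ℕ} (f : Word a b) : Word (a + 1) (b + 1) := tensor f (id 1) rfl rfl

/-- `id_W ⊗ f`, for `f : W^{⊗a} → W^{⊗b}`. -/
def strandLeft {a b : ℕ} (f : Word a b) : Word (a + 1) (b + 1) :=
  tensor (id 1) f (Nat.add_comm _ _) (Nat.add_comm _ _)

/-- The listed relations between the generators. -/
inductive Listed (t : ℂ) : {k l : ℕ} → Word k l → Word k l → Prop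
  | neutralizer_idem : Listed t (comp neutralizer neutralizer) neutralizer
  | neutralizer_comm :
      Listed t (comp (strandRight neutralizer) (strandLeft neutralizer))
        (comp (strandLeft neutralizer) (strandRight neutralizer))
  | circle : Listed t (comp cup cap) (smul t (id 0))
  | zigzag_left : Listed t (comp (strandRight cup) (strandLeft cap)) (id 1)
  | zigzag_right : Listed t (comp (strandLeft cup) (strandRight cap)) (id 1)
  | neutralizer_cup : Listed t (comp cup neutralizer) cup
  | neutralizer_slide :
      Listed t (comp (strandRight cup) (strandLeft neutralizer))
        (comp (strandLeft cup) (strandRight neutralizer))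
  | cross_cross : Listed t (comp cross cross) (id 2)
  | braid :
      Listed t (comp (strandRight cross) (comp (strandLeft cross) (strandRight cross)))
        (comp (strandLeft cross) (comp (strandRight cross) (strandLeft cross)))
  | cap_cross : Listed t (comp cross cap) cap
  | neutralizer_cross : Listed t (comp cross neutralizer) neutralizer
  | neutralizer_past_strand :
      Listed t (comp (strandLeft cross) (comp (strandRight cross) (strandLeft neutralizer)))
        (comp (strandRight neutralizer) (comp (strandLeft cross) (strandRight cross)))
  | cap_past_strand :
      Listed t (comp (strandLeft cross) (comp (strandRight cross) (strandLeft cap)))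
        (strandRight cap)

/-- Equality in `Par_t`: the congruence on formal morphisms generated by the laws of a strict
`ℂ`-linear monoidal category and by the listed relations with their reflections. -/
inductive Rel (t : ℂ) : {k l : ℕ} → Word k l → Word k l → Prop
  -- equivalence relation and congruence
  | refl {k l : ℕ} (f : Word k l) : Rel t f f
  | symm {k l : ℕ} {f g : Word k l} : Rel t f g → Rel t g f
  | trans {k l : ℕ} {f g h : Word k l} : Rel t f g → Rel t g h → Rel t f h
  | comp {k l m : ℕ} {f f' : Word k l} {g g' : Word l m} :
      Rel t f f' → Rel t g g' → Rel t (comp f g) (comp f' g')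
  | tensor {a b a' b' k l : ℕ} {f f' : Word a b} {g g' : Word a' b'} (hk : k = a + a')
      (hl : l = b + b') :
      Rel t f f' → Rel t g g' → Rel t (tensor f g hk hl) (tensor f' g' hk hl)
  | add {k l : ℕ} {f f' g g' : Word k l} :
      Rel t f f' → Rel t g g' → Rel t (add f g) (add f' g')
  | smul {k l : ℕ} (c : ℂ) {f f' : Word k l} : Rel t f f' → Rel t (smul c f) (smul c f')
  -- category
  | id_comp {k l : ℕ} (f : Word k l) : Rel t (Word.comp (id k) f) f
  | comp_id {k l : ℕ} (f : Word k l) : Rel t (Word.comp f (id l)) f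
  | comp_assoc {k l m n : ℕ} (f : Word k l) (g : Word l m) (h : Word m n) :
      Rel t (Word.comp (Word.comp f g) h) (Word.comp f (Word.comp g h))
  -- vector spaces of morphisms
  | add_assoc {k l : ℕ} (f g h : Word k l) :
      Rel t (Word.add (Word.add f g) h) (Word.add f (Word.add g h))
  | add_comm {k l : ℕ} (f g : Word k l) : Rel t (Word.add f g) (Word.add g f)
  | zero_add {k l : ℕ} (f : Word k l) : Rel t (Word.add (zero k l) f) f
  | one_smul {k l : ℕ} (f : Word k l) : Rel t (Word.smul 1 f) f
  | mul_smul {k l : ℕ} (c d : ℂ) (f : Word k l) :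
      Rel t (Word.smul (c * d) f) (Word.smul c (Word.smul d f))
  | smul_add {k l : ℕ} (c : ℂ) (f g : Word k l) :
      Rel t (Word.smul c (Word.add f g)) (Word.add (Word.smul c f) (Word.smul c g))
  | add_smul {k l : ℕ} (c d : ℂ) (f : Word k l) :
      Rel t (Word.smul (c + d) f) (Word.add (Word.smul c f) (Word.smul d f))
  | zero_smul {k l : ℕ} (f : Word k l) : Rel t (Word.smul 0 f) (zero k l)
  -- bilinearity of composition and of the tensor product
  | add_comp {k l m : ℕ} (f f' : Word k l) (g : Word l m) :
      Rel t (Word.comp (Word.add f f') g) (Word.add (Word.comp f g) (Word.comp f' g))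
  | comp_add {k l m : ℕ} (f : Word k l) (g g' : Word l m) :
      Rel t (Word.comp f (Word.add g g')) (Word.add (Word.comp f g) (Word.comp f g'))
  | smul_comp {k l m : ℕ} (c : ℂ) (f : Word k l) (g : Word l m) :
      Rel t (Word.comp (Word.smul c f) g) (Word.smul c (Word.comp f g))
  | comp_smul {k l m : ℕ} (c : ℂ) (f : Word k l) (g : Word l m) :
      Rel t (Word.comp f (Word.smul c g)) (Word.smul c (Word.comp f g))
  | add_tensor {a b a' b' k l : ℕ} (f f' : Word a b) (g : Word a' b') (hk : k = a + a')
      (hl : l = b + b') :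
      Rel t (Word.tensor (Word.add f f') g hk hl)
        (Word.add (Word.tensor f g hk hl) (Word.tensor f' g hk hl))
  | tensor_add {a b a' b' k l : ℕ} (f : Word a b) (g g' : Word a' b') (hk : k = a + a')
      (hl : l = b + b') :
      Rel t (Word.tensor f (Word.add g g') hk hl)
        (Word.add (Word.tensor f g hk hl) (Word.tensor f g' hk hl))
  | smul_tensor {a b a' b' k l : ℕ} (c : ℂ) (f : Word a b) (g : Word a' b') (hk : k = a + a')
      (hl : l = b + b') :
      Rel t (Word.tensor (Word.smul c f) g hk hl) (Word.smul c (Word.tensor f g hk hl))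
  | tensor_smul {a b a' b' k l : ℕ} (c : ℂ) (f : Word a b) (g : Word a' b') (hk : k = a + a')
      (hl : l = b + b') :
      Rel t (Word.tensor f (Word.smul c g) hk hl) (Word.smul c (Word.tensor f g hk hl))
  -- strict monoidal category
  | tensor_id (a b : ℕ) : Rel t (Word.tensor (id a) (id b) rfl rfl) (id (a + b))
  | interchange {a b c a' b' c' k l m : ℕ} (f : Word a b) (g : Word b c) (f' : Word a' b')
      (g' : Word b' c') (hk : k = a + a') (hl : l = b + b') (hm : m = c + c') :
      Rel t (Word.comp (Word.tensor f f' hk hl) (Word.tensor g g' hl hm))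
        (Word.tensor (Word.comp f g) (Word.comp f' g') hk hm)
  | tensor_assoc {a b a' b' a'' b'' p q p' q' k l : ℕ} (f : Word a b) (g : Word a' b')
      (h : Word a'' b'') (hp : p = a + a') (hq : q = b + b') (hp' : p' = a' + a'')
      (hq' : q' = b' + b'') (hk : k = p + a'') (hl : l = q + b'') (hk' : k = a + p')
      (hl' : l = b + q') :
      Rel t (Word.tensor (Word.tensor f g hp hq) h hk hl)
        (Word.tensor f (Word.tensor g h hp' hq') hk' hl')
  | unit_tensor {k l : ℕ} (f : Word k l) (hk : k = 0 + k) (hl : l = 0 + l) :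
      Rel t (Word.tensor (id 0) f hk hl) f
  | tensor_unit {k l : ℕ} (f : Word k l) (hk : k = k + 0) (hl : l = l + 0) :
      Rel t (Word.tensor f (id 0) hk hl) f
  -- the relations of the presentation, and their reflections
  | listed {k l : ℕ} {f g : Word k l} : Listed t f g → Rel t f g
  | listed_flipV {k l : ℕ} {f g : Word k l} : Listed t f g → Rel t (flipV f) (flipV g)
  | listed_flipH {k l : ℕ} {f g : Word k l} : Listed t f g → Rel t (flipH f) (flipH g)
  | listed_flipVH {k l : ℕ} {f g : Word k l} :
      Listed t f g → Rel t (flipH (flipV f)) (flipH (flipV g))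

end Word

/-- Morphisms `W^{⊗k} → W^{⊗l}` of `Par_t`. -/
def ParHom (t : ℂ) (k l : ℕ) : Type := Quot (Word.Rel t (k := k) (l := l))

namespace ParHom

variable {t : ℂ} {a b c a' b' c' k l m n : ℕ}

def mk (f : Word k l) : ParHom t k l := Quot.mk _ f

def comp (f : ParHom t k l) (g : ParHom t l m) : ParHom t k m :=
  Quot.map₂ Word.comp (fun f _ _ h => .comp (.refl f) h) (fun _ _ g h => .comp h (.refl g)) f g

def tensor (f : ParHom t a b) (g : ParHom t a' b') (hk : k = a + a') (hl : l = b + b') :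
    ParHom t k l :=
  Quot.map₂ (fun f g => Word.tensor f g hk hl) (fun f _ _ h => .tensor hk hl (.refl f) h)
    (fun _ _ g h => .tensor hk hl h (.refl g)) f g

instance : Zero (ParHom t k l) := ⟨mk (.zero k l)⟩

instance : Add (ParHom t k l) :=
  ⟨Quot.map₂ Word.add (fun f _ _ h => .add (.refl f) h) (fun _ _ g h => .add h (.refl g))⟩

instance : SMul ℂ (ParHom t k l) := ⟨fun c => Quot.map (Word.smul c) fun _ _ h => .smul c h⟩

instance : Neg (ParHom t k l) := ⟨fun f => (-1 : ℂ) • f⟩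

lemma one_smul' (f : ParHom t k l) : (1 : ℂ) • f = f := by
  induction f using Quot.ind
  exact Quot.sound (.one_smul _)

lemma add_smul' (c d : ℂ) (f : ParHom t k l) : (c + d) • f = c • f + d • f := by
  induction f using Quot.ind
  exact Quot.sound (.add_smul _ _ _)

lemma zero_smul' (f : ParHom t k l) : (0 : ℂ) • f = 0 := by
  induction f using Quot.ind
  exact Quot.sound (.zero_smul _)

lemma add_comm' (f g : ParHom t k l) : f + g = g + f := by
  induction f using Quot.ind
  induction g using Quot.ind
  exact Quot.sound (.add_comm _ _)

lemma zero_add' (f : ParHom t k l) : 0 + f = f := by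
  induction f using Quot.ind
  exact Quot.sound (.zero_add _)

lemma mul_smul' (c d : ℂ) (f : ParHom t k l) : (c * d) • f = c • d • f := by
  induction f using Quot.ind
  exact Quot.sound (.mul_smul _ _ _)

instance : AddCommGroup (ParHom t k l) where
  add_assoc f g h := by
    induction f using Quot.ind
    induction g using Quot.ind
    induction h using Quot.ind
    exact Quot.sound (.add_assoc _ _ _)
  zero_add := zero_add'
  add_zero f := by rw [add_comm', zero_add']
  nsmul := nsmulRec
  zsmul := zsmulRec
  neg_add_cancel f := by
    have h := add_smul' (-1) 1 f
    rw [one_smul', neg_add_cancel, zero_smul'] at h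
    exact h.symm
  add_comm := add_comm'

instance : Module ℂ (ParHom t k l) where
  one_smul := one_smul'
  mul_smul := mul_smul'
  smul_zero c := by rw [← zero_smul' (0 : ParHom t k l), ← mul_smul', mul_zero]
  smul_add c f g := by
    induction f using Quot.ind
    induction g using Quot.ind
    exact Quot.sound (.smul_add _ _ _)
  add_smul := add_smul'
  zero_smul := zero_smul'

lemma add_comp (f f' : ParHom t k l) (g : ParHom t l m) :
    (f + f').comp g = f.comp g + f'.comp g := by
  induction f using Quot.ind
  induction f' using Quot.ind
  induction g using Quot.ind
  exact Quot.sound (.add_comp _ _ _)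

lemma comp_add (f : ParHom t k l) (g g' : ParHom t l m) :
    f.comp (g + g') = f.comp g + f.comp g' := by
  induction f using Quot.ind
  induction g using Quot.ind
  induction g' using Quot.ind
  exact Quot.sound (.comp_add _ _ _)

lemma smul_comp (c : ℂ) (f : ParHom t k l) (g : ParHom t l m) :
    (c • f).comp g = c • f.comp g := by
  induction f using Quot.ind
  induction g using Quot.ind
  exact Quot.sound (.smul_comp _ _ _)

lemma comp_smul (f : ParHom t k l) (c : ℂ) (g : ParHom t l m) :
    f.comp (c • g) = c • f.comp g := by
  induction f using Quot.ind
  induction g using Quot.ind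
  exact Quot.sound (.comp_smul _ _ _)

lemma add_tensor (f f' : ParHom t a b) (g : ParHom t a' b') (hk : k = a + a')
    (hl : l = b + b') : (f + f').tensor g hk hl = f.tensor g hk hl + f'.tensor g hk hl := by
  induction f using Quot.ind
  induction f' using Quot.ind
  induction g using Quot.ind
  exact Quot.sound (.add_tensor _ _ _ _ _)

lemma tensor_add (f : ParHom t a b) (g g' : ParHom t a' b') (hk : k = a + a')
    (hl : l = b + b') : f.tensor (g + g') hk hl = f.tensor g hk hl + f.tensor g' hk hl := by
  induction f using Quot.ind
  induction g using Quot.ind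
  induction g' using Quot.ind
  exact Quot.sound (.tensor_add _ _ _ _ _)

lemma smul_tensor (c : ℂ) (f : ParHom t a b) (g : ParHom t a' b') (hk : k = a + a')
    (hl : l = b + b') : (c • f).tensor g hk hl = c • f.tensor g hk hl := by
  induction f using Quot.ind
  induction g using Quot.ind
  exact Quot.sound (.smul_tensor _ _ _ _ _)

lemma tensor_smul (c : ℂ) (f : ParHom t a b) (g : ParHom t a' b') (hk : k = a + a')
    (hl : l = b + b') : f.tensor (c • g) hk hl = c • f.tensor g hk hl := by
  induction f using Quot.ind
  induction g using Quot.ind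
  exact Quot.sound (.tensor_smul _ _ _ _ _)

lemma interchange (f : ParHom t a b) (g : ParHom t b c) (f' : ParHom t a' b')
    (g' : ParHom t b' c') (hk : k = a + a') (hl : l = b + b') (hm : m = c + c') :
    (f.tensor f' hk hl).comp (g.tensor g' hl hm) = (f.comp g).tensor (f'.comp g') hk hm := by
  induction f using Quot.ind
  induction g using Quot.ind
  induction f' using Quot.ind
  induction g' using Quot.ind
  exact Quot.sound (.interchange _ _ _ _ _ _ _)

lemma tensor_assoc {a'' b'' p q p' q' : ℕ} (f : ParHom t a b) (g : ParHom t a' b')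
    (h : ParHom t a'' b'') (hp : p = a + a') (hq : q = b + b') (hp' : p' = a' + a'')
    (hq' : q' = b' + b'') (hk : k = p + a'') (hl : l = q + b'') (hk' : k = a + p')
    (hl' : l = b + q') :
    (f.tensor g hp hq).tensor h hk hl = f.tensor (g.tensor h hp' hq') hk' hl' := by
  induction f using Quot.ind
  induction g using Quot.ind
  induction h using Quot.ind
  exact Quot.sound (.tensor_assoc _ _ _ _ _ _ _ _ _ _ _)

lemma unit_tensor (f : ParHom t k l) (hk : k = 0 + k) (hl : l = 0 + l) :
    tensor (mk (.id 0)) f hk hl = f := by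
  induction f using Quot.ind
  exact Quot.sound (.unit_tensor _ _ _)

lemma tensor_unit (f : ParHom t k l) (hk : k = k + 0) (hl : l = l + 0) :
    tensor f (mk (.id 0)) hk hl = f := by
  induction f using Quot.ind
  exact Quot.sound (.tensor_unit _ _ _)

end ParHom

/-- The category `Par_t`; the object `⟨k⟩` is `W^{⊗k}`. -/
structure ParCat (t : ℂ) : Type where
  rank : ℕ

namespace ParCat

variable {t : ℂ} {a b c a' b' c' k l m n : ℕ}

instance : Category (ParCat t) where
  Hom X Y := ParHom t X.rank Y.rank
  id X := ParHom.mk (.id X.rank)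
  comp f g := ParHom.comp f g
  id_comp f := by
    induction f using Quot.ind
    exact Quot.sound (.id_comp _)
  comp_id f := by
    induction f using Quot.ind
    exact Quot.sound (.comp_id _)
  assoc f g h := by
    induction f using Quot.ind
    induction g using Quot.ind
    induction h using Quot.ind
    exact Quot.sound (.comp_assoc _ _ _)

instance (X Y : ParCat t) : AddCommGroup (X ⟶ Y) :=
  inferInstanceAs (AddCommGroup (ParHom t X.rank Y.rank))

instance (X Y : ParCat t) : Module ℂ (X ⟶ Y) :=
  inferInstanceAs (Module ℂ (ParHom t X.rank Y.rank))

instance : Preadditive (ParCat t) where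
  homGroup _ _ := inferInstance
  add_comp _ _ _ f f' g := ParHom.add_comp f f' g
  comp_add _ _ _ f g g' := ParHom.comp_add f g g'

instance : Linear ℂ (ParCat t) where
  homModule _ _ := inferInstance
  smul_comp _ _ _ r f g := ParHom.smul_comp r f g
  comp_smul _ _ _ f r g := ParHom.comp_smul f r g

/-- The tensor product is strictly associative and strictly unital: the structural isomorphisms are
the identities `eqToIso`. -/
instance : MonoidalCategoryStruct (ParCat t) where
  tensorObj X Y := ⟨X.rank + Y.rank⟩
  tensorHom f g := ParHom.tensor f g rfl rfl
  whiskerLeft X {_ _} f := ParHom.tensor (𝟙 X) f rfl rfl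
  whiskerRight f Y := ParHom.tensor f (𝟙 Y) rfl rfl
  tensorUnit := ⟨0⟩
  associator X Y Z := eqToIso (congrArg mk (Nat.add_assoc X.rank Y.rank Z.rank))
  leftUnitor X := eqToIso (congrArg mk (Nat.zero_add X.rank))
  rightUnitor X := eqToIso (congrArg mk (Nat.add_zero X.rank))

lemma tensor_id (X Y : ParCat t) :
    MonoidalCategoryStruct.tensorHom (𝟙 X) (𝟙 Y) = 𝟙 (MonoidalCategoryStruct.tensorObj X Y) :=
  Quot.sound (.tensor_id _ _)

lemma tensor_comp_eqToHom (f : ParHom t a b) (g : ParHom t a' b') (hk : k = a + a')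
    (hl : l = b + b') {l' : ℕ} (h : l = l') :
    (show (⟨k⟩ : ParCat t) ⟶ ⟨l⟩ from f.tensor g hk hl) ≫ eqToHom (congrArg mk h) =
      f.tensor g hk (h ▸ hl) := by
  subst h
  exact Category.comp_id _

lemma eqToHom_comp_tensor (f : ParHom t a b) (g : ParHom t a' b') (hk : k = a + a')
    (hl : l = b + b') {k' : ℕ} (h : k' = k) :
    eqToHom (congrArg mk h) ≫ (show (⟨k⟩ : ParCat t) ⟶ ⟨l⟩ from f.tensor g hk hl) =
      f.tensor g (h.trans hk) hl := by
  subst h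
  exact Category.id_comp _

instance : MonoidalCategory (ParCat t) :=
  MonoidalCategory.ofTensorHom
    (id_tensorHom_id := tensor_id)
    (id_tensorHom := fun _ _ _ _ => rfl)
    (tensorHom_id := fun _ _ => rfl)
    (tensorHom_comp_tensorHom := fun f₁ f₂ g₁ g₂ => ParHom.interchange f₁ g₁ f₂ g₂ rfl rfl rfl)
    (associator_naturality := fun {_ _ _ _ _ _} f₁ f₂ f₃ =>
      (tensor_comp_eqToHom _ _ _ _ (Nat.add_assoc _ _ _)).trans
        ((ParHom.tensor_assoc f₁ f₂ f₃ _ _ rfl rfl _ _ (Nat.add_assoc _ _ _) rfl).trans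
          (eqToHom_comp_tensor _ _ _ _ (Nat.add_assoc _ _ _)).symm))
    (leftUnitor_naturality := fun {X Y} f => by
      refine (tensor_comp_eqToHom _ _ _ _ (Nat.zero_add _)).trans ?_
      have h := eqToHom_comp_tensor (t := t) (ParHom.mk (.id 0)) f (Nat.zero_add _).symm
        (Nat.zero_add _).symm (Nat.zero_add X.rank)
      rw [ParHom.unit_tensor] at h
      exact h.symm)
    (rightUnitor_naturality := fun {X Y} f => by
      refine (tensor_comp_eqToHom _ _ _ _ (Nat.add_zero _)).trans ?_
      exact (ParHom.tensor_unit f _ _).trans (Category.id_comp _).symm)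
    (pentagon := fun W X Y Z => by
      simp only [MonoidalCategoryStruct.associator, eqToIso.hom, eqToHom_tensor_id tensor_id,
        id_tensor_eqToHom tensor_id, eqToHom_trans])
    (triangle := fun X Y => by
      simp only [MonoidalCategoryStruct.associator, MonoidalCategoryStruct.leftUnitor,
        MonoidalCategoryStruct.rightUnitor, eqToIso.hom, eqToHom_tensor_id tensor_id,
        id_tensor_eqToHom tensor_id, eqToHom_trans])

lemma whiskerLeft_add' (X : ParCat t) {Y Z : ParCat t} (f g : Y ⟶ Z) :
    X ◁ (f + g) = X ◁ f + X ◁ g := ParHom.tensor_add _ f g rfl rfl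

lemma add_whiskerRight' (X : ParCat t) {Y Z : ParCat t} (f g : Y ⟶ Z) :
    (f + g) ▷ X = f ▷ X + g ▷ X := ParHom.add_tensor f g _ rfl rfl

lemma whiskerLeft_smul' (X : ParCat t) {Y Z : ParCat t} (r : ℂ) (f : Y ⟶ Z) :
    X ◁ (r • f) = r • (X ◁ f) := ParHom.tensor_smul r _ f rfl rfl

lemma smul_whiskerRight' (r : ℂ) {Y Z : ParCat t} (f : Y ⟶ Z) (X : ParCat t) :
    (r • f) ▷ X = r • (f ▷ X) := ParHom.smul_tensor r f _ rfl rfl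

instance : MonoidalPreadditive (ParCat t) where
  whiskerLeft_zero {X Y Z} := by
    have h := whiskerLeft_smul' X (0 : ℂ) (0 : Y ⟶ Z)
    rwa [zero_smul, zero_smul] at h
  zero_whiskerRight {X Y Z} := by
    have h := smul_whiskerRight' (0 : ℂ) (0 : Y ⟶ Z) X
    rwa [zero_smul, zero_smul] at h
  whiskerLeft_add f g := whiskerLeft_add' _ f g
  add_whiskerRight f g := add_whiskerRight' _ f g

instance : MonoidalLinear ℂ (ParCat t) where
  whiskerLeft_smul X _ _ r f := whiskerLeft_smul' X r f
  smul_whiskerRight r _ _ f X := smul_whiskerRight' r f X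

/-- The generating object. -/
def W (t : ℂ) : ParCat t := ⟨1⟩

def neutralizer (t : ℂ) : W t ⊗ W t ⟶ W t ⊗ W t := ParHom.mk .neutralizer

def cap (t : ℂ) : W t ⊗ W t ⟶ 𝟙_ (ParCat t) := ParHom.mk .cap

def cup (t : ℂ) : 𝟙_ (ParCat t) ⟶ W t ⊗ W t := ParHom.mk .cup

def cross (t : ℂ) : W t ⊗ W t ⟶ W t ⊗ W t := ParHom.mk .cross

end ParCat

namespace ReflectionCat

/-- `{{1,2,1',2'}}` -/
noncomputable def fourLegs (t : ℂ) : (⟨2⟩ : ReflectionCat t) ⟶ ⟨2⟩ :=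
  ofPartition (EvenPartition.block 2 2 (by decide))

/-- `{{1,2}}` -/
noncomputable def cap (t : ℂ) : (⟨2⟩ : ReflectionCat t) ⟶ ⟨0⟩ :=
  ofPartition (EvenPartition.block 2 0 (by decide))

/-- `{{1',2'}}` -/
noncomputable def cup (t : ℂ) : (⟨0⟩ : ReflectionCat t) ⟶ ⟨2⟩ :=
  ofPartition (EvenPartition.block 0 2 (by decide))

/-- `{{1,2'},{2,1'}}` -/
noncomputable def cross (t : ℂ) : (⟨2⟩ : ReflectionCat t) ⟶ ⟨2⟩ :=
  ofPartition (EvenPartition.perm (Equiv.swap 0 1))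

end ReflectionCat

/-! ### Isomorphisms of `ℂ`-linear symmetric monoidal categories -/

/-- An isomorphism of strict `ℂ`-linear symmetric monoidal categories: an isomorphism of categories
that is `ℂ`-linear, strictly monoidal and compatible with the symmetries. -/
structure SymmetricIso (C D : Type) [Category.{0} C] [Preadditive C] [Linear ℂ C]
    [MonoidalCategory C] [MonoidalPreadditive C] [MonoidalLinear ℂ C] [SymmetricCategory C]
    [Category.{0} D] [Preadditive D] [Linear ℂ D] [MonoidalCategory D] [MonoidalPreadditive D]
    [MonoidalLinear ℂ D] [SymmetricCategory D] where
  functor : C ⥤ D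
  inverse : D ⥤ C
  functor_inverse : functor ⋙ inverse = 𝟭 C
  inverse_functor : inverse ⋙ functor = 𝟭 D
  additive : functor.Additive
  linear : functor.Linear ℂ
  braided : functor.Braided
  unit_obj : 𝟙_ D = functor.obj (𝟙_ C)
  tensor_obj : ∀ X Y : C, functor.obj X ⊗ functor.obj Y = functor.obj (X ⊗ Y)
  ε_eq : Functor.LaxMonoidal.ε functor = eqToHom unit_obj
  μ_eq : ∀ X Y : C, Functor.LaxMonoidal.μ functor X Y = eqToHom (tensor_obj X Y)

/-- `End(𝟙) = ℂ`. -/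
def ScalarEndUnit (C : Type) [Category.{0} C] [Preadditive C] [Linear ℂ C] [MonoidalCategory C] :
    Prop :=
  Function.Bijective fun c : ℂ => c • 𝟙 (𝟙_ C)

end PartitionDiagram

/-! The functor is the identity on ranks and evaluates each generator to its partition. What has to
be shown is that evaluation from `Hom(W^{⊗k}, W^{⊗l})` to `ℂ P_even(k,l)` is well defined
(`Word.eval_eq_of_rel`) and bijective (`ParHom.toLin_bijective`). The inverse functor, the symmetry
of `Par_t` and the scalars of its unit are then pulled back along this bijection.

Well-definedness: a partition together with a number `c` of loops is recorded faithfully by the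
matrix, indexed by two-colourings of the rows, with entry `2 ^ c` at the colourings constant on
blocks and `0` elsewhere (`mat_inj`). Stacking becomes the matrix product and juxtaposition the
product of entries. Hence each listed relation, apart from the evaluation of the circle, is an
equality of two small matrices over `ℕ` and is settled by computation; its reflections follow by
transposing the matrices and reversing the colourings.

Bijectivity: bending strands reduces it to morphisms out of the unit. The crossings satisfy the
Coxeter relations, so the symmetric groups act, and conjugates of the neutralizer give elements
`link i j` for arbitrary positions. These are commuting idempotents, transitive in the sense of
`link_mul_link`, and `link i j` absorbs the transposition of `i` and `j`. A morphism made of cups,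
permutations and links is called standard. It has a normal form (`Std.normal_form`): cups, then a
permutation that places each cup inside a block, then the product of all links inside blocks. The
normal form depends on the partition only (`Std.unique`): each block receives half as many cups as
it has points, so two admissible permutations differ by a permutation of the cups, which the cups
absorb, and a block preserving permutation, which the links absorb.

Standard morphisms span (`stdSpan_eq_top`). The delicate generator is the cap. It absorbs a
neutralizer, so the two points to be closed may be assumed to be connected; by uniqueness the
standard morphism may then be replaced by one in which this pair was added last, and there the
closure is again standard, up to a factor `t` when the pair is a block of its own (`Std.closeLast`).
Every even partition comes from a standard morphism (`exists_std`), and a standard morphism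
evaluates to its partition (`Std.rep`), so evaluation is bijective on morphisms out of the unit. -/

/-! ### The Coxeter presentation of the symmetric group -/

namespace CoxeterLift

variable {M : Type*} [Monoid M]

/-- The relations of the adjacent transpositions `s 0, …, s (N - 2)` of `N` points. -/
structure Relations (N : ℕ) (s : ℕ → M) : Prop where
  sq : ∀ i, i + 2 ≤ N → s i * s i = 1
  braid : ∀ i, i + 3 ≤ N → s i * s (i + 1) * s i = s (i + 1) * s i * s (i + 1)
  comm : ∀ i j, i + 2 ≤ j → j + 2 ≤ N → s i * s j = s j * s i

lemma Relations.mono {N N' : ℕ} {s : ℕ → M} (h : Relations N s) (hN : N' ≤ N) :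
    Relations N' s where
  sq i hi := h.sq i (by omega)
  braid i hi := h.braid i (by omega)
  comm i j hij hj := h.comm i j hij (by omega)

/-- The descending product `s (k - 1) * ⋯ * s (k - d)`. -/
def run (s : ℕ → M) (k : ℕ) : ℕ → M
  | 0 => 1
  | d + 1 => run s k d * s (k - 1 - d)

def gens (s : ℕ → M) (k : ℕ) : Submonoid M := Submonoid.closure {x | ∃ i, i + 2 ≤ k ∧ x = s i}

lemma mem_gens (s : ℕ → M) {k i : ℕ} (hi : i + 2 ≤ k) : s i ∈ gens s k :=
  Submonoid.subset_closure ⟨i, hi, rfl⟩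

/-- Generators below the run commute with it. -/
lemma run_mul_low {k : ℕ} {s : ℕ → M} (h : Relations (k + 1) s) (i : ℕ) :
    ∀ d, i + d + 2 ≤ k → run s k d * s i = s i * run s k d
  | 0, _ => by simp [run]
  | d + 1, hd => by
    have ih := run_mul_low h i d (by omega)
    rw [run, mul_assoc, ← h.comm i (k - 1 - d) (by omega) (by omega), ← mul_assoc, ih, mul_assoc]

/-- Generators inside the run move through it with a shift. -/
lemma run_mul_high {k : ℕ} {s : ℕ → M} (h : Relations (k + 1) s) (i : ℕ) :
    ∀ d, d ≤ k → k < i + 1 + d → i + 1 < k → run s k d * s (i + 1) = s i * run s k d := by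
  intro d
  induction d with
  | zero => intro _ h1 h2; omega
  | succ d ih =>
    intro hd h1 h2
    by_cases hlt : k < i + 1 + d
    · rw [run, mul_assoc, h.comm (k - 1 - d) (i + 1) (by omega) (by omega), ← mul_assoc,
        ih (by omega) hlt h2, mul_assoc]
    · obtain ⟨e, rfl⟩ : ∃ e, d = e + 1 := ⟨d - 1, by omega⟩
      have e1 : k - 1 - (e + 1) = i := by omega
      have e2 : k - 1 - e = i + 1 := by omega
      have h3 := run_mul_low h i e (by omega)
      rw [run, run, e1, e2]
      calc run s k e * s (i + 1) * s i * s (i + 1)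
          = run s k e * (s (i + 1) * s i * s (i + 1)) := by simp only [mul_assoc]
        _ = run s k e * s i * (s (i + 1) * s i) := by
            rw [← h.braid i (by omega)]; simp only [mul_assoc]
        _ = _ := by rw [h3]; simp only [mul_assoc]

/-- Coset decomposition of the symmetric group on `k + 1` points by the one on `k` points, carried
out in any monoid with the relations: the set of products `u * run s k d` contains `1` and is stable
under right multiplication by the generators. -/
lemma exists_run {k : ℕ} {s : ℕ → M} (h : Relations (k + 1) s) {x : M}
    (hx : x ∈ gens s (k + 1)) : ∃ u ∈ gens s k, ∃ d ≤ k, x = u * run s k d := by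
  induction hx using Submonoid.closure_induction_right with
  | one => exact ⟨1, one_mem _, 0, Nat.zero_le _, by simp [run]⟩
  | mul_right x _ y hy ih =>
    obtain ⟨i, hi, rfl⟩ := hy
    obtain ⟨u, hu, d, hd, rfl⟩ := ih
    -- For `d > 0` the run ends in `s (k - d)`. An index below `k - d - 1` commutes out to the left,
    -- the index `k - d - 1` prolongs the run, the index `k - d` cancels its last letter, and a
    -- larger index passes through and drops by one.
    rcases lt_trichotomy (i + 1 + d) k with h1 | h1 | h1
    · refine ⟨u * s i, mul_mem hu (mem_gens s (by omega)), d, hd, ?_⟩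
      rw [mul_assoc, run_mul_low h i d (by omega), mul_assoc]
    · refine ⟨u, hu, d + 1, by omega, ?_⟩
      rw [run, mul_assoc, show k - 1 - d = i by omega]
    · by_cases h2 : k = i + d
      · obtain ⟨e, rfl⟩ : ∃ e, d = e + 1 := ⟨d - 1, by omega⟩
        refine ⟨u, hu, e, by omega, ?_⟩
        rw [run, show k - 1 - e = i by omega, mul_assoc, mul_assoc, h.sq i hi, mul_one]
      · obtain ⟨j, rfl⟩ : ∃ j, i = j + 1 := ⟨i - 1, by omega⟩
        refine ⟨u * s j, mul_mem hu (mem_gens s (by omega)), d, hd, ?_⟩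
        rw [mul_assoc, run_mul_high h j d hd (by omega) (by omega), mul_assoc]

/-- The transposition of `i` and `i + 1`. -/
def adj (i : ℕ) : Equiv.Perm ℕ := Equiv.swap i (i + 1)

lemma adj_relations (N : ℕ) : Relations N adj where
  sq i _ := Equiv.swap_mul_self _ _
  braid i _ := by
    have h1 := Equiv.swap_mul_swap_mul_swap (x := i + 2) (y := i + 1) (z := i) (by omega) (by omega)
    have h2 := Equiv.swap_mul_swap_mul_swap (x := i) (y := i + 1) (z := i + 2) (by omega) (by omega)
    rw [Equiv.swap_comm (i + 1) i, Equiv.swap_comm (i + 2) (i + 1)] at h1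
    rw [adj, adj, show i + 1 + 1 = i + 2 from rfl, h1, h2, Equiv.swap_comm]
  comm i j hij _ :=
    (Equiv.Perm.disjoint_swap_swap (by simp; omega)).commute

lemma gens_adj_apply {k m : ℕ} (hm : k ≤ m) {σ : Equiv.Perm ℕ} (h : σ ∈ gens adj k) : σ m = m := by
  induction h using Submonoid.closure_induction with
  | mem x hx =>
    obtain ⟨i, hi, rfl⟩ := hx
    exact Equiv.swap_apply_of_ne_of_ne (by omega) (by omega)
  | one => rfl
  | mul x y _ _ hx hy => rw [Equiv.Perm.mul_apply, hy, hx]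

/-- The run of length `d` is recognised by the point that it moves to `k`; this separates the
cosets. -/
lemma run_adj_apply (k : ℕ) : ∀ d, d ≤ k → run adj k d (k - d) = k
  | 0, _ => rfl
  | d + 1, h => by
    rw [run, Equiv.Perm.mul_apply, show k - (d + 1) = k - 1 - d by omega, adj, Equiv.swap_apply_left,
      show k - 1 - d + 1 = k - d by omega, run_adj_apply k d (by omega)]

lemma run_prod {M' : Type*} [Monoid M'] (s : ℕ → M) (s' : ℕ → M') (k : ℕ) :
    ∀ d, run (fun i => (s i, s' i)) k d = (run s k d, run s' k d)
  | 0 => rfl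
  | d + 1 => by rw [run, run_prod s s' k d]; rfl

lemma gens_fst {M' : Type*} [Monoid M'] (s : ℕ → M) (s' : ℕ → M') (k : ℕ) {x : M × M'}
    (hx : x ∈ gens (fun i => (s i, s' i)) k) : x.1 ∈ gens s k := by
  induction hx using Submonoid.closure_induction with
  | mem x hx =>
    obtain ⟨i, hi, rfl⟩ := hx
    exact mem_gens s hi
  | one => exact one_mem _
  | mul x y _ _ hx hy => exact mul_mem hx hy

lemma Relations.prod {M' : Type*} [Monoid M'] {N : ℕ} {s : ℕ → M} {s' : ℕ → M'}
    (h : Relations N s) (h' : Relations N s') : Relations N (fun i => (s i, s' i)) where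
  sq i hi := Prod.ext (h.sq i hi) (h'.sq i hi)
  braid i hi := Prod.ext (h.braid i hi) (h'.braid i hi)
  comm i j hij hj := Prod.ext (h.comm i j hij hj) (h'.comm i j hij hj)

/-- A word whose permutation is trivial has a trivial value wherever the relations hold. Permutation
and value are carried along as a pair, so that one coset decomposition serves both; induction on the
number of points then strips off the runs. -/
lemma snd_eq_one {s : ℕ → M} : ∀ {N : ℕ}, Relations N s → ∀ {x : Equiv.Perm ℕ × M},
    x ∈ gens (fun i => (adj i, s i)) N → x.1 = 1 → x.2 = 1
  | 0, _, x, hx, _ => by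
    have : {x | ∃ i, i + 2 ≤ 0 ∧ x = (adj i, s i)} = ∅ := by
      ext; simp
    rw [gens, this, Submonoid.closure_empty, Submonoid.mem_bot] at hx
    rw [hx]; rfl
  | k + 1, h, x, hx, h1 => by
    obtain ⟨u, hu, d, hd, rfl⟩ := exists_run ((adj_relations _).prod h) hx
    -- `u` fixes `k` and the run moves `k - d` to `k`, so a trivial permutation forces an empty run.
    have hd0 : d = 0 := by
      have h2 := congrArg (fun σ : Equiv.Perm ℕ => σ (k - d)) h1
      simp only [run_prod, Prod.fst_mul, Equiv.Perm.mul_apply, run_adj_apply k d hd,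
        gens_adj_apply le_rfl (gens_fst _ _ _ hu), Equiv.Perm.one_apply] at h2
      omega
    subst hd0
    rw [run, mul_one] at h1 ⊢
    exact snd_eq_one (h.mono (Nat.le_succ _)) hu h1

/-- The extension of a permutation of `Fin N` to `ℕ`. -/
def extend (N : ℕ) : Equiv.Perm (Fin N) →* Equiv.Perm ℕ :=
  Equiv.Perm.extendDomainHom Fin.equivSubtype

lemma extend_apply {N : ℕ} (σ : Equiv.Perm (Fin N)) (i : ℕ) :
    extend N σ i = if h : i < N then (σ ⟨i, h⟩ : ℕ) else i := by
  split_ifs with h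
  · exact Equiv.Perm.extendDomain_apply_subtype σ Fin.equivSubtype h
  · exact Equiv.Perm.extendDomain_apply_not_subtype σ Fin.equivSubtype h

lemma extend_swap {N i : ℕ} (hi : i + 1 < N) :
    extend N (Equiv.swap ⟨i, by omega⟩ ⟨i + 1, hi⟩) = adj i := by
  ext j
  rw [extend_apply, adj]
  split_ifs with h
  · simp only [Equiv.swap_apply_def, Fin.mk.injEq]
    split_ifs <;> rfl
  · rw [Equiv.swap_apply_of_ne_of_ne (by omega) (by omega)]

lemma adjacent_closure (N : ℕ) : Submonoid.closure
    {σ : Equiv.Perm (Fin N) | ∃ (i : ℕ) (hi : i + 1 < N),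
      σ = Equiv.swap ⟨i, by omega⟩ ⟨i + 1, hi⟩} = ⊤ := by
  rcases N with _ | N
  · exact Subsingleton.elim _ _
  · rw [eq_top_iff, ← Equiv.Perm.mclosure_swap_castSucc_succ, Submonoid.closure_le]
    rintro _ ⟨i, rfl⟩
    exact Submonoid.subset_closure ⟨i, by omega, rfl⟩

lemma mul_mem_gens_extend {N : ℕ} {s : ℕ → M} {σ τ : Equiv.Perm (Fin N)} {x y : M}
    (hx : (extend N σ, x) ∈ gens (fun i => (adj i, s i)) N)
    (hy : (extend N τ, y) ∈ gens (fun i => (adj i, s i)) N) :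
    (extend N (σ * τ), x * y) ∈ gens (fun i => (adj i, s i)) N := by
  have h := mul_mem hx hy
  rwa [Prod.mk_mul_mk, ← map_mul] at h

lemma exists_lift_pair {N : ℕ} (s : ℕ → M) (σ : Equiv.Perm (Fin N)) :
    ∃ x, (extend N σ, x) ∈ gens (fun i => (adj i, s i)) N := by
  have hσ : σ ∈ (⊤ : Submonoid (Equiv.Perm (Fin N))) := trivial
  rw [← adjacent_closure] at hσ
  induction hσ using Submonoid.closure_induction with
  | mem σ h =>
    obtain ⟨i, hi, rfl⟩ := h
    rw [extend_swap]
    exact ⟨s i, mem_gens (fun i => (adj i, s i)) (by omega)⟩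
  | one => exact ⟨1, by rw [map_one]; exact one_mem _⟩
  | mul σ τ _ _ h h' =>
    obtain ⟨x, hx⟩ := h
    obtain ⟨y, hy⟩ := h'
    exact ⟨x * y, mul_mem_gens_extend hx hy⟩

end CoxeterLift

open CoxeterLift in
/-- A family that satisfies the Coxeter relations of the adjacent transpositions extends to the
symmetric group. -/
theorem exists_monoidHom_perm {M : Type*} [Monoid M] {N : ℕ} {s : ℕ → M} (h : Relations N s) :
    ∃ P : Equiv.Perm (Fin N) →* M, ∀ i (hi : i + 1 < N),
      P (Equiv.swap ⟨i, by omega⟩ ⟨i + 1, hi⟩) = s i := by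
  -- `P σ` is the value of some word for `σ`; by `huniq` all words for `σ` have this value, so
  -- multiplicativity is automatic.
  choose P hP using exists_lift_pair (M := M) (N := N) s
  have hone : ∀ σ τ x y, σ * τ = 1 → (extend N σ, x) ∈ gens (fun i => (adj i, s i)) N →
      (extend N τ, y) ∈ gens (fun i => (adj i, s i)) N → x * y = 1 := by
    intro σ τ x y hστ hx hy
    exact snd_eq_one h (mul_mem_gens_extend hx hy) (by rw [hστ, map_one])
  -- `M` is only a monoid; the value of a word for `σ⁻¹` plays the part of the inverse.
  have huniq : ∀ σ x, (extend N σ, x) ∈ gens (fun i => (adj i, s i)) N → x = P σ := by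
    intro σ x hx
    calc x = x * (P σ⁻¹ * P σ) := by
          rw [hone _ _ _ _ (inv_mul_cancel σ) (hP _) (hP _), mul_one]
      _ = P σ := by rw [← mul_assoc, hone _ _ _ _ (mul_inv_cancel σ) hx (hP _), one_mul]
  refine ⟨⟨⟨P, (huniq 1 1 ?_).symm⟩, fun σ τ => (huniq _ _ ?_).symm⟩, fun i hi =>
    (huniq _ _ ?_).symm⟩
  · rw [map_one]; exact one_mem _
  · exact mul_mem_gens_extend (hP σ) (hP τ)
  · rw [extend_swap]; exact mem_gens (fun i => (adj i, s i)) (by omega)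

namespace PartitionDiagram

/-! ### Slices of morphisms of the presented category -/

namespace ParHom

variable {t : ℂ} {a b c a' b' c' k l m n k' l' m' N M : ℕ}

/-- The identity of `W^{⊗k}`. -/
def one (t : ℂ) (k : ℕ) : ParHom t k k := mk (.id k)

lemma one_comp (f : ParHom t k l) : (one t k).comp f = f := by
  induction f using Quot.ind
  exact Quot.sound (.id_comp _)

lemma comp_one (f : ParHom t k l) : f.comp (one t l) = f := by
  induction f using Quot.ind
  exact Quot.sound (.comp_id _)

lemma comp_assoc (f : ParHom t k l) (g : ParHom t l m) (h : ParHom t m n) :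
    (f.comp g).comp h = f.comp (g.comp h) := by
  induction f using Quot.ind
  induction g using Quot.ind
  induction h using Quot.ind
  exact Quot.sound (.comp_assoc _ _ _)

lemma one_tensor_one (hk : N = a + b) (hl : N = a + b) :
    (one t a).tensor (one t b) hk hl = one t N := by
  subst hk
  exact Quot.sound (.tensor_id _ _)

lemma zero_comp (g : ParHom t l m) : (0 : ParHom t k l).comp g = 0 := by
  rw [← zero_smul ℂ (0 : ParHom t k l), smul_comp, zero_smul]

lemma zero_tensor (g : ParHom t a' b') (hk : k = a + a') (hl : l = b + b') :
    (0 : ParHom t a b).tensor g hk hl = 0 := by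
  rw [← zero_smul ℂ (0 : ParHom t a b), smul_tensor, zero_smul]

lemma tensor_zero (g : ParHom t a b) (hk : k = a + a') (hl : l = b + b') :
    g.tensor (0 : ParHom t a' b') hk hl = 0 := by
  rw [← zero_smul ℂ (0 : ParHom t a' b'), tensor_smul, zero_smul]

lemma tensor_eq_comp (f : ParHom t a b) (g : ParHom t a' b') (hk : k = a + a') (hl : l = b + b')
    (hm : m = b + a') :
    f.tensor g hk hl = (f.tensor (one t a') hk hm).comp ((one t b).tensor g hm hl) := by
  rw [interchange, comp_one, one_comp]

/-- `id ⊗ f ⊗ id`, with `a` strands on the left and `b` strands on the right of `f`. -/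
def slice (a b : ℕ) (f : ParHom t k l) (hN : N = a + k + b) (hM : M = a + l + b) : ParHom t N M :=
  ((one t a).tensor f rfl rfl).tensor (one t b) hN hM

lemma slice_zero_left (f : ParHom t k l) (hN : N = 0 + k + b) (hM : M = 0 + l + b) :
    slice 0 b f hN hM = f.tensor (one t b) (by omega) (by omega) := by
  obtain rfl : N = k + b := by omega
  obtain rfl : M = l + b := by omega
  -- The inner ranks `0 + k` and `0 + l` are generalized to variables, which can be substituted so
  -- that the unit law applies.
  have h : ∀ {k₀ l₀ : ℕ} (h1 : k₀ = k) (h2 : l₀ = l) (e1 : k₀ = 0 + k) (e2 : l₀ = 0 + l)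
      (h3 : k + b = k₀ + b) (h4 : l + b = l₀ + b),
      ((one t 0).tensor f e1 e2).tensor (one t b) h3 h4 = f.tensor (one t b) rfl rfl := by
    intro k₀ l₀ h1 h2 e1 e2 h3 h4
    subst h1 h2
    rw [one, unit_tensor]
  exact h (Nat.zero_add _) (Nat.zero_add _) _ _ _ _

lemma slice_zero_right (f : ParHom t k l) (hN : N = a + k + 0) (hM : M = a + l + 0) :
    slice a 0 f hN hM = (one t a).tensor f hN hM := by
  subst hN hM
  exact tensor_unit _ _ _

lemma slice_zero_zero (f : ParHom t k l) (hN : k = 0 + k + 0) (hM : l = 0 + l + 0) :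
    slice 0 0 f hN hM = f := by
  rw [slice_zero_left, one, tensor_unit]

lemma slice_one (a b : ℕ) (hN : N = a + k + b) (hM : N = a + k + b) :
    slice a b (one t k) hN hM = one t N := by
  rw [slice, one_tensor_one, one_tensor_one]

lemma slice_comp (a b : ℕ) (f : ParHom t k l) (g : ParHom t l m) (hN : N = a + k + b)
    (hM : M = a + l + b) (hL : n = a + m + b) :
    (slice a b f hN hM).comp (slice a b g hM hL) = slice a b (f.comp g) hN hL := by
  rw [slice, slice, interchange, interchange, one_comp, one_comp, slice]

/-- Strict associativity merges the identities on either side. All ranks are variables tied by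
equations, so no transport between bracketings enters the statement. -/
lemma slice_slice (a b c d : ℕ) (f : ParHom t k l) (h1 : k' = c + k + d) (h2 : l' = c + l + d)
    (hN : N = a + k' + b) (hM : M = a + l' + b) :
    slice a b (slice c d f h1 h2) hN hM =
      slice (a + c) (d + b) f (by omega) (by omega) := by
  subst h1 h2
  rw [slice, slice, slice, ← tensor_assoc (one t a) _ (one t d) (p := a + (c + k))
    (q := a + (c + l)) rfl rfl _ _ (by omega) (by omega),
    tensor_assoc _ (one t d) (one t b) (p' := d + b) (q' := d + b) _ _ rfl rfl _ _ (by omega)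
      (by omega), one_tensor_one]
  have h : ∀ {p q : ℕ} (h1 : p = a + c + k) (h2 : q = a + c + l) (h3 : p = a + (c + k))
      (h4 : q = a + (c + l)) (h5 : N = p + (d + b)) (h6 : M = q + (d + b)),
      ((one t a).tensor ((one t c).tensor f rfl rfl) h3 h4).tensor (one t (d + b)) h5 h6 =
      ((one t (a + c)).tensor f rfl rfl).tensor (one t (d + b)) (by omega) (by omega) := by
    intro p q h1 h2 h3 h4 h5 h6
    subst h1 h2
    rw [← one_tensor_one (t := t) (a := a) (b := c) rfl rfl,
      tensor_assoc (one t a) (one t c) f rfl rfl rfl rfl]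
  exact h (by omega) (by omega) _ _ _ _

lemma slice_add (a b : ℕ) (f g : ParHom t k l) (hN : N = a + k + b) (hM : M = a + l + b) :
    slice a b (f + g) hN hM = slice a b f hN hM + slice a b g hN hM := by
  rw [slice, tensor_add, add_tensor, slice, slice]

lemma slice_smul (a b : ℕ) (r : ℂ) (f : ParHom t k l) (hN : N = a + k + b) (hM : M = a + l + b) :
    slice a b (r • f) hN hM = r • slice a b f hN hM := by
  rw [slice, tensor_smul, smul_tensor, slice]

lemma slice_zero (a b : ℕ) (hN : N = a + k + b) (hM : M = a + l + b) :
    slice a b (0 : ParHom t k l) hN hM = 0 := by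
  rw [slice, tensor_zero, zero_tensor]

lemma one_tensor_eq (f : ParHom t k l) (hN : N = a + k) (hM : M = a + l) :
    (one t a).tensor f hN hM = slice a 0 f hN hM := (slice_zero_right f _ _).symm

lemma tensor_one_eq (f : ParHom t k l) (hN : N = k + b) (hM : M = l + b) :
    f.tensor (one t b) hN hM = slice 0 b f (by omega) (by omega) := (slice_zero_left f _ _).symm

/-- Slices at distant positions commute. -/
lemma slice_interchange (a c b : ℕ) (f : ParHom t k l) (g : ParHom t k' l')
    {b₁ b₂ a₁ a₂ : ℕ} (hb₁ : b₁ = c + k' + b) (hb₂ : b₂ = c + l' + b) (ha₁ : a₁ = a + l + c)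
    (ha₂ : a₂ = a + k + c) (h1 : N = a + k + b₁) (h2 : M = a + l + b₁) (h3 : M = a₁ + k' + b)
    (h4 : n = a₁ + l' + b) (h5 : N = a₂ + k' + b) (h6 : m = a₂ + l' + b) (h7 : m = a + k + b₂)
    (h8 : n = a + l + b₂) :
    (slice a b₁ f h1 h2).comp (slice a₁ b g h3 h4) =
      (slice a₂ b g h5 h6).comp (slice a b₂ f h7 h8) := by
  subst hb₁ hb₂ ha₁ ha₂
  -- With the strands left of `g` split as `p + c`, both composites become the tensor product of
  -- `1_a ⊗ f` and the slice `G` of `g`.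
  have e : ∀ p, ∀ {N M : ℕ} (h3 : N = p + c + k' + b) (h4 : M = p + c + l' + b),
      slice (p + c) b g h3 h4 =
      (one t p).tensor (slice c b g rfl rfl) (by omega) (by omega) := by
    intro p N M h3 h4
    rw [one_tensor_eq, slice_slice]
    rfl
  rw [e (a + l), e (a + k)]
  generalize slice c b g rfl rfl = G
  rw [slice, slice, interchange, interchange, comp_one, one_comp,
    one_comp, comp_one]

/-! ### Generators and relations -/

def neut (t : ℂ) : ParHom t 2 2 := mk .neutralizer
def cap (t : ℂ) : ParHom t 2 0 := mk .cap
def cup (t : ℂ) : ParHom t 0 2 := mk .cup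
def cross (t : ℂ) : ParHom t 2 2 := mk .cross

lemma mk_strandRight (w : Word k l) :
    mk (t := t) (.strandRight w) = slice 0 1 (mk w) (by omega) (by omega) := by
  rw [slice_zero_left]
  rfl

lemma mk_strandLeft (w : Word k l) :
    mk (t := t) (.strandLeft w) = slice 1 0 (mk w) (by omega) (by omega) := by
  rw [slice_zero_right]
  rfl

lemma neut_comp_neut : (neut t).comp (neut t) = neut t :=
  Quot.sound (.listed .neutralizer_idem)

lemma cup_comp_cap : (cup t).comp (cap t) = t • one t 0 :=
  Quot.sound (.listed .circle)

lemma cup_comp_neut : (cup t).comp (neut t) = cup t :=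
  Quot.sound (.listed .neutralizer_cup)

lemma neut_comp_cap : (neut t).comp (cap t) = cap t :=
  Quot.sound (.listed_flipV .neutralizer_cup)

lemma cross_comp_cross : (cross t).comp (cross t) = one t 2 :=
  Quot.sound (.listed .cross_cross)

lemma cross_comp_neut : (cross t).comp (neut t) = neut t :=
  Quot.sound (.listed .neutralizer_cross)

lemma neut_comp_cross : (neut t).comp (cross t) = neut t :=
  Quot.sound (.listed_flipV .neutralizer_cross)

lemma zigzag_left : (slice 0 1 (cup t) (N := 1) (M := 3) rfl rfl).comp
    (slice 1 0 (cap t) (M := 1) rfl rfl) = one t 1 := by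
  have h := Quot.sound (Word.Rel.listed (t := t) .zigzag_left)
  exact (congrArg₂ comp (mk_strandRight .cup).symm (mk_strandLeft .cap).symm).trans h

lemma neut_slide : (slice 0 1 (cup t) (N := 1) (M := 3) rfl rfl).comp
    (slice 1 0 (neut t) (M := 3) rfl rfl) =
    (slice 1 0 (cup t) (N := 1) (M := 3) rfl rfl).comp (slice 0 1 (neut t) (M := 3) rfl rfl) := by
  have h := Quot.sound (Word.Rel.listed (t := t) .neutralizer_slide)
  exact (congrArg₂ comp (mk_strandRight .cup).symm (mk_strandLeft .neutralizer).symm).trans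
    (h.trans (congrArg₂ comp (mk_strandLeft .cup) (mk_strandRight .neutralizer)))

lemma neut_comm : (slice 0 1 (neut t) (N := 3) (M := 3) rfl rfl).comp
    (slice 1 0 (neut t) (M := 3) rfl rfl) =
    (slice 1 0 (neut t) (N := 3) (M := 3) rfl rfl).comp (slice 0 1 (neut t) (M := 3) rfl rfl) := by
  have h := Quot.sound (Word.Rel.listed (t := t) .neutralizer_comm)
  exact (congrArg₂ comp (mk_strandRight .neutralizer).symm (mk_strandLeft .neutralizer).symm).trans
    (h.trans (congrArg₂ comp (mk_strandLeft .neutralizer) (mk_strandRight .neutralizer)))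

lemma cross_braid : (slice 0 1 (cross t) (N := 3) (M := 3) rfl rfl).comp
    ((slice 1 0 (cross t) (M := 3) rfl rfl).comp (slice 0 1 (cross t) (M := 3) rfl rfl)) =
    (slice 1 0 (cross t) (N := 3) (M := 3) rfl rfl).comp
      ((slice 0 1 (cross t) (M := 3) rfl rfl).comp (slice 1 0 (cross t) (M := 3) rfl rfl)) := by
  have h := Quot.sound (Word.Rel.listed (t := t) .braid)
  have hr := (mk_strandRight (t := t) .cross)
  have hl := (mk_strandLeft (t := t) .cross)
  exact (congrArg₂ comp hr.symm (congrArg₂ comp hl.symm hr.symm)).trans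
    (h.trans (congrArg₂ comp hl (congrArg₂ comp hr hl)))

lemma neut_past : (slice 1 0 (cross t) (N := 3) (M := 3) rfl rfl).comp
    ((slice 0 1 (cross t) (M := 3) rfl rfl).comp (slice 1 0 (neut t) (M := 3) rfl rfl)) =
    (slice 0 1 (neut t) (N := 3) (M := 3) rfl rfl).comp
      ((slice 1 0 (cross t) (M := 3) rfl rfl).comp (slice 0 1 (cross t) (M := 3) rfl rfl)) := by
  have h := Quot.sound (Word.Rel.listed (t := t) .neutralizer_past_strand)
  have hr := (mk_strandRight (t := t) .cross)
  have hl := (mk_strandLeft (t := t) .cross)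
  exact (congrArg₂ comp hl.symm (congrArg₂ comp hr.symm (mk_strandLeft .neutralizer).symm)).trans
    (h.trans (congrArg₂ comp (mk_strandRight .neutralizer) (congrArg₂ comp hl hr)))

lemma cap_past : (slice 1 0 (cross t) (N := 3) (M := 3) rfl rfl).comp
    ((slice 0 1 (cross t) (M := 3) rfl rfl).comp (slice 1 0 (cap t) (M := 1) rfl rfl)) =
    slice 0 1 (cap t) (N := 3) (M := 1) rfl rfl := by
  have h := Quot.sound (Word.Rel.listed (t := t) .cap_past_strand)
  have hr := (mk_strandRight (t := t) .cross)
  have hl := (mk_strandLeft (t := t) .cross)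
  exact (congrArg₂ comp hl.symm (congrArg₂ comp hr.symm (mk_strandLeft .cap).symm)).trans
    (h.trans (mk_strandRight .cap))

lemma cup_past : ((slice 1 0 (cup t) (N := 1) (M := 3) rfl rfl).comp
    (slice 0 1 (cross t) (M := 3) rfl rfl)).comp (slice 1 0 (cross t) (M := 3) rfl rfl) =
    slice 0 1 (cup t) (N := 1) (M := 3) rfl rfl := by
  have h := Quot.sound (Word.Rel.listed_flipV (t := t) .cap_past_strand)
  have hr := (mk_strandRight (t := t) .cross)
  have hl := (mk_strandLeft (t := t) .cross)
  exact (congrArg₂ comp (congrArg₂ comp (mk_strandLeft .cup).symm hr.symm) hl.symm).trans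
    (h.trans (mk_strandRight .cup))

end ParHom

end PartitionDiagram

namespace PartitionDiagram

namespace ParHom

variable {t : ℂ} {a b c a' b' c' k l m n k' l' m' N M : ℕ}

/-! ### The symmetric groups act -/

/-- The product of endomorphisms is that of functions: `f * g` is `f` after `g`. -/
instance : Monoid (ParHom t n n) where
  mul f g := g.comp f
  one := one t n
  mul_assoc f g h := (comp_assoc h g f).symm
  one_mul := comp_one
  mul_one := one_comp

lemma mul_def (f g : ParHom t n n) : f * g = g.comp f := rfl

lemma one_def : (1 : ParHom t n n) = one t n := rfl

lemma comp_mul (x : ParHom t k n) (f g : ParHom t n n) : x.comp (f * g) = (x.comp g).comp f :=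
  (comp_assoc x g f).symm

lemma comp_one' (x : ParHom t k n) : x.comp (1 : ParHom t n n) = x := comp_one x

/-- The endomorphism `f` of `W ⊗ W` at the positions `i` and `i + 1`. -/
def at2 (f : ParHom t 2 2) (n i : ℕ) : ParHom t n n :=
  -- The identity out of range makes this a family indexed by all of `ℕ`, the form in which
  -- `CoxeterLift.Relations` is stated.
  if h : i + 2 ≤ n then slice i (n - i - 2) f (by omega) (by omega) else 1

lemma at2_eq (f : ParHom t 2 2) {i : ℕ} (hN : n = i + 2 + b) (hM : n = i + 2 + b) :
    slice i b f hN hM = at2 f n i := by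
  obtain rfl : b = n - i - 2 := by omega
  rw [at2, dif_pos (by omega)]

lemma at2_mul (f g : ParHom t 2 2) {i : ℕ} (h : i + 2 ≤ n) :
    at2 f n i * at2 g n i = at2 (f * g) n i := by
  obtain ⟨b, rfl⟩ := Nat.exists_eq_add_of_le h
  simp only [← at2_eq _ rfl rfl]
  exact slice_comp _ _ _ _ _ _ _

lemma at2_one {i : ℕ} : at2 (1 : ParHom t 2 2) n i = 1 := by
  unfold at2
  split_ifs with h
  · exact slice_one _ _ _ _
  · rfl

lemma at2_comm (f g : ParHom t 2 2) {i j : ℕ} (hij : i + 2 ≤ j) (h : j + 2 ≤ n) :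
    at2 f n i * at2 g n j = at2 g n j * at2 f n i := by
  obtain ⟨c, rfl⟩ := Nat.exists_eq_add_of_le hij
  obtain ⟨b, rfl⟩ := Nat.exists_eq_add_of_le h
  rw [← at2_eq f (b := c + 2 + b) (by omega) (by omega), ← at2_eq g rfl rfl]
  exact (slice_interchange i c b f g rfl rfl rfl rfl _ _ _ _ _ _ _ _).symm

/-- The tensor product with identities, as a homomorphism. -/
def strandsHom (t : ℂ) (a b n : ℕ) : ParHom t n n →* ParHom t (a + n + b) (a + n + b) where
  toFun f := slice a b f rfl rfl
  map_one' := slice_one _ _ _ _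
  map_mul' _ _ := (slice_comp _ _ _ _ _ _ _).symm

lemma strandsHom_at2 (f : ParHom t 2 2) {i : ℕ} (h : i + 2 ≤ n) :
    strandsHom t a b n (at2 f n i) = at2 f (a + n + b) (a + i) := by
  obtain ⟨c, rfl⟩ := Nat.exists_eq_add_of_le h
  rw [← at2_eq f rfl rfl]
  exact (slice_slice _ _ _ _ _ _ _ _ _).trans (at2_eq _ _ _)

/-- Identities between endomorphisms of `W^{⊗3}` at the positions `i`, `i + 1`, `i + 2`. -/
lemma at2_zero_eq (f : ParHom t 2 2) (i : ℕ) :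
    at2 f (i + 3 + b) i = strandsHom t i b 3 (slice 0 1 f rfl rfl) := by
  rw [at2_eq, strandsHom_at2 f (by omega)]
  rfl

lemma at2_one_eq (f : ParHom t 2 2) (i : ℕ) :
    at2 f (i + 3 + b) (i + 1) = strandsHom t i b 3 (slice 1 0 f rfl rfl) := by
  rw [at2_eq, strandsHom_at2 f (by omega)]

/-- The braid relation is the image under `strandsHom` of the listed one on three strands; distant
crossings commute by the interchange law. -/
lemma cross_relations (t : ℂ) (n : ℕ) : CoxeterLift.Relations n (at2 (cross t) n) where
  sq i hi := by
    rw [at2_mul _ _ hi, mul_def, cross_comp_cross]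
    exact at2_one
  braid i hi := by
    obtain ⟨b, rfl⟩ := Nat.exists_eq_add_of_le hi
    rw [at2_zero_eq, at2_one_eq, ← map_mul, ← map_mul, ← map_mul, ← map_mul]
    exact congrArg _ cross_braid
  comm i j hij hj := at2_comm _ _ hij hj

/-- The action of the symmetric group by crossings. -/
noncomputable def perm (t : ℂ) (n : ℕ) : Equiv.Perm (Fin n) →* ParHom t n n :=
  (exists_monoidHom_perm (cross_relations t n)).choose

lemma perm_adjacent {i : ℕ} (hi : i + 1 < n) :
    perm t n (Equiv.swap ⟨i, by omega⟩ ⟨i + 1, hi⟩) = at2 (cross t) n i :=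
  (exists_monoidHom_perm (cross_relations t n)).choose_spec i hi

lemma monoidHom_perm_ext {A : Type*} [Monoid A] {φ ψ : Equiv.Perm (Fin n) →* A}
    (h : ∀ i (hi : i + 1 < n), φ (Equiv.swap ⟨i, by omega⟩ ⟨i + 1, hi⟩) =
      ψ (Equiv.swap ⟨i, by omega⟩ ⟨i + 1, hi⟩)) : φ = ψ := by
  refine MonoidHom.eq_of_eqOn_denseM (CoxeterLift.adjacent_closure n) ?_
  rintro _ ⟨i, hi, rfl⟩
  exact h i hi

/-- The permutation `σ` of the middle points of `a + n + b` points. -/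
def midPerm (a b n : ℕ) : Equiv.Perm (Fin n) →* Equiv.Perm (Fin (a + n + b)) where
  toFun σ := sumPerm (sumPerm (Equiv.refl (Fin a)) σ) (Equiv.refl (Fin b))
  map_one' := by
    change sumPerm (sumPerm (Equiv.refl _) (Equiv.refl _)) _ = _
    rw [sumPerm_refl, sumPerm_refl]
    rfl
  map_mul' σ τ := by
    ext i
    refine Fin.addCases (fun i => Fin.addCases (fun i => ?_) (fun i => ?_) i) (fun i => ?_) i <;>
      simp

lemma midPerm_apply_left (σ : Equiv.Perm (Fin n)) (i : Fin a) :
    midPerm a b n σ (Fin.castAdd b (Fin.castAdd n i)) = Fin.castAdd b (Fin.castAdd n i) := by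
  simp [midPerm]

lemma midPerm_apply_mid (σ : Equiv.Perm (Fin n)) (i : Fin n) :
    midPerm a b n σ (Fin.castAdd b (Fin.natAdd a i)) = Fin.castAdd b (Fin.natAdd a (σ i)) := by
  simp [midPerm]

lemma midPerm_apply_right (σ : Equiv.Perm (Fin n)) (i : Fin b) :
    midPerm a b n σ (Fin.natAdd (a + n) i) = Fin.natAdd (a + n) i := by
  simp [midPerm]

lemma midPerm_swap (i j : Fin n) : midPerm a b n (Equiv.swap i j) =
    Equiv.swap (Fin.castAdd b (Fin.natAdd a i)) (Fin.castAdd b (Fin.natAdd a j)) := by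
  have hinj : Function.Injective fun i : Fin n => Fin.castAdd b (Fin.natAdd a i) :=
    (Fin.castAdd_injective _ _).comp (Fin.natAdd_injective _ _)
  refine Equiv.ext fun x => ?_
  refine Fin.addCases (fun x => Fin.addCases (fun x => ?_) (fun x => ?_) x) (fun x => ?_) x
  · rw [midPerm_apply_right, Equiv.swap_apply_of_ne_of_ne] <;> rw [Ne, Fin.ext_iff] <;>
      simp <;> omega
  · rw [midPerm_apply_left, Equiv.swap_apply_of_ne_of_ne] <;> rw [Ne, Fin.ext_iff] <;>
      simp <;> omega
  · rw [midPerm_apply_mid]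
    exact hinj.map_swap _ _ _

/-- Both sides are multiplicative in `σ`, so adjacent transpositions suffice. -/
lemma perm_midPerm (σ : Equiv.Perm (Fin n)) :
    perm t (a + n + b) (midPerm a b n σ) = slice a b (perm t n σ) rfl rfl := by
  have h : (perm t (a + n + b)).comp (midPerm a b n) = (strandsHom t a b n).comp (perm t n) := by
    refine monoidHom_perm_ext fun i hi => ?_
    rw [MonoidHom.comp_apply, MonoidHom.comp_apply, midPerm_swap, perm_adjacent hi,
      strandsHom_at2 _ (by omega), ← perm_adjacent (by omega)]
    rfl
  exact DFunLike.congr_fun h σ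

/-! ### Neutralizers between arbitrary positions -/

open Classical in
/-- The neutralizer that connects the strands `i` and `j`; the identity for `i = j`. -/
noncomputable def link (t : ℂ) {n : ℕ} (i j : Fin n) : ParHom t n n :=
  -- The result does not depend on the permutation chosen (`link_eq`). For `i = j` there is none, by
  -- injectivity.
  if h : ∃ (σ : Equiv.Perm (Fin n)) (hn : 1 < n), σ ⟨0, by omega⟩ = i ∧ σ ⟨1, hn⟩ = j then
    perm t n h.choose * at2 (neut t) n 0 * perm t n h.choose⁻¹
  else 1

lemma link_self (i : Fin n) : link t i i = 1 := by
  rw [link, dif_neg]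
  rintro ⟨σ, hn, h1, h2⟩
  have := congrArg Fin.val (σ.injective (h1.trans h2.symm))
  simp at this

/-- The stabilizer of the first two points acts on the other strands only; the shape `2 + c + 0` is
that of `midPerm 2 0 c`. -/
lemma exists_midPerm (σ : Equiv.Perm (Fin (2 + c + 0))) (h0 : σ ⟨0, by omega⟩ = ⟨0, by omega⟩)
    (h1 : σ ⟨1, by omega⟩ = ⟨1, by omega⟩) : ∃ τ : Equiv.Perm (Fin c), midPerm 2 0 c τ = σ := by
  have hge : ∀ i : Fin c, 2 ≤ (σ (Fin.castAdd 0 (Fin.natAdd 2 i)) : ℕ) := by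
    intro i
    have h : ∀ (k : ℕ) (hk : k < 2), σ ⟨k, by omega⟩ = ⟨k, by omega⟩ →
        (σ (Fin.castAdd 0 (Fin.natAdd 2 i)) : ℕ) ≠ k := by
      intro k hk hσ h
      have h2 := congrArg Fin.val (σ.injective ((Fin.ext h).trans hσ.symm))
      simp at h2
      omega
    have := h 0 (by omega) h0
    have := h 1 (by omega) h1
    omega
  let f : Fin c → Fin c := fun i => ⟨σ (Fin.castAdd 0 (Fin.natAdd 2 i)) - 2, by
    have := (σ (Fin.castAdd 0 (Fin.natAdd 2 i))).2
    have := hge i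
    omega⟩
  have hf : Function.Injective f := by
    intro i j hij
    have h2 := congrArg Fin.val hij
    have := hge i
    have := hge j
    simp only [f] at h2
    have h3 := σ.injective (Fin.ext (by omega : (σ (Fin.castAdd 0 (Fin.natAdd 2 i)) : ℕ) =
      σ (Fin.castAdd 0 (Fin.natAdd 2 j))))
    exact Fin.natAdd_injective _ _ (Fin.castAdd_injective _ _ h3)
  refine ⟨Equiv.ofBijective f (Finite.injective_iff_bijective.1 hf), Equiv.ext fun x => ?_⟩
  refine Fin.addCases (fun x => Fin.addCases (fun x => ?_) (fun x => ?_) x) (fun x => ?_) x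
  · exact x.elim0
  · rw [midPerm_apply_left]
    fin_cases x
    · exact h0.symm
    · exact h1.symm
  · rw [midPerm_apply_mid]
    refine Fin.ext ?_
    have := hge x
    simp only [Equiv.ofBijective_apply, f, Fin.val_castAdd, Fin.val_natAdd]
    omega

/-- Such a permutation is a slice on the remaining strands, and the interchange law moves it past
`f`. -/
lemma perm_comm_at2_zero (f : ParHom t 2 2) (σ : Equiv.Perm (Fin n)) (hn : 1 < n)
    (h0 : σ ⟨0, by omega⟩ = ⟨0, by omega⟩) (h1 : σ ⟨1, hn⟩ = ⟨1, hn⟩) :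
    perm t n σ * at2 f n 0 = at2 f n 0 * perm t n σ := by
  obtain ⟨c, rfl⟩ : ∃ c, n = 2 + c + 0 := Nat.exists_eq_add_of_le (by omega)
  obtain ⟨τ, rfl⟩ := exists_midPerm σ h0 h1
  rw [perm_midPerm, ← at2_eq f (b := c) (by omega) (by omega)]
  exact slice_interchange 0 0 0 f (perm t c τ) (by omega) (by omega) (by omega) (by omega)
    _ _ _ _ _ _ _ _

/-- Independence of the choice in `link`: two choices differ by a permutation that fixes the first
two positions, and this commutes with the neutralizer there. -/
lemma link_eq (σ : Equiv.Perm (Fin n)) (hn : 1 < n) :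
    link t (σ ⟨0, by omega⟩) (σ ⟨1, hn⟩) =
      perm t n σ * at2 (neut t) n 0 * perm t n σ⁻¹ := by
  have h : ∃ (τ : Equiv.Perm (Fin n)) (hn : 1 < n),
      τ ⟨0, by omega⟩ = σ ⟨0, by omega⟩ ∧ τ ⟨1, hn⟩ = σ ⟨1, hn⟩ := ⟨σ, hn, rfl, rfl⟩
  rw [link, dif_pos h]
  obtain ⟨hn', h0, h1⟩ := h.choose_spec
  set τ := h.choose
  have e := perm_comm_at2_zero (t := t) (neut t) (σ⁻¹ * τ) hn
    (by rw [Equiv.Perm.mul_apply, h0, Equiv.Perm.inv_def, Equiv.symm_apply_apply])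
    (by rw [Equiv.Perm.mul_apply, h1, Equiv.Perm.inv_def, Equiv.symm_apply_apply])
  calc perm t n τ * at2 (neut t) n 0 * perm t n τ⁻¹
      = perm t n σ * (perm t n (σ⁻¹ * τ) * at2 (neut t) n 0) * perm t n τ⁻¹ := by
        rw [← mul_assoc, ← map_mul, mul_inv_cancel_left]
    _ = perm t n σ * at2 (neut t) n 0 * perm t n (σ⁻¹ * τ * τ⁻¹) := by
        rw [e, map_mul _ (σ⁻¹ * τ)]
        simp only [mul_assoc]
    _ = _ := by rw [mul_inv_cancel_right]

lemma exists_perm_pair {i j : Fin n} (h : i ≠ j) : ∃ (σ : Equiv.Perm (Fin n)) (hn : 1 < n),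
    σ ⟨0, by omega⟩ = i ∧ σ ⟨1, hn⟩ = j := by
  have hn : 1 < n := by omega
  obtain ⟨σ, hσ⟩ := Equiv.Perm.exists_extending_pair
    (![⟨0, by omega⟩, ⟨1, hn⟩] : Fin 2 → Fin n) ![i, j]
    (by intro a b; fin_cases a <;> fin_cases b <;> simp)
    (by intro a b; fin_cases a <;> fin_cases b <;> simp [h, h.symm])
  exact ⟨σ, hn, hσ 0, hσ 1⟩

lemma perm_mul_inv (σ : Equiv.Perm (Fin n)) : perm t n σ * perm t n σ⁻¹ = 1 := by
  rw [← map_mul, mul_inv_cancel, map_one]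

lemma perm_inv_mul (σ : Equiv.Perm (Fin n)) : perm t n σ⁻¹ * perm t n σ = 1 := by
  rw [← map_mul, inv_mul_cancel, map_one]

/-- Equivariance. It reduces relations between links to the first few positions, where they come
from the presentation. -/
lemma perm_conj_link (τ : Equiv.Perm (Fin n)) (i j : Fin n) :
    perm t n τ * link t i j * perm t n τ⁻¹ = link t (τ i) (τ j) := by
  by_cases h : i = j
  · subst h
    rw [link_self, link_self, mul_one, perm_mul_inv]
  · obtain ⟨σ, hn, rfl, rfl⟩ := exists_perm_pair h
    have := link_eq (t := t) (τ * σ) hn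
    rw [Equiv.Perm.mul_apply, Equiv.Perm.mul_apply] at this
    rw [this, link_eq, map_mul, mul_inv_rev, map_mul]
    simp only [mul_assoc]

lemma perm_mul_link (τ : Equiv.Perm (Fin n)) (i j : Fin n) :
    perm t n τ * link t i j = link t (τ i) (τ j) * perm t n τ := by
  rw [← perm_conj_link, mul_assoc, perm_inv_mul, mul_one]

lemma at2_neut_zero (hn : 1 < n) :
    at2 (neut t) n 0 = link t ⟨0, by omega⟩ ⟨1, hn⟩ := by
  have := link_eq (t := t) 1 hn
  rw [inv_one, map_one, one_mul, mul_one] at this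
  exact this.symm

/-- Induction on `i`: the crossings at `i` and `i + 1` carry the positions `i, i + 1` to `i + 1, i +
2`, and by `neut_past` the neutralizer slides along with them past a strand. -/
lemma at2_neut {i : ℕ} (hi : i + 1 < n) :
    at2 (neut t) n i = link t ⟨i, by omega⟩ ⟨i + 1, hi⟩ := by
  induction i with
  | zero => exact at2_neut_zero hi
  | succ i ih =>
    have ih := ih (by omega)
    obtain ⟨b, rfl⟩ : ∃ b, n = i + 3 + b := Nat.exists_eq_add_of_le (by omega)
    have h : at2 (neut t) (i + 3 + b) (i + 1) *
        (at2 (cross t) (i + 3 + b) i * at2 (cross t) (i + 3 + b) (i + 1)) =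
        at2 (cross t) (i + 3 + b) i * at2 (cross t) (i + 3 + b) (i + 1) *
          at2 (neut t) (i + 3 + b) i := by
      rw [at2_zero_eq, at2_one_eq, at2_one_eq, at2_zero_eq, ← map_mul, ← map_mul, ← map_mul]
      refine congrArg _ ?_
      simp only [mul_def, comp_assoc]
      exact neut_past
    rw [← perm_adjacent (by omega), ← perm_adjacent (by omega), ← map_mul, ih, perm_mul_link] at h
    have h' := congrArg (· * perm t (i + 3 + b) (Equiv.swap ⟨i, by omega⟩ ⟨i + 1, by omega⟩ *
      Equiv.swap ⟨i + 1, by omega⟩ ⟨i + 1 + 1, hi⟩)⁻¹) h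
    simp only [mul_assoc, perm_mul_inv, mul_one] at h'
    rw [h']
    have e1 : Equiv.swap (⟨i + 1, by omega⟩ : Fin (i + 3 + b)) ⟨i + 1 + 1, hi⟩ ⟨i, by omega⟩ =
        ⟨i, by omega⟩ := Equiv.swap_apply_of_ne_of_ne (by simp) (by simp; omega)
    have e2 : Equiv.swap (⟨i, by omega⟩ : Fin (i + 3 + b)) ⟨i + 1, by omega⟩ ⟨i + 1 + 1, hi⟩ =
        ⟨i + 1 + 1, hi⟩ := Equiv.swap_apply_of_ne_of_ne (by simp; omega) (by simp)
    rw [Equiv.Perm.mul_apply, Equiv.Perm.mul_apply, e1, Equiv.swap_apply_left,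
      Equiv.swap_apply_left, e2]

lemma link_symm (i j : Fin n) : link t i j = link t j i := by
  by_cases h : i = j
  · rw [h]
  · obtain ⟨σ, hn, rfl, rfl⟩ := exists_perm_pair h
    rw [← perm_conj_link, ← perm_conj_link]
    congr 2
    have e := perm_conj_link (t := t) (Equiv.swap ⟨0, by omega⟩ ⟨1, hn⟩) ⟨0, by omega⟩ ⟨1, hn⟩
    rw [Equiv.swap_apply_left, Equiv.swap_apply_right, Equiv.swap_inv] at e
    rw [← e, ← at2_neut_zero]
    have e' := perm_adjacent (t := t) (n := n) (i := 0) hn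
    rw [e', at2_mul _ _ (by omega), at2_mul _ _ (by omega), mul_def, mul_def, neut_comp_cross,
      cross_comp_neut]

/-- A conjugate of `αγ = α`. Connected strands are interchangeable; this is the source of the
absorption of block preserving permutations. -/
lemma link_mul_swap (i j : Fin n) : link t i j * perm t n (Equiv.swap i j) = link t i j := by
  by_cases h : i = j
  · subst h
    rw [Equiv.swap_self]
    exact (congrArg _ (map_one _)).trans (mul_one _)
  · obtain ⟨σ, hn, rfl, rfl⟩ := exists_perm_pair h
    have e : Equiv.swap (σ ⟨0, by omega⟩) (σ ⟨1, hn⟩) =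
      σ * Equiv.swap ⟨0, by omega⟩ ⟨1, hn⟩ * σ⁻¹ := Equiv.swap_apply_apply _ _ _
    have e' := perm_adjacent (t := t) (n := n) (i := 0) hn
    have e'' : at2 (neut t) n 0 * at2 (cross t) n 0 = at2 (neut t) n 0 := by
      rw [at2_mul _ _ (by omega), mul_def, cross_comp_neut]
    rw [e, link_eq, map_mul, map_mul, e']
    calc perm t n σ * at2 (neut t) n 0 * perm t n σ⁻¹ *
          (perm t n σ * at2 (cross t) n 0 * perm t n σ⁻¹)
        = perm t n σ * at2 (neut t) n 0 * (perm t n σ⁻¹ * perm t n σ) *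
          (at2 (cross t) n 0 * perm t n σ⁻¹) := by simp only [mul_assoc]
      _ = perm t n σ * (at2 (neut t) n 0 * at2 (cross t) n 0) * perm t n σ⁻¹ := by
          rw [perm_inv_mul, mul_one]; simp only [mul_assoc]
      _ = _ := by rw [e'']

lemma perm_conj_mul (σ : Equiv.Perm (Fin n)) (f g : ParHom t n n) :
    perm t n σ * (f * g) * perm t n σ⁻¹ =
      (perm t n σ * f * perm t n σ⁻¹) * (perm t n σ * g * perm t n σ⁻¹) := by
  calc _ = perm t n σ * f * (perm t n σ⁻¹ * perm t n σ) * (g * perm t n σ⁻¹) := by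
        rw [perm_inv_mul, mul_one]; simp only [mul_assoc]
    _ = _ := by simp only [mul_assoc]

lemma link_idem (i j : Fin n) : link t i j * link t i j = link t i j := by
  by_cases h : i = j
  · subst h
    rw [link_self, mul_one]
  · obtain ⟨σ, hn, rfl, rfl⟩ := exists_perm_pair h
    rw [← perm_conj_link, ← perm_conj_mul, ← at2_neut_zero, at2_mul _ _ (by omega),
      mul_def (neut t), neut_comp_neut]

lemma commute_conj {σ : Equiv.Perm (Fin n)} {f g : ParHom t n n} (h : Commute f g) :
    Commute (perm t n σ * f * perm t n σ⁻¹) (perm t n σ * g * perm t n σ⁻¹) := by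
  rw [commute_iff_eq, ← perm_conj_mul, ← perm_conj_mul, h.eq]

/-- The listed commutation of neutralizers on three strands, transported from the positions `0, 1,
2`. -/
lemma link_comm_adjacent {i j k : Fin n} (hij : i ≠ j) (hjk : j ≠ k) (hik : i ≠ k) :
    Commute (link t i j) (link t j k) := by
  have hn : 2 < n := by omega
  obtain ⟨σ, hσ⟩ := Equiv.Perm.exists_extending_pair
    (![⟨0, by omega⟩, ⟨1, by omega⟩, ⟨2, hn⟩] : Fin 3 → Fin n) ![i, j, k]
    (by intro a b; fin_cases a <;> fin_cases b <;> simp)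
    (by intro a b; fin_cases a <;> fin_cases b <;> simp [hij, hij.symm, hjk, hjk.symm, hik, hik.symm])
  obtain rfl := hσ 0
  obtain rfl := hσ 1
  obtain rfl := hσ 2
  rw [← perm_conj_link, ← perm_conj_link]
  apply commute_conj
  obtain ⟨b, rfl⟩ : ∃ b, n = 0 + 3 + b := Nat.exists_eq_add_of_le (by omega)
  have h0 := at2_neut (t := t) (n := 0 + 3 + b) (i := 0) (by omega)
  have h1 := at2_neut (t := t) (n := 0 + 3 + b) (i := 0 + 1) (by omega)
  have h : Commute (at2 (neut t) (0 + 3 + b) 0) (at2 (neut t) (0 + 3 + b) (0 + 1)) := by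
    rw [at2_zero_eq, at2_one_eq]
    exact Commute.map (show Commute (slice 0 1 (neut t) _ _) (slice 1 0 (neut t) _ _) from
      (commute_iff_eq _ _).2 neut_comm.symm) _
  rw [h0, h1] at h
  exact h

/-- At the positions `0, 1` and `2, 3` this is the interchange law. -/
lemma link_comm_disjoint {i j k l : Fin n} (hij : i ≠ j) (hjk : j ≠ k) (hik : i ≠ k) (hil : i ≠ l)
    (hjl : j ≠ l) (hkl : k ≠ l) : Commute (link t i j) (link t k l) := by
  have hn : 3 < n := by omega
  obtain ⟨σ, hσ⟩ := Equiv.Perm.exists_extending_pair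
    (![⟨0, by omega⟩, ⟨1, by omega⟩, ⟨2, by omega⟩, ⟨3, hn⟩] : Fin 4 → Fin n) ![i, j, k, l]
    (by intro a b; fin_cases a <;> fin_cases b <;> simp)
    (by
      intro a b
      fin_cases a <;> fin_cases b <;> simp [hij, hij.symm, hjk, hjk.symm, hik, hik.symm, hil,
        hil.symm, hjl, hjl.symm, hkl, hkl.symm])
  obtain rfl := hσ 0
  obtain rfl := hσ 1
  obtain rfl := hσ 2
  obtain rfl := hσ 3
  rw [← perm_conj_link, ← perm_conj_link]
  apply commute_conj
  have h0 := at2_neut (t := t) (n := n) (i := 0) (by omega)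
  have h1 := at2_neut (t := t) (n := n) (i := 2) (by omega)
  have h : Commute (at2 (neut t) n 0) (at2 (neut t) n 2) := at2_comm _ _ le_rfl (by omega)
  rw [h0, h1] at h
  exact h

lemma link_comm (i j k l : Fin n) : Commute (link t i j) (link t k l) := by
  by_cases hij : i = j
  · rw [hij, link_self]; exact Commute.one_left _
  by_cases hkl : k = l
  · rw [hkl, link_self]; exact Commute.one_right _
  by_cases hjk : j = k
  · subst hjk
    by_cases hil : i = l
    · subst hil; rw [link_symm]
    · exact link_comm_adjacent hij hkl hil
  by_cases hjl : j = l
  · subst hjl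
    by_cases hik : i = k
    · subst hik; exact Commute.refl _
    · rw [link_symm k]; exact link_comm_adjacent hij hjk hik
  by_cases hik : i = k
  · subst hik; rw [link_symm i j]; exact link_comm_adjacent hjk hkl hjl
  by_cases hil : i = l
  · subst hil; rw [link_symm i j, link_symm k]; exact link_comm_adjacent hjl hik hjk
  exact link_comm_disjoint hij hjk hik hil hjl hkl

/-- Connections between strands are transitive. -/
lemma link_mul_link (i j k : Fin n) :
    link t i j * link t j k = link t i j * link t j k * link t i k := by
  -- `link t i j` emits the transposition of `i` and `j`, which turns `link t j k` into `link t i k`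
  -- on its way and is then absorbed again.
  have h : link t i j * link t j k = link t i j * link t i k := by
    by_cases hik : i = k
    · subst hik
      rw [link_self, mul_one, link_symm j, link_idem]
    by_cases hjk : j = k
    · subst hjk
      rw [link_self, mul_one, link_idem]
    calc link t i j * link t j k
        = link t i j * (perm t n (Equiv.swap i j) * link t j k) := by
          rw [← mul_assoc, link_mul_swap]
      _ = link t i j * link t i k * perm t n (Equiv.swap i j) := by
          rw [perm_mul_link, Equiv.swap_apply_right,
            Equiv.swap_apply_of_ne_of_ne (Ne.symm hik) (Ne.symm hjk), mul_assoc]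
      _ = link t i k * (link t i j * perm t n (Equiv.swap i j)) := by
          rw [(link_comm i j i k).eq, mul_assoc]
      _ = _ := by rw [link_mul_swap, (link_comm i j i k).eq]
  rw [h, mul_assoc, link_idem]

end ParHom

end PartitionDiagram

namespace PartitionDiagram

namespace ParHom

variable {t : ℂ} {a b c a' b' c' k l m n k' l' m' N M : ℕ}

/-! ### Standard morphisms from the unit object -/

lemma slice_link (i j : Fin n) (hN : N = a + n + b) (hM : N = a + n + b) (i' j' : Fin N)
    (hi : (i' : ℕ) = a + i) (hj : (j' : ℕ) = a + j) :
    slice a b (link t i j) hN hM = link t i' j' := by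
  subst hN
  obtain rfl : i' = Fin.castAdd b (Fin.natAdd a i) := Fin.ext hi
  obtain rfl : j' = Fin.castAdd b (Fin.natAdd a j) := Fin.ext hj
  by_cases h : i = j
  · subst h
    rw [link_self, link_self]
    exact slice_one _ _ _ _
  · obtain ⟨σ, hn, rfl, rfl⟩ := exists_perm_pair h
    have e : strandsHom t a b n (at2 (neut t) n 0) =
        link t (Fin.castAdd b (Fin.natAdd a ⟨0, by omega⟩))
          (Fin.castAdd b (Fin.natAdd a ⟨1, hn⟩)) := by
      rw [strandsHom_at2 _ (by omega), at2_neut (by omega)]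
      rfl
    rw [link_eq, ← midPerm_apply_mid, ← midPerm_apply_mid, ← perm_conj_link, ← e, ← map_inv,
      perm_midPerm, perm_midPerm]
    exact (map_mul (strandsHom t a b n) _ _).trans (congrArg (· * _) (map_mul _ _ _))

lemma link_tensor_one (i j : Fin n) :
    (link t i j).tensor (one t b) rfl rfl = link t (Fin.castAdd b i) (Fin.castAdd b j) := by
  rw [tensor_one_eq]
  exact slice_link _ _ _ _ _ _ (by simp) (by simp)

lemma slice_perm (σ : Equiv.Perm (Fin n)) (hN : N = a + n + b) (hM : N = a + n + b)
    (τ : Equiv.Perm (Fin N)) (h : ∀ i, Fin.cast hN (τ i) = midPerm a b n σ (Fin.cast hN i)) :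
    slice a b (perm t n σ) hN hM = perm t N τ := by
  subst hN
  obtain rfl : τ = midPerm a b n σ := Equiv.ext h
  exact (perm_midPerm σ).symm

lemma perm_tensor_one (σ : Equiv.Perm (Fin n)) :
    (perm t n σ).tensor (one t b) rfl rfl = perm t (n + b) (sumPerm σ (Equiv.refl _)) := by
  rw [tensor_one_eq]
  refine slice_perm _ _ _ _ fun i => ?_
  refine Fin.addCases (fun i => ?_) (fun i => ?_) i
  · have e : ∀ i : Fin n, Fin.cast (by omega : n + b = 0 + n + b) (Fin.castAdd b i) =
        Fin.castAdd b (Fin.natAdd 0 i) := fun i => Fin.ext (by simp)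
    rw [sumPerm_castAdd, e, e, midPerm_apply_mid]
  · have e : ∀ i : Fin b, Fin.cast (by omega : n + b = 0 + n + b) (Fin.natAdd n i) =
        Fin.natAdd (0 + n) i := fun i => Fin.ext (by simp)
    rw [sumPerm_natAdd, e, e, midPerm_apply_right, Equiv.refl_apply]

/-- The tensor product with `W ⊗ W` from the right, as a homomorphism. -/
def tensorHom (t : ℂ) (n b : ℕ) : ParHom t n n →* ParHom t (n + b) (n + b) where
  toFun f := f.tensor (one t b) rfl rfl
  map_one' := one_tensor_one _ _
  map_mul' f g := by rw [mul_def, mul_def, interchange, comp_one]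

/-- The composite of the cups at `(0,1)`, `(2,3)`, …; zero for an odd number of strands. -/
def cups (t : ℂ) : (n : ℕ) → ParHom t 0 n
  | 0 => one t 0
  | 1 => 0
  | n + 2 => (cups t n).tensor (cup t) rfl rfl

lemma comp_tensor_cup (x : ParHom t 0 n) (f : ParHom t n n) :
    (x.comp f).tensor (cup t) rfl rfl =
      (x.tensor (cup t) (k := 0) (l := n + 2) rfl rfl).comp (tensorHom t n 2 f) := by
  change _ = (x.tensor (cup t) rfl rfl).comp (f.tensor (one t 2) rfl rfl)
  rw [interchange, comp_one]

/-- From `αδ = δ`: a new cup supplies the link between its end points for free, which keeps the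
normal form complete when a cup is added. -/
lemma tensor_cup_comp_link (x : ParHom t 0 n) :
    (x.tensor (cup t) (k := 0) (l := n + 2) rfl rfl).comp
      (link t (Fin.natAdd n 0) (Fin.natAdd n 1)) = x.tensor (cup t) rfl rfl := by
  have h : link t (Fin.natAdd n (0 : Fin 2)) (Fin.natAdd n 1) =
      (one t n).tensor (neut t) rfl rfl := by
    rw [one_tensor_eq, at2_eq (b := 0), at2_neut (by omega)]
    rfl
  rw [h, interchange, comp_one, cup_comp_neut]

lemma tensor_cup_eq (x : ParHom t 0 n) :
    x.tensor (cup t) (k := 0) (l := n + 2) rfl rfl = x.comp (slice n 0 (cup t) rfl rfl) := by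
  rw [← one_tensor_eq, tensor_eq_comp x (cup t) _ _ rfl, one, tensor_unit]

/-- Two crossings move a cup one position to the left. Iterated, a cup in any position is a cup at
the right end followed by crossings. -/
lemma cup_past_at (p b : ℕ) (hN : N = p + 1 + 0 + b) (hM : M = p + 1 + 2 + b)
    (hN' : N = p + 0 + (b + 1)) (hM' : M = p + 2 + (b + 1)) :
    ((slice (p + 1) b (cup t) hN hM).comp (at2 (cross t) M p)).comp (at2 (cross t) M (p + 1)) =
      slice p (b + 1) (cup t) hN' hM' := by
  obtain rfl : N = p + 1 + b := by omega
  obtain rfl : M = p + 3 + b := by omega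
  have h := congrArg (fun f => slice p b f (N := p + 1 + b) (M := p + 3 + b) rfl rfl)
    (cup_past (t := t))
  simp only [← slice_comp p b _ _ (n := p + 3 + b) (N := p + 1 + b) (M := p + 3 + b) rfl rfl rfl]
    at h
  rw [slice_slice, slice_slice, slice_slice, slice_slice, at2_eq, at2_eq] at h
  convert h using 2
  all_goals simp [Nat.add_comm]

/-- Dually, a cap in any position is a sequence of crossings followed by a cap at the right end. -/
lemma cap_past_at (p b : ℕ) (hN : N = p + 1 + 0 + b) (hM : M = p + 1 + 2 + b)
    (hN' : N = p + 0 + (b + 1)) (hM' : M = p + 2 + (b + 1)) :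
    (at2 (cross t) M (p + 1)).comp ((at2 (cross t) M p).comp (slice (p + 1) b (cap t) hM hN)) =
      slice p (b + 1) (cap t) hM' hN' := by
  obtain rfl : N = p + 1 + b := by omega
  obtain rfl : M = p + 3 + b := by omega
  have h := congrArg (fun f => slice p b f (N := p + 3 + b) (M := p + 1 + b) rfl rfl)
    (cap_past (t := t))
  simp only [← slice_comp p b _ _ (n := p + 1 + b) (N := p + 3 + b) (M := p + 3 + b) rfl rfl rfl]
    at h
  rw [slice_slice, slice_slice, slice_slice, slice_slice, at2_eq, at2_eq] at h
  convert h using 2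
  all_goals simp [Nat.add_comm]

/-- The crossings pull the second cup to the left past both legs of the first, one leg at a time
(`h1`, `h2`). The outcome is the same two cups inserted in the other order, which `h3` identifies
with the original. -/
lemma cup_cup_comp_cross (x : ParHom t 0 n) :
    ((x.tensor (cup t) (l := n + 2) rfl rfl).tensor (cup t) (k := 0) (l := n + 4) rfl rfl).comp
      (at2 (cross t) (n + 4) (n + 1) * at2 (cross t) (n + 4) n * at2 (cross t) (n + 4) (n + 2) *
        at2 (cross t) (n + 4) (n + 1)) =
    (x.tensor (cup t) (l := n + 2) rfl rfl).tensor (cup t) (k := 0) (l := n + 4) rfl rfl := by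
  have h1 := cup_past_at (t := t) (N := n + 2) (M := n + 4) (n + 1) 0 rfl rfl rfl rfl
  have h2 := cup_past_at (t := t) (N := n + 2) (M := n + 4) n 1 rfl rfl rfl rfl
  have h3 := slice_interchange (N := n) (M := n + 2) (n := n + 4) (m := n + 2) n 0 0 (cup t) (cup t)
    (b₁ := 0) (b₂ := 2) (a₁ := n + 2) (a₂ := n) rfl rfl rfl rfl rfl rfl rfl rfl rfl rfl rfl rfl
  rw [tensor_cup_eq, tensor_cup_eq]
  simp only [mul_def]
  rw [comp_assoc x, comp_assoc x]
  congr 1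
  rw [h3]
  calc _ = (slice n 0 (cup t) rfl rfl).comp ((((slice (n + 1 + 1) 0 (cup t) rfl rfl).comp
        (at2 (cross t) (n + 4) (n + 1))).comp (at2 (cross t) (n + 4) (n + 1 + 1))).comp
        ((at2 (cross t) (n + 4) n).comp (at2 (cross t) (n + 4) (n + 1)))) := by
        rw [← h3]
        simp only [comp_assoc]
    _ = _ := by
        rw [h1, ← comp_assoc (slice (n + 1) _ _ _ _)]
        exact congrArg _ h2

/-- The four crossings exchange the pairs `i` and `i + 1`. Either the last pair is not involved, and
they act within the left tensor factor, or the last two pairs are exchanged, which is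
`cup_cup_comp_cross`. -/
lemma cups_comp_pairs (r i : ℕ) (hi : i + 2 ≤ r) :
    (cups t (2 * r)).comp (at2 (cross t) (2 * r) (2 * i + 1) * at2 (cross t) (2 * r) (2 * i) *
      at2 (cross t) (2 * r) (2 * i + 2) * at2 (cross t) (2 * r) (2 * i + 1)) = cups t (2 * r) := by
  induction r with
  | zero => omega
  | succ r ih =>
    by_cases h : i + 2 ≤ r
    · have e : ∀ q, q + 2 ≤ 2 * r →
          at2 (cross t) (2 * r + 2) q = tensorHom t (2 * r) 2 (at2 (cross t) (2 * r) q) := by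
        intro q hq
        obtain ⟨c, hc⟩ := Nat.exists_eq_add_of_le hq
        rw [← at2_eq (n := 2 * r) (cross t) hc hc]
        change _ = tensor (slice q c (cross t) hc hc) (one t 2) rfl rfl
        rw [tensor_one_eq, slice_slice, at2_eq, Nat.zero_add]
      change (tensor (cups t (2 * r)) (cup t) _ _).comp (at2 (cross t) (2 * r + 2) _ *
        at2 (cross t) (2 * r + 2) _ * at2 (cross t) (2 * r + 2) _ *
        at2 (cross t) (2 * r + 2) _) = tensor (cups t (2 * r)) (cup t) _ _
      rw [e _ (by omega), e _ (by omega), e _ (by omega), ← map_mul, ← map_mul, ← map_mul,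
        ← comp_tensor_cup, ih h]
    · obtain rfl : r = i + 1 := by omega
      change (tensor (tensor (cups t (2 * i)) (cup t) _ _) (cup t) (k := 0) _ _).comp
        (at2 (cross t) (2 * i + 4) (2 * i + 1) * at2 (cross t) (2 * i + 4) (2 * i) *
          at2 (cross t) (2 * i + 4) (2 * i + 2) * at2 (cross t) (2 * i + 4) (2 * i + 1)) =
        tensor (tensor (cups t (2 * i)) (cup t) _ _) (cup t) (k := 0) _ _
      exact cup_cup_comp_cross _

/-- The position `2 * i + e`, for a pair `i` and `e < 2`. -/
def pairPos {r : ℕ} (i : Fin r) (e : Fin 2) : Fin (2 * r) := ⟨2 * i + e, by omega⟩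

lemma exists_pairPos {r : ℕ} (k : Fin (2 * r)) : ∃ i e, k = pairPos i e :=
  ⟨⟨k / 2, by omega⟩, ⟨k % 2, by omega⟩, Fin.ext (by simp [pairPos]; omega)⟩

lemma val_adjacent {i : ℕ} (hi : i + 1 < n) (k : Fin n) :
    (Equiv.swap (⟨i, by omega⟩ : Fin n) ⟨i + 1, hi⟩ k : ℕ) =
      if (k : ℕ) = i then i + 1 else if (k : ℕ) = i + 1 then i else k := by
  simp only [Equiv.swap_apply_def, Fin.ext_iff]
  split_ifs <;> rfl

/-- Permutations of the pairs fix the composite of cups. -/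
lemma exists_pairPerm {r : ℕ} (π : Equiv.Perm (Fin r)) : ∃ ρ : Equiv.Perm (Fin (2 * r)),
    (cups t (2 * r)).comp (perm t _ ρ) = cups t (2 * r) ∧
      ∀ i e, ρ (pairPos i e) = pairPos (π i) e := by
  have hπ : π ∈ (⊤ : Submonoid (Equiv.Perm (Fin r))) := trivial
  rw [← CoxeterLift.adjacent_closure] at hπ
  induction hπ using Submonoid.closure_induction with
  | one => exact ⟨1, by rw [map_one, comp_one'], fun _ _ => rfl⟩
  | mul π π' _ _ h h' =>
    obtain ⟨ρ, h1, h2⟩ := h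
    obtain ⟨ρ', h1', h2'⟩ := h'
    exact ⟨ρ * ρ', by rw [map_mul, comp_mul, h1', h1], fun i e => by
      rw [Equiv.Perm.mul_apply, h2', h2, Equiv.Perm.mul_apply]⟩
  | mem π h =>
    obtain ⟨i, hi, rfl⟩ := h
    have hc := cups_comp_pairs (t := t) r i hi
    rw [← perm_adjacent (by omega), ← perm_adjacent (by omega), ← perm_adjacent (by omega),
      ← map_mul, ← map_mul, ← map_mul] at hc
    refine ⟨_, hc, fun j e => ?_⟩
    have he := e.2
    refine Fin.ext ?_
    have hj : (Equiv.swap (⟨i, by omega⟩ : Fin r) ⟨i + 1, hi⟩ j : ℕ) =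
        if (j : ℕ) = i then i + 1 else if (j : ℕ) = i + 1 then i else j := val_adjacent _ _
    simp only [Equiv.Perm.mul_apply, pairPos, hj, val_adjacent]
    split_ifs <;> omega

/-! ### Products of neutralizers and what they absorb -/

/-- The finest equivalence relation with `i ~ j`. -/
def pairRel (i j : Fin n) : Setoid (Fin n) := Relation.EqvGen.setoid fun a b => a = i ∧ b = j

lemma pairRel_le {i j : Fin n} {s : Setoid (Fin n)} : pairRel i j ≤ s ↔ s i j := by
  constructor
  · intro h
    exact h (.rel _ _ ⟨rfl, rfl⟩)
  · intro h
    refine Setoid.eqvGen_le ?_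
    rintro _ _ ⟨rfl, rfl⟩
    exact h

lemma map_le_iff {α β : Type} {r : Setoid α} {f : α → β} {s : Setoid β} :
    r.map f ≤ s ↔ ∀ a b, r a b → s (f a) (f b) := by
  constructor
  · intro h a b hab
    exact h (Setoid.le_comap_map (r := r) (f := f) hab)
  · intro h
    refine Setoid.eqvGen_le ?_
    rintro _ _ ⟨a, b, hab, rfl, rfl⟩
    exact h a b hab

/-- The strands `i` and `j` that `f` leaves connected. -/
def absorbed (f : ParHom t n n) : Setoid (Fin n) where
  r i j := f * link t i j = f
  iseqv :=
    { refl i := by rw [link_self, mul_one]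
      symm {i j} h := by rwa [link_symm]
      trans {i j k} h h' := by
        have h1 : f * (link t i j * link t j k) = f := by rw [← mul_assoc, h, h']
        calc f * link t i k = f * (link t i j * link t j k) * link t i k := by rw [h1]
          _ = f := by rw [mul_assoc, ← link_mul_link, h1] }

lemma absorbed_iff {f : ParHom t n n} {i j : Fin n} : absorbed f i j ↔ f * link t i j = f :=
  Iff.rfl

/-- Products of neutralizers inside the blocks of `p`. -/
noncomputable def links (t : ℂ) (p : Setoid (Fin n)) : Submonoid (ParHom t n n) :=
  Submonoid.closure {f | ∃ i j, p i j ∧ f = link t i j}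

lemma link_mem_links {p : Setoid (Fin n)} {i j : Fin n} (h : p i j) : link t i j ∈ links t p :=
  Submonoid.subset_closure ⟨i, j, h, rfl⟩

lemma links_mono {p q : Setoid (Fin n)} (h : p ≤ q) : links t p ≤ links t q := by
  refine Submonoid.closure_mono ?_
  rintro _ ⟨i, j, hij, rfl⟩
  exact ⟨i, j, h hij, rfl⟩

lemma links_le {p : Setoid (Fin n)} {S : Submonoid (ParHom t n n)}
    (h : ∀ i j, p i j → link t i j ∈ S) : links t p ≤ S := by
  refine (Submonoid.closure_le).2 ?_
  rintro _ ⟨i, j, hij, rfl⟩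
  exact h i j hij

lemma link_comm_of_mem {p : Setoid (Fin n)} {f : ParHom t n n} (hf : f ∈ links t p) (i j : Fin n) :
    Commute f (link t i j) := by
  have h : links t p ≤ Submonoid.centralizer {link t i j} :=
    links_le fun k l _ => Submonoid.mem_centralizer_iff.2 fun g hg => by
      rw [Set.mem_singleton_iff.1 hg]
      exact link_comm i j k l
  exact (Submonoid.mem_centralizer_iff.1 (h hf) _ rfl).symm

lemma commute_of_mem {p q : Setoid (Fin n)} {f g : ParHom t n n} (hf : f ∈ links t p)
    (hg : g ∈ links t q) : Commute f g := by
  have h : links t q ≤ Submonoid.centralizer {f} :=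
    links_le fun k l _ => Submonoid.mem_centralizer_iff.2 fun g hg => by
      rw [Set.mem_singleton_iff.1 hg]
      exact link_comm_of_mem hf k l
  exact Submonoid.mem_centralizer_iff.1 (h hg) _ rfl

lemma mul_eq_of_mem_links {p : Setoid (Fin n)} {f g : ParHom t n n} (hg : g ∈ links t p)
    (hf : p ≤ absorbed f) : f * g = f := by
  induction hg using Submonoid.closure_induction with
  | mem g h =>
    obtain ⟨i, j, hij, rfl⟩ := h
    exact hf hij
  | one => exact mul_one f
  | mul g g' _ _ h h' => rw [← mul_assoc, h, h']

lemma perm_conj_mem_links {p : Setoid (Fin n)} {f : ParHom t n n} (σ : Equiv.Perm (Fin n))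
    (hf : f ∈ links t p) : perm t n σ * f * perm t n σ⁻¹ ∈ links t (p.map σ) := by
  induction hf using Submonoid.closure_induction with
  | mem f h =>
    obtain ⟨i, j, hij, rfl⟩ := h
    rw [perm_conj_link]
    exact link_mem_links (map_le_iff.1 le_rfl _ _ hij)
  | one => rw [mul_one, perm_mul_inv]; exact one_mem _
  | mul f g _ _ hf hg =>
    rw [perm_conj_mul]
    exact mul_mem hf hg

/-- Block preserving permutations are absorbed. -/
lemma mul_perm_of_absorbed {p : Setoid (Fin n)} {f : ParHom t n n} (hf : p ≤ absorbed f)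
    (τ : Equiv.Perm (Fin n)) (hτ : ∀ i, p i (τ i)) : f * perm t n τ = f := by
  let S : Set (Equiv.Perm (Fin n)) := {σ | ∃ i j, i ≠ j ∧ p i j ∧ σ = Equiv.swap i j}
  -- A subgroup generated by transpositions contains `τ`, of finite support, as soon as each point
  -- lies in one orbit with its image; here a single transposition inside the block connects them.
  have h : τ ∈ Subgroup.closure S := by
    refine (mem_closure_isSwap ?_).2 ⟨Set.toFinite _, fun i => ?_⟩
    · rintro _ ⟨i, j, hij, -, rfl⟩
      exact ⟨i, j, hij, rfl⟩
    · by_cases hi : i = τ i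
      · rw [← hi]
        exact MulAction.mem_orbit_self _
      · exact ⟨⟨_, Subgroup.subset_closure ⟨i, τ i, hi, hτ i, rfl⟩⟩, Equiv.swap_apply_left _ _⟩
  clear hτ
  induction h using Subgroup.closure_induction with
  | mem σ h =>
    obtain ⟨i, j, -, hij, rfl⟩ := h
    have := absorbed_iff.1 (hf hij)
    rw [← this, mul_assoc, link_mul_swap]
  | one => rw [map_one, mul_one]
  | mul σ τ _ _ h h' => rw [map_mul, ← mul_assoc, h, h']
  | inv σ _ h =>
    conv_lhs => rw [← h]
    rw [mul_assoc, perm_mul_inv, mul_one]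

/-! ### Standard morphisms: normal form and uniqueness -/

/-- `Std t n p x`: the morphism `x` is built from cups, crossings and neutralizers and represents
the partition `p` of the upper row. -/
inductive Std (t : ℂ) : (n : ℕ) → Setoid (Fin n) → ParHom t 0 n → Prop
  | nil (p : Setoid (Fin 0)) : Std t 0 p (one t 0)
  | cup {n : ℕ} {p : Setoid (Fin n)} {x : ParHom t 0 n} : Std t n p x →
      Std t (n + 2) (p.map (Fin.castAdd 2) ⊔ pairRel (Fin.natAdd n 0) (Fin.natAdd n 1))
        (x.tensor (ParHom.cup t) rfl rfl)
  | perm {n : ℕ} {p : Setoid (Fin n)} {x : ParHom t 0 n} (σ : Equiv.Perm (Fin n)) : Std t n p x →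
      Std t n (p.map σ) (x.comp (ParHom.perm t n σ))
  | link {n : ℕ} {p : Setoid (Fin n)} {x : ParHom t 0 n} (i j : Fin n) : Std t n p x →
      Std t n (p ⊔ pairRel i j) (x.comp (ParHom.link t i j))

lemma Std.even {p : Setoid (Fin n)} {x : ParHom t 0 n} (h : Std t n p x) : ∃ r, n = 2 * r := by
  induction h with
  | nil => exact ⟨0, rfl⟩
  | cup _ ih =>
    obtain ⟨r, rfl⟩ := ih
    exact ⟨r + 1, rfl⟩
  | perm _ _ ih => exact ih
  | link _ _ _ ih => exact ih

/-- Links commute, and permutations act on them by conjugation, so the constituents can be sorted: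
cups, one permutation, links. Membership in `links t p` and absorption of all of `p` together pin
down `A`; the last clause says that each cup lands inside one block. -/
lemma Std.normal_form {p : Setoid (Fin n)} {x : ParHom t 0 n} (h : Std t n p x) :
    ∃ (A : ParHom t n n) (σ : Equiv.Perm (Fin n)), x = (cups t n).comp (A * ParHom.perm t n σ) ∧
      A ∈ links t p ∧ p ≤ absorbed A ∧
      ∀ i (hi : 2 * i + 1 < n), p (σ ⟨2 * i, by omega⟩) (σ ⟨2 * i + 1, hi⟩) := by
  induction h with
  | nil p =>
    refine ⟨1, 1, ?_, one_mem _, fun {i} => i.elim0, fun i hi => by omega⟩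
    rw [map_one, mul_one, comp_one']
    rfl
  | @cup n p x hx ih =>
    obtain ⟨A, σ, rfl, hA, hp, hσ⟩ := ih
    obtain ⟨r, rfl⟩ := hx.even
    -- `A ⊗ 1` need not absorb a connection between the two new points; the extra link provides this
    -- and may be inserted because the new cup emits it.
    refine ⟨tensorHom t _ 2 A * ParHom.link t (Fin.natAdd _ 0) (Fin.natAdd _ 1),
      sumPerm σ (Equiv.refl _), ?_, mul_mem ?_ (link_mem_links ?_), ?_, ?_⟩
    · rw [← perm_tensor_one, comp_tensor_cup, map_mul, mul_assoc, comp_mul, comp_mul, comp_mul]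
      have e := comp_tensor_cup (cups t (2 * r)) (ParHom.perm t _ σ)
      change _ = (((tensor _ _ _ _).comp (tensorHom t _ 2 (ParHom.perm t _ σ))).comp _).comp _
      rw [← e, tensor_cup_comp_link]
    · have h : links t p ≤ (links t (p.map (Fin.castAdd 2) ⊔
          pairRel (Fin.natAdd (2 * r) 0) (Fin.natAdd (2 * r) 1))).comap (tensorHom t _ 2) := by
        refine links_le fun i j hij => ?_
        change (ParHom.link t i j).tensor (one t 2) rfl rfl ∈ links t _
        rw [link_tensor_one]
        exact link_mem_links ((le_sup_left : p.map (Fin.castAdd 2) ≤ _)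
          (map_le_iff.1 le_rfl _ _ hij))
      exact h hA
    · exact (le_sup_right : pairRel _ _ ≤ _) (pairRel_le.1 le_rfl)
    · refine sup_le (map_le_iff.2 fun i j hij => ?_) (pairRel_le.2 ?_)
      · rw [absorbed_iff, mul_assoc, (link_comm _ _ _ _).eq, ← mul_assoc, ← link_tensor_one]
        change tensorHom t _ 2 A * tensorHom t _ 2 _ * _ = _
        rw [← map_mul, absorbed_iff.1 (hp hij)]
      · rw [absorbed_iff, mul_assoc, link_idem]
    · intro i hi
      by_cases h : 2 * i + 1 < 2 * r
      · have := map_le_iff.1 (le_sup_left : p.map (Fin.castAdd 2) ≤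
          _ ⊔ pairRel (Fin.natAdd (2 * r) 0) (Fin.natAdd (2 * r) 1)) _ _ (hσ i h)
        rw [← sumPerm_castAdd (k' := 2) σ (Equiv.refl (Fin 2)),
          ← sumPerm_castAdd (k' := 2) σ (Equiv.refl (Fin 2))] at this
        exact this
      · obtain rfl : i = r := by omega
        have := pairRel_le.1 (le_sup_right : pairRel (Fin.natAdd (2 * i) (0 : Fin 2))
          (Fin.natAdd (2 * i) 1) ≤ p.map (Fin.castAdd 2) ⊔ _)
        have e : ∀ e : Fin 2, sumPerm σ (Equiv.refl (Fin 2)) (Fin.natAdd (2 * i) e) =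
          Fin.natAdd (2 * i) e := sumPerm_natAdd σ (Equiv.refl (Fin 2))
        exact (congrArg₂ (fun a b => (p.map (Fin.castAdd 2) ⊔
          pairRel (Fin.natAdd (2 * i) (0 : Fin 2)) (Fin.natAdd (2 * i) 1)) a b)
          (e 0) (e 1)).mpr this
  | @perm n p x τ hx ih =>
    obtain ⟨A, σ, rfl, hA, hp, hσ⟩ := ih
    have hle : ∀ {i j}, p i j → p.map τ (τ i) (τ j) := fun h => map_le_iff.1 le_rfl _ _ h
    -- Moving `τ` below `A` conjugates `A`, which carries its links into the image blocks.
    refine ⟨ParHom.perm t n τ * A * ParHom.perm t n τ⁻¹, τ * σ, ?_, ?_, ?_, fun i hi => ?_⟩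
    · rw [← comp_mul, map_mul]
      congr 1
      calc _ = ParHom.perm t n τ * A * 1 * ParHom.perm t n σ := by simp only [mul_assoc, one_mul]
        _ = _ := by rw [← perm_inv_mul τ]; simp only [mul_assoc]
    · exact perm_conj_mem_links τ hA
    · refine map_le_iff.2 fun i j hij => ?_
      rw [absorbed_iff, ← perm_conj_link]
      calc _ = ParHom.perm t n τ * A * (ParHom.perm t n τ⁻¹ * ParHom.perm t n τ) *
            ParHom.link t i j * ParHom.perm t n τ⁻¹ := by simp only [mul_assoc]
        _ = _ := by rw [perm_inv_mul, mul_one, mul_assoc _ A, absorbed_iff.1 (hp hij)]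
    · exact hle (hσ i hi)
  | @link n p x i j hx ih =>
    obtain ⟨A, σ, rfl, hA, hp, hσ⟩ := ih
    have hle : p ≤ p ⊔ pairRel i j := le_sup_left
    refine ⟨A * ParHom.link t i j, σ, ?_, mul_mem (links_mono hle hA) (link_mem_links ?_),
      sup_le (fun {k l} h => ?_) (pairRel_le.2 ?_), fun i hi => hle (hσ i hi)⟩
    · rw [← comp_mul, ← mul_assoc, (link_comm_of_mem hA i j).eq]
    · exact pairRel_le.1 le_sup_right
    · rw [absorbed_iff, mul_assoc, (link_comm _ _ _ _).eq, ← mul_assoc, absorbed_iff.1 (hp h)]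
    · rw [absorbed_iff, mul_assoc, link_idem]

lemma sum_pairs (r : ℕ) (g : Fin (2 * r) → ℕ) :
    ∑ k, g k = ∑ i : Fin r, (g (pairPos i 0) + g (pairPos i 1)) := by
  induction r with
  | zero => rfl
  | succ r ih =>
    have h : ∑ k, g k = ∑ k : Fin (2 * r), g k.castSucc.castSucc +
        g (Fin.last (2 * r)).castSucc + g (Fin.last (2 * r + 1)) :=
      (Fin.sum_univ_castSucc (n := 2 * r + 1) g).trans
        (congrArg (· + _) (Fin.sum_univ_castSucc (n := 2 * r) _))
    rw [h, ih, Fin.sum_univ_castSucc (n := r), add_assoc]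
    rfl

-- A block is the disjoint union of the pairs that are placed in it, so it holds half as many pairs
-- as points, whatever `σ` is. This makes two normal forms comparable.
open Classical in
lemma card_fiber_pairs {r : ℕ} (p : Setoid (Fin (2 * r))) (σ : Equiv.Perm (Fin (2 * r)))
    (hσ : ∀ i : Fin r, p (σ (pairPos i 0)) (σ (pairPos i 1))) (q : Quotient p) :
    2 * Fintype.card {i : Fin r // Quotient.mk p (σ (pairPos i 0)) = q} =
      Fintype.card {k // Quotient.mk p k = q} := by
  rw [Fintype.card_subtype, Fintype.card_subtype, Finset.card_filter, Finset.card_filter,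
    ← Equiv.sum_comp σ, sum_pairs, Finset.mul_sum]
  refine Finset.sum_congr rfl fun i _ => ?_
  rw [Quotient.sound (s := p) (hσ i), two_mul]

/-- A standard morphism is determined by its partition. -/
theorem Std.unique {p : Setoid (Fin n)} {x y : ParHom t 0 n} (hx : Std t n p x)
    (hy : Std t n p y) : x = y := by
  classical
  obtain ⟨r, rfl⟩ := hx.even
  obtain ⟨A, σ, rfl, hA, hp, hσ⟩ := hx.normal_form
  obtain ⟨A', σ', rfl, hA', hp', hσ'⟩ := hy.normal_form
  -- Each factor absorbs the links of the other, and the two commute, so `A = A * A' = A' * A = A'`.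
  have hAA : A = A' := by
    rw [← mul_eq_of_mem_links hA' hp, (commute_of_mem hA hA').eq, mul_eq_of_mem_links hA hp']
  subst hAA
  have hσ := fun i : Fin r => hσ i (by omega)
  have hσ' := fun i : Fin r => hσ' i (by omega)
  -- `σ` and `σ'` put equally many cups into each block; the bijections between these sets of cups
  -- assemble to a permutation of the cups.
  have e : ∀ q, {i : Fin r // Quotient.mk p (σ' (pairPos i 0)) = q} ≃
      {i : Fin r // Quotient.mk p (σ (pairPos i 0)) = q} := fun q =>
    Fintype.equivOfCardEq (by
      have h1 := card_fiber_pairs p σ hσ q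
      have h2 := card_fiber_pairs p σ' hσ' q
      omega)
  obtain ⟨ρ, hρ, hρ'⟩ := exists_pairPerm (t := t) (Equiv.ofFiberEquiv e)
  have hmatch : ∀ i, p (σ' (pairPos i 0)) (σ (ρ (pairPos i 0))) := fun i => by
    rw [hρ']
    exact Quotient.exact (Equiv.ofFiberEquiv_map e i).symm
  -- Up to the permutation `ρ` of the cups, `σ` and `σ'` differ by a block preserving permutation.
  have hτ : ∀ k, p k ((σ * ρ * σ'⁻¹) k) := by
    intro k
    obtain ⟨k, rfl⟩ := σ'.surjective k
    obtain ⟨i, e, rfl⟩ := exists_pairPos k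
    simp only [Equiv.Perm.mul_apply, Equiv.Perm.inv_def, Equiv.symm_apply_apply]
    fin_cases e
    · exact hmatch i
    · refine p.trans' (p.symm' (hσ' i)) (p.trans' (hmatch i) ?_)
      rw [hρ', hρ']
      exact hσ _
  -- `A` absorbs `σ * ρ * σ'⁻¹`, which turns `σ'` into `σ * ρ`; then the cups absorb `ρ`.
  have h := mul_perm_of_absorbed hp _ hτ
  conv_rhs => rw [← h]
  rw [mul_assoc, ← map_mul, inv_mul_cancel_right, map_mul, ← mul_assoc, comp_mul _ _
    (ParHom.perm t _ ρ), hρ]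

end ParHom

end PartitionDiagram

namespace PartitionDiagram

namespace ParHom

variable {t : ℂ} {a b c a' b' c' k l m n k' l' m' N M : ℕ}

/-! ### Standard morphisms span -/

/-- All blocks have an even number of elements, in terms of two-colourings. -/
def EvenRel (p : Setoid (Fin n)) : Prop :=
  ∀ y : Fin n → Bool, p ≤ Setoid.ker y → Even (Finset.univ.filter fun i => y i = true).card

lemma card_filter_add (y : Fin (n + 2) → Bool) :
    (Finset.univ.filter fun i => y i = true).card =
      (Finset.univ.filter fun i : Fin n => y (Fin.castAdd 2 i) = true).card +
        ((if y (Fin.natAdd n 0) = true then 1 else 0) +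
          if y (Fin.natAdd n 1) = true then 1 else 0) := by
  rw [Finset.card_filter, Fin.sum_univ_add, Fin.sum_univ_two, Finset.card_filter]

lemma map_perm_apply (p : Setoid (Fin n)) (σ : Equiv.Perm (Fin n)) :
    p.map σ = p.comap (σ⁻¹ : Equiv.Perm (Fin n)) := by
  refine le_antisymm (map_le_iff.2 fun i j h => ?_) fun {i j} h => ?_
  · simpa [Setoid.comap_rel] using h
  · have := map_le_iff.1 (le_refl (p.map σ)) _ _ h
    simpa using this

lemma Std.evenRel {p : Setoid (Fin n)} {x : ParHom t 0 n} (h : Std t n p x) : EvenRel p := by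
  induction h with
  | nil => intro y _; simp
  | @cup n p x _ ih =>
    intro y hy
    rw [sup_le_iff, map_le_iff, pairRel_le] at hy
    rw [card_filter_add]
    refine (ih (y ∘ Fin.castAdd 2) (fun {i j} h => hy.1 i j h)).add ?_
    rw [← Setoid.ker_def.1 hy.2]
    exact ⟨_, rfl⟩
  | @perm n p x σ _ ih =>
    intro y hy
    rw [map_le_iff] at hy
    have := ih (y ∘ σ) (fun {i j} h => hy i j h)
    rw [Finset.card_filter] at this ⊢
    rwa [← Equiv.sum_comp σ]
  | link i j _ ih => exact fun y hy => ih y (le_sup_left.trans hy)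

/-! ### Closing two strands by a cap -/

/-- The last two strands are closed by a cap. -/
def closeLast (x : ParHom t 0 (n + 2)) : ParHom t 0 n := x.comp (slice n 0 (cap t) rfl rfl)

lemma comp_tensor_one_closeLast (x : ParHom t 0 (n + 2)) (f : ParHom t n n) :
    closeLast (x.comp (f.tensor (one t 2) rfl rfl)) = (closeLast x).comp f := by
  have e : f.tensor (one t 0) rfl rfl = f := tensor_unit f _ _
  rw [closeLast, closeLast, ← one_tensor_eq, comp_assoc, interchange, one_comp, comp_one,
    comp_assoc]
  conv_rhs => rw [← e]
  rw [interchange, one_comp, comp_one]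

lemma closeLast_cup (x : ParHom t 0 n) : closeLast (x.tensor (cup t) rfl rfl) = t • x := by
  rw [closeLast, ← one_tensor_eq, interchange, comp_one, cup_comp_cap, tensor_smul, one,
    tensor_unit]

lemma link_last (t : ℂ) (n : ℕ) : link t (Fin.natAdd n (0 : Fin 2)) (Fin.natAdd n 1) =
    slice n 0 (neut t) rfl rfl := by
  rw [at2_eq (b := 0), at2_neut (by omega)]
  rfl

lemma closeLast_link (x : ParHom t 0 (n + 2)) :
    closeLast (x.comp (link t (Fin.natAdd n 0) (Fin.natAdd n 1))) = closeLast x := by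
  rw [link_last, closeLast, comp_assoc, slice_comp, neut_comp_cap, closeLast]

/-- The neutralizer slides along the cup to the legs of the cap, which absorbs it; a zigzag remains.
-/
lemma cup_neut_cap : ((slice 1 0 (cup t) (N := 1) (M := 3) rfl rfl).comp
    (slice 0 1 (neut t) (M := 3) rfl rfl)).comp (slice 1 0 (cap t) (M := 1) rfl rfl) =
    one t 1 := by
  rw [← neut_slide, comp_assoc, slice_comp, neut_comp_cap, zigzag_left]

/-- For the last strand this is `cup_neut_cap`. Any other `k` is brought there by a transposition of
the strands that are not closed, which commutes with the closing. -/
lemma closeLast_cup_link (x : ParHom t 0 n) (k : Fin n) :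
    closeLast ((x.tensor (cup t) (k := 0) (l := n + 2) rfl rfl).comp
      (link t (Fin.castAdd 2 k) (Fin.natAdd n 0))) = x := by
  obtain ⟨m, rfl⟩ : ∃ m, n = m + 1 := Nat.exists_eq_succ_of_ne_zero k.pos.ne'
  have hlast : ∀ y : ParHom t 0 (m + 1),
      closeLast ((y.tensor (cup t) (k := 0) (l := m + 1 + 2) rfl rfl).comp
        (link t (Fin.castAdd 2 (Fin.last m)) (Fin.natAdd (m + 1) 0))) = y := by
    intro y
    have e : link t (Fin.castAdd 2 (Fin.last m)) (Fin.natAdd (m + 1) (0 : Fin 2)) =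
        at2 (neut t) (m + 1 + 2) m := (at2_neut (i := m) (n := m + 1 + 2)
        (show m + 1 < m + 1 + 2 from Nat.lt_add_of_pos_right two_pos)).symm
    have h := congrArg (fun f => slice m 0 f (N := m + 1) (M := m + 1) rfl rfl)
      (cup_neut_cap (t := t))
    simp only [← slice_comp m 0 _ _ (n := m + 1) (N := m + 1) (M := m + 3) rfl rfl rfl,
      ← slice_comp m 0 _ _ (n := m + 3) (N := m + 1) (M := m + 3) rfl rfl rfl, slice_one] at h
    rw [slice_slice, slice_slice, slice_slice] at h
    rw [e, tensor_cup_eq, closeLast, comp_assoc, comp_assoc, ← at2_eq (b := 1) (neut t) rfl rfl]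
    refine (congrArg (y.comp) ?_).trans (comp_one y)
    rw [← comp_assoc]
    exact h
  have h := perm_conj_link (t := t) (sumPerm (Equiv.swap (Fin.last m) k) (Equiv.refl (Fin 2)))
    (Fin.castAdd 2 (Fin.last m)) (Fin.natAdd (m + 1) 0)
  rw [sumPerm_castAdd, sumPerm_natAdd, Equiv.swap_apply_left, Equiv.refl_apply] at h
  set σ := Equiv.swap (Fin.last m) k
  have hσ := perm_tensor_one (t := t) (b := 2) σ
  have hσ' := perm_tensor_one (t := t) (b := 2) σ⁻¹
  have e := comp_tensor_cup x (perm t _ σ⁻¹)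
  change _ = (tensor _ _ _ _).comp (tensor (perm t (m + 1) σ⁻¹) (one t 2) rfl rfl) at e
  rw [show (sumPerm σ (Equiv.refl (Fin 2)))⁻¹ = sumPerm σ⁻¹ (Equiv.refl _) from rfl, ← hσ,
    ← hσ'] at h
  rw [← h, comp_mul, comp_mul, ← e, comp_tensor_one_closeLast, hlast, ← comp_mul, perm_mul_inv,
    comp_one']

/-- Once the last two points are connected, `p` is generated by its restriction to the other points,
the pair itself, and the relations of other points to the first member of the pair. -/
lemma le_of_pair {p S : Setoid (Fin (n + 2))} (hp : p (Fin.natAdd n 0) (Fin.natAdd n 1))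
    (h1 : (p.comap (Fin.castAdd 2)).map (Fin.castAdd 2) ≤ S)
    (h2 : S (Fin.natAdd n 0) (Fin.natAdd n 1))
    (h3 : ∀ j : Fin n, p (Fin.castAdd 2 j) (Fin.natAdd n 0) →
      S (Fin.castAdd 2 j) (Fin.natAdd n 0)) : p ≤ S := by
  have hu : ∀ {r : Setoid (Fin (n + 2))}, r (Fin.natAdd n 0) (Fin.natAdd n 1) →
      ∀ e : Fin 2, r (Fin.natAdd n 0) (Fin.natAdd n e) := by
    intro r hr e
    fin_cases e
    · exact r.refl' _
    · exact hr
  intro a b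
  refine Fin.addCases (fun a => ?_) (fun a => ?_) a <;>
    refine Fin.addCases (fun b => ?_) (fun b => ?_) b <;> intro h
  · exact map_le_iff.1 h1 _ _ h
  · exact S.trans' (h3 a (p.trans' h (p.symm' (hu hp b)))) (hu h2 b)
  · exact S.symm' (S.trans' (h3 b (p.trans' (p.symm' h) (p.symm' (hu hp a)))) (hu h2 a))
  · exact S.trans' (S.symm' (hu h2 a)) (hu h2 b)

/-- A colouring of the first `n` points extends to the pair by the common colour `c` of the points
joined to it (any colour if there are none); two points of equal colour do not affect parity. -/
lemma evenRel_comap {p : Setoid (Fin (n + 2))} (hp : EvenRel p)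
    (h : p (Fin.natAdd n 0) (Fin.natAdd n 1)) : EvenRel (p.comap (Fin.castAdd 2)) := by
  intro y hy
  obtain ⟨c, hc⟩ : ∃ c : Bool, ∀ j : Fin n, p (Fin.castAdd 2 j) (Fin.natAdd n 0) → y j = c := by
    by_cases hk : ∃ k : Fin n, p (Fin.castAdd 2 k) (Fin.natAdd n 0)
    · obtain ⟨k, hk⟩ := hk
      exact ⟨y k, fun j hj => hy (p.trans' hj (p.symm' hk))⟩
    · exact ⟨true, fun j hj => absurd ⟨j, hj⟩ hk⟩
  have h1 := hp (Fin.append y fun _ => c) (le_of_pair h (map_le_iff.2 fun i j hij => by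
    have := hy hij
    rw [Setoid.ker_def] at this ⊢
    simpa using this) (by rw [Setoid.ker_def]; simp) (fun j hj => by
    rw [Setoid.ker_def]; simpa using hc j hj))
  rw [card_filter_add] at h1
  simp only [Fin.append_left, Fin.append_right] at h1
  exact (Nat.even_add.1 h1).2 ⟨_, rfl⟩

/-- Partitions that connect the last two points. -/
lemma exists_std_last {p : Setoid (Fin (n + 2))} (hp : EvenRel p)
    (h : p (Fin.natAdd n 0) (Fin.natAdd n 1))
    (ih : ∀ q : Setoid (Fin n), EvenRel q → ∃ x, Std t n q x) :
    ∃ x, Std t (n + 2) p x ∧ ∃ q y, Std t n q y ∧ ∃ r : ℂ, closeLast x = r • y := by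
  obtain ⟨y, hy⟩ := ih _ (evenRel_comap hp h)
  have hS : (p.comap (Fin.castAdd 2)).map (Fin.castAdd 2) ⊔
      pairRel (Fin.natAdd n 0) (Fin.natAdd n 1) ≤ p :=
    sup_le (map_le_iff.2 fun _ _ h => h) (pairRel_le.2 h)
  -- If the pair belongs to a block with earlier points, a new cup linked to one of them represents
  -- `p`, and the cap undoes both. Otherwise the cup stays alone and closes to a circle, which
  -- contributes the factor `t`.
  by_cases hk : ∃ k : Fin n, p (Fin.castAdd 2 k) (Fin.natAdd n 0)
  · obtain ⟨k, hk⟩ := hk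
    refine ⟨_, ?_, _, y, hy, 1, (closeLast_cup_link y k).trans (one_smul ℂ y).symm⟩
    have := hy.cup.link (Fin.castAdd 2 k) (Fin.natAdd n 0)
    convert this using 1
    set S := _ ⊔ pairRel (Fin.castAdd 2 k) (Fin.natAdd n 0)
    have h1 : (p.comap (Fin.castAdd 2)).map (Fin.castAdd 2) ≤ S := le_sup_left.trans le_sup_left
    refine le_antisymm (le_of_pair h h1
      (pairRel_le.1 (le_sup_right.trans le_sup_left)) fun j hj => ?_)
      (sup_le hS (pairRel_le.2 hk))
    exact S.trans' (map_le_iff.1 h1 j k (p.trans' hj (p.symm' hk))) (pairRel_le.1 le_sup_right)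
  · refine ⟨_, ?_, _, y, hy, t, closeLast_cup y⟩
    convert hy.cup using 1
    exact le_antisymm (le_of_pair h le_sup_left (pairRel_le.1 le_sup_right)
      fun j hj => absurd ⟨j, hj⟩ hk) hS

/-- Every even partition is represented by a standard morphism. -/
lemma exists_std : ∀ {n : ℕ} (p : Setoid (Fin n)), EvenRel p → ∃ x, Std t n p x
  | 0, p, _ => ⟨_, .nil p⟩
  | 1, p, hp => by
    have h := hp (fun _ => true) fun {_ _} _ => rfl
    simp at h
  | n + 2, p, hp => by
    classical
    -- The block of the last point has a second element; otherwise its indicator colouring would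
    -- colour exactly one point.
    obtain ⟨i, hi, hpi⟩ : ∃ i, i ≠ Fin.natAdd n 1 ∧ p i (Fin.natAdd n (1 : Fin 2)) := by
      by_contra hcon
      push Not at hcon
      have h := hp (fun i => decide (p i (Fin.natAdd n (1 : Fin 2)))) (fun {a b} hab => by
        rw [Setoid.ker_def, decide_eq_decide]
        exact ⟨fun h => p.trans' (p.symm' hab) h, fun h => p.trans' hab h⟩)
      have e : (Finset.univ.filter fun i => decide (p i (Fin.natAdd n (1 : Fin 2))) = true) =
          {Fin.natAdd n 1} := by
        ext i
        simp only [decide_eq_true_eq, Finset.mem_filter, Finset.mem_univ, true_and,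
          Finset.mem_singleton]
        exact ⟨fun h => by_contra fun h' => hcon i h' h, fun h => h ▸ p.refl' _⟩
      rw [e, Finset.card_singleton] at h
      exact absurd h (by decide)
    -- A transposition brings the partner `i` next to the last point, where `exists_std_last`
    -- applies.
    have hσ : EvenRel (p.comap (Equiv.swap i (Fin.natAdd n 0))) := by
      intro y hy
      have := hp (y ∘ Equiv.swap i (Fin.natAdd n 0)) (fun {a b} hab => hy (by
        rw [Setoid.comap_rel, Equiv.swap_apply_self, Equiv.swap_apply_self]; exact hab))
      rw [Finset.card_filter] at this ⊢
      rwa [← Equiv.sum_comp (Equiv.swap i (Fin.natAdd n 0))]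
    obtain ⟨x, hx, -⟩ := exists_std_last (t := t) hσ (by
      rw [Setoid.comap_rel, Equiv.swap_apply_right, Equiv.swap_apply_of_ne_of_ne hi.symm]
      · exact hpi
      · rw [Ne, Fin.ext_iff]; simp) fun q hq => exists_std q hq
    have h := hx.perm (Equiv.swap i (Fin.natAdd n 0))
    rw [map_perm_apply, Equiv.swap_inv, ← Setoid.comap_comp] at h
    have e : (Equiv.swap i (Fin.natAdd n (0 : Fin 2)) : Fin (n + 2) → Fin (n + 2)) ∘
        Equiv.swap i (Fin.natAdd n 0) = id := funext fun k => Equiv.swap_apply_self _ _ _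
    rw [e, Setoid.comap_id] at h
    exact ⟨_, h⟩

/-- The cap absorbs a link between the two points that it closes, so these may be assumed to be
connected. By uniqueness the resulting morphism equals the one built in `exists_std_last`, whose
closure is known. -/
lemma Std.closeLast {p : Setoid (Fin (n + 2))} {x : ParHom t 0 (n + 2)} (hx : Std t (n + 2) p x) :
    ∃ q y, Std t n q y ∧ ∃ r : ℂ, closeLast x = r • y := by
  have h := hx.link (Fin.natAdd n 0) (Fin.natAdd n 1)
  obtain ⟨x', hx', q, y, hy, r, e⟩ := exists_std_last (t := t) h.evenRel
    (pairRel_le.1 le_sup_right) fun q hq => exists_std q hq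
  rw [← h.unique hx', closeLast_link] at e
  exact ⟨q, y, hy, r, e⟩

/-! ### Stability of the span under composition -/

/-- The span of the standard morphisms. -/
def stdSpan (t : ℂ) (n : ℕ) : Submodule ℂ (ParHom t 0 n) :=
  Submodule.span ℂ {x | ∃ p, Std t n p x}

lemma std_comp_cross {p : Setoid (Fin N)} {x : ParHom t 0 N} (hx : Std t N p x)
    (hN : N = a + 2 + b) (hM : N = a + 2 + b) :
    ∃ q, Std t N q (x.comp (slice a b (cross t) hN hM)) := by
  rw [at2_eq, ← perm_adjacent (by omega)]
  exact ⟨_, hx.perm _⟩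

lemma std_comp_neut {p : Setoid (Fin N)} {x : ParHom t 0 N} (hx : Std t N p x)
    (hN : N = a + 2 + b) (hM : N = a + 2 + b) :
    ∃ q, Std t N q (x.comp (slice a b (neut t) hN hM)) := by
  rw [at2_eq, at2_neut (by omega)]
  exact ⟨_, hx.link _ _⟩

/-- Induction on the number of strands to the right of the cup; `cup_past_at` reduces it to a cup at
the end, a constructor of `Std`. -/
lemma std_comp_cup : ∀ {a b N M : ℕ} {p : Setoid (Fin N)} {x : ParHom t 0 N} (_ : Std t N p x)
    (hN : N = a + 0 + b) (hM : M = a + 2 + b),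
    ∃ q, Std t M q (x.comp (slice a b (cup t) hN hM))
  | a, 0, N, M, _, x, hx, hN, hM => by
    obtain rfl : N = a := hN
    obtain rfl : M = N + 2 := hM
    have := tensor_cup_eq x
    exact ⟨_, this ▸ hx.cup⟩
  | a, b + 1, N, M, _, x, hx, hN, hM => by
    rw [← cup_past_at a b (by omega) (by omega) hN hM, ← comp_assoc, ← comp_assoc]
    obtain ⟨_, h⟩ := std_comp_cup hx (a := a + 1) (b := b) (M := M) (by omega) (by omega)
    rw [← perm_adjacent (by omega), ← perm_adjacent (by omega)]
    exact ⟨_, (h.perm _).perm _⟩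

/-- `cap_past_at` moves the cap to the right end at the cost of crossings, which the standard
morphism takes up before `Std.closeLast` is used. -/
lemma std_comp_cap : ∀ {a b N M : ℕ} {p : Setoid (Fin N)} {x : ParHom t 0 N} (_ : Std t N p x)
    (hN : N = a + 2 + b) (hM : M = a + 0 + b),
    ∃ q y, Std t M q y ∧ ∃ r : ℂ, x.comp (slice a b (cap t) hN hM) = r • y
  | a, 0, N, M, _, x, hx, hN, hM => by
    obtain rfl : M = a := hM
    obtain rfl : N = M + 2 := hN
    exact hx.closeLast
  | a, b + 1, N, M, _, x, hx, hN, hM => by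
    rw [← cap_past_at a b (by omega) (by omega) hM hN, ← comp_assoc, ← comp_assoc,
      ← perm_adjacent (by omega), ← perm_adjacent (by omega)]
    exact std_comp_cap ((hx.perm _).perm _) (a := a + 1) (b := b) (by omega) (by omega)

lemma comp_mem_stdSpan {f : ParHom t N M}
    (h : ∀ p x, Std t N p x → x.comp f ∈ stdSpan t M) {x : ParHom t 0 N}
    (hx : x ∈ stdSpan t N) : x.comp f ∈ stdSpan t M := by
  induction hx using Submodule.span_induction with
  | mem x hx => exact h _ x hx.choose_spec
  | zero => rw [zero_comp]; exact zero_mem _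
  | add x y _ _ hx hy => rw [add_comp]; exact add_mem hx hy
  | smul r x _ hx => rw [smul_comp]; exact Submodule.smul_mem _ _ hx

/-- Allowing arbitrary identities beside `w` makes the induction pass tensor products: `f ⊗ g` is a
slice of `f` followed by a slice of `g`. -/
lemma comp_slice_mem_stdSpan (w : Word k l) : ∀ {a b N M : ℕ} (hN : N = a + k + b)
    (hM : M = a + l + b) {x : ParHom t 0 N}, x ∈ stdSpan t N →
      x.comp (slice a b (mk w) hN hM) ∈ stdSpan t M := by
  induction w with
  | id k =>
    intro a b N M hN hM x hx
    subst hN hM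
    have e : slice a b (mk (.id k)) rfl rfl = one t (a + k + b) := slice_one a b rfl rfl
    rwa [e, comp_one]
  | comp f g hf hg =>
    intro a b N M hN hM x hx
    rw [show mk (t := t) (f.comp g) = (mk f).comp (mk g) from rfl, ← slice_comp a b _ _ hN rfl hM,
      ← comp_assoc]
    exact hg _ _ (hf _ _ hx)
  | @tensor p q p' q' k l f g hk hl hf hg =>
    intro a b N M hN hM x hx
    rw [show mk (t := t) (f.tensor g hk hl) = (mk f).tensor (mk g) hk hl from rfl,
      tensor_eq_comp _ _ _ _ rfl, tensor_one_eq, one_tensor_eq, ← slice_comp a b _ _ hN rfl hM,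
      slice_slice, slice_slice, ← comp_assoc]
    exact hg _ _ (hf _ _ hx)
  | zero k l =>
    intro a b N M hN hM x hx
    have := slice_zero (t := t) (k := k) (l := l) a b hN hM
    rw [show mk (t := t) (.zero k l) = 0 from rfl, this, ← zero_smul ℂ (0 : ParHom t N M), comp_smul,
      zero_smul]
    exact zero_mem _
  | add f g hf hg =>
    intro a b N M hN hM x hx
    rw [show mk (t := t) (f.add g) = mk f + mk g from rfl, slice_add, comp_add]
    exact add_mem (hf _ _ hx) (hg _ _ hx)
  | smul c f hf =>
    intro a b N M hN hM x hx
    rw [show mk (t := t) (f.smul c) = c • mk f from rfl, slice_smul, comp_smul]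
    exact Submodule.smul_mem _ _ (hf _ _ hx)
  | neutralizer =>
    intro a b N M hN hM x hx
    subst hN hM
    exact comp_mem_stdSpan (fun p x hx => Submodule.subset_span (std_comp_neut hx _ _)) hx
  | cross =>
    intro a b N M hN hM x hx
    subst hN hM
    exact comp_mem_stdSpan (fun p x hx => Submodule.subset_span (std_comp_cross hx _ _)) hx
  | cup =>
    intro a b N M hN hM x hx
    exact comp_mem_stdSpan (fun p x hx => Submodule.subset_span (std_comp_cup hx _ _)) hx
  | cap =>
    intro a b N M hN hM x hx
    refine comp_mem_stdSpan (fun p x hx => ?_) hx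
    obtain ⟨q, y, hy, r, e⟩ := std_comp_cap hx hN hM
    change x.comp (slice a b (ParHom.cap t) hN hM) ∈ _
    rw [e]
    exact Submodule.smul_mem _ _ (Submodule.subset_span ⟨q, hy⟩)

theorem stdSpan_eq_top (t : ℂ) (n : ℕ) : stdSpan t n = ⊤ := by
  refine eq_top_iff.2 fun f _ => ?_
  induction f using Quot.ind with
  | mk w =>
    have h := comp_slice_mem_stdSpan (t := t) w (a := 0) (b := 0) (N := 0) (M := n) rfl (by omega)
      (x := one t 0) (Submodule.subset_span ⟨⊤, .nil _⟩)
    rw [slice_zero_zero, one_comp] at h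
    exact h

end ParHom

end PartitionDiagram

namespace PartitionDiagram

variable {a b c a' b' c' k l m n k' l' m' N M : ℕ}

/-! ### The matrix of a formal morphism -/

/-- The sum over all two-colourings of `n` points. -/
def colourSum : (n : ℕ) → ((Fin n → Bool) → ℕ) → ℕ
  | 0, f => f Fin.elim0
  | n + 1, f => colourSum n (fun y => f (Fin.cons true y)) + colourSum n fun y => f (Fin.cons false y)

lemma colourSum_eq : ∀ (n : ℕ) (f : (Fin n → Bool) → ℕ), colourSum n f = ∑ y, f y
  | 0, f => by
    rw [Fintype.sum_unique, colourSum]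
    exact congrArg f (Subsingleton.elim _ _)
  | n + 1, f => by
    rw [colourSum, colourSum_eq n, colourSum_eq n, ← Equiv.sum_comp (Fin.consEquiv fun _ => Bool),
      Fintype.sum_prod_type, Fintype.sum_bool]
    rfl

/-- A test for all two-colourings of `n` points. -/
def colourAll : (n : ℕ) → ((Fin n → Bool) → Bool) → Bool
  | 0, f => f Fin.elim0
  | n + 1, f => colourAll n (fun y => f (Fin.cons true y)) && colourAll n fun y => f (Fin.cons false y)

lemma of_colourAll : ∀ {n : ℕ} {f : (Fin n → Bool) → Bool}, colourAll n f = true → ∀ y, f y = true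
  | 0, f, h, y => by rwa [colourAll, Subsingleton.elim Fin.elim0 y] at h
  | n + 1, f, h, y => by
    rw [colourAll, Bool.and_eq_true] at h
    rw [← Fin.cons_self_tail y]
    cases y 0
    · exact of_colourAll h.2 _
    · exact of_colourAll h.1 _

namespace Word

/-- The formal morphism is built without linear combinations. -/
def IsMono : {k l : ℕ} → Word k l → Prop
  | _, _, comp f g => IsMono f ∧ IsMono g
  | _, _, tensor f g _ _ => IsMono f ∧ IsMono g
  | _, _, zero _ _ => False
  | _, _, add _ _ => False
  | _, _, smul _ _ => False
  | _, _, _ => True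

/-- The matrix of a formal morphism, indexed by two-colourings. -/
def entry : {k l : ℕ} → Word k l → (Fin k → Bool) → (Fin l → Bool) → ℕ
  | _, _, id k, x, y => if ∀ i, x i = y i then 1 else 0
  | _, _, comp (l := l) f g, x, z => colourSum l fun y => entry f x y * entry g y z
  | _, _, tensor (a := a) (b := b) (a' := a') (b' := b') f g hk hl, x, y =>
      entry f (fun i => x (Fin.cast hk.symm (Fin.castAdd a' i)))
        (fun i => y (Fin.cast hl.symm (Fin.castAdd b' i))) *
      entry g (fun i => x (Fin.cast hk.symm (Fin.natAdd a i)))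
        (fun i => y (Fin.cast hl.symm (Fin.natAdd b i)))
  | _, _, zero _ _, _, _ => 0
  | _, _, add _ _, _, _ => 0
  | _, _, smul _ _, _, _ => 0
  | _, _, neutralizer, x, y => if x 0 = x 1 ∧ y 0 = y 1 ∧ x 0 = y 0 then 1 else 0
  | _, _, cap, x, _ => if x 0 = x 1 then 1 else 0
  | _, _, cup, _, y => if y 0 = y 1 then 1 else 0
  | _, _, cross, x, y => if x 0 = y 1 ∧ x 1 = y 0 then 1 else 0


lemma isMono_flipV (f : Word k l) (h : f.IsMono) : f.flipV.IsMono := by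
  induction f with
  | comp f g hf hg => exact ⟨hg h.2, hf h.1⟩
  | tensor f g _ _ hf hg => exact ⟨hf h.1, hg h.2⟩
  | zero => exact h
  | add => exact h
  | smul => exact h
  | _ => trivial

lemma isMono_flipH (f : Word k l) (h : f.IsMono) : f.flipH.IsMono := by
  induction f with
  | comp f g hf hg => exact ⟨hf h.1, hg h.2⟩
  | tensor f g _ _ hf hg => exact ⟨hg h.2, hf h.1⟩
  | zero => exact h
  | add => exact h
  | smul => exact h
  | _ => trivial

lemma entry_flipV (f : Word k l) (x : Fin l → Bool) (y : Fin k → Bool) :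
    entry f.flipV x y = entry f y x := by
  induction f with
  | id k =>
    simp only [flipV, entry]
    exact if_congr (forall_congr' fun i => eq_comm) rfl rfl
  | comp f g hf hg =>
    simp only [flipV, entry, colourSum_eq, hf, hg]
    exact Finset.sum_congr rfl fun _ _ => mul_comm _ _
  | tensor f g hk hl hf hg => simp only [flipV, entry, hf, hg]
  | neutralizer =>
    simp only [flipV, entry]
    refine if_congr ?_ rfl rfl
    generalize x 0 = p, x 1 = q, y 0 = r, y 1 = s
    revert p q r s
    decide
  | cross =>
    simp only [flipV, entry]
    refine if_congr ?_ rfl rfl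
    generalize x 0 = p, x 1 = q, y 0 = r, y 1 = s
    revert p q r s
    decide
  | _ => rfl

lemma entry_flipH (f : Word k l) (x : Fin k → Bool) (y : Fin l → Bool) :
    entry f.flipH x y = entry f (x ∘ Fin.rev) (y ∘ Fin.rev) := by
  have two : ∀ i : Fin 2, Fin.rev i = 1 - i := by decide
  induction f with
  | id k =>
    simp only [flipH, entry]
    refine if_congr ⟨fun h i => h _, fun h i => ?_⟩ rfl rfl
    simpa using h (Fin.rev i)
  | comp f g hf hg =>
    simp only [flipH, entry, colourSum_eq, hf, hg]
    exact Equiv.sum_comp (Equiv.arrowCongr Fin.revPerm (Equiv.refl Bool))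
      fun y' => entry f (x ∘ Fin.rev) y' * entry g y' (y ∘ Fin.rev)
  | tensor f g hk hl hf hg =>
    subst hk hl
    simp only [flipH, entry, hf, hg]
    rw [mul_comm]
    congr 2 <;> funext i <;> simp only [Function.comp_apply] <;> congr 1 <;> ext <;>
      simp <;> omega
  | neutralizer =>
    simp only [flipH, entry, Function.comp_apply, two]
    refine if_congr ?_ rfl rfl
    change _ ↔ x 1 = x 0 ∧ y 1 = y 0 ∧ x 1 = y 1
    generalize x 0 = p, x 1 = q, y 0 = r, y 1 = s
    revert p q r s
    decide
  | cross =>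
    simp only [flipH, entry, Function.comp_apply, two]
    exact if_congr and_comm rfl rfl
  | cap => exact if_congr eq_comm rfl rfl
  | cup => exact if_congr eq_comm rfl rfl
  | _ => rfl

/-- Reduces an equality of matrices to a Boolean that is computed by recursion on the numbers of
points. -/
lemma entry_eq_of_colourAll {f g : Word k l}
    (h : colourAll k (fun x => colourAll l fun y => decide (entry f x y = entry g x y)) = true)
    (x : Fin k → Bool) (y : Fin l → Bool) : entry f x y = entry g x y :=
  of_decide_eq_true (of_colourAll (of_colourAll h x) y)

/-- At most three strands occur, so the matrices have at most eight rows and columns and are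
compared by evaluation. The circle relation has a scalar on its right side and is excluded by `hg`.
-/
lemma Listed.entry_eq {t : ℂ} {f g : Word k l} (h : Listed t f g) (hg : g.IsMono) :
    ∀ x y, entry f x y = entry g x y := by
  cases h
  case circle => exact hg.elim
  all_goals exact entry_eq_of_colourAll (by decide +kernel)

lemma Listed.isMono {t : ℂ} {f g : Word k l} (h : Listed t f g) : f.IsMono := by
  cases h <;> simp [IsMono, strandLeft, strandRight]

end Word

/-! ### Evaluation of formal morphisms -/

/-- Transport along equalities of the numbers of points. -/
noncomputable def castLin : (hk : k = k') → (hl : l = l') → EvenLin k' l' →ₗ[ℂ] EvenLin k l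
  | rfl, rfl => LinearMap.id

lemma castLin_castLin (hk : k = k') (hl : l = l') (hk' : k' = m) (hl' : l' = n) (f : EvenLin m n) :
    castLin hk hl (castLin hk' hl' f) = castLin (hk.trans hk') (hl.trans hl') f := by
  subst hk hl
  rfl

/-- Turns naturality squares whose sides are permutation partitions of equal ranks into statements
about transport. -/
lemma eq_castLin_of_comp (t : ℂ) (hk : k = k') (hl : l = l') {f : EvenLin k l} {g : EvenLin k' l'}
    (h : vcompLin t _ _ _ f (permLin (finCongr hl)) =
      vcompLin t _ _ _ (permLin (finCongr hk)) g) : f = castLin hk hl g := by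
  subst hk hl
  have h' : vcompLin t _ _ _ f (permLin (Equiv.refl _)) =
      vcompLin t _ _ _ (permLin (Equiv.refl _)) g := h
  rwa [vcompLin_refl, refl_vcompLin] at h'

namespace Word

/-- The linear combination of even partitions that a formal morphism denotes. -/
noncomputable def eval (t : ℂ) : {k l : ℕ} → Word k l → EvenLin k l
  | _, _, id k => permLin (Equiv.refl _)
  | _, _, comp f g => vcompLin t _ _ _ (eval t f) (eval t g)
  | _, _, tensor f g hk hl => castLin hk hl (hcompLin _ _ _ _ (eval t f) (eval t g))
  | _, _, zero _ _ => 0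
  | _, _, add f g => eval t f + eval t g
  | _, _, smul c f => c • eval t f
  | _, _, neutralizer => Finsupp.single (EvenPartition.block 2 2 (by decide)) 1
  | _, _, cap => Finsupp.single (EvenPartition.block 2 0 (by decide)) 1
  | _, _, cup => Finsupp.single (EvenPartition.block 0 2 (by decide)) 1
  | _, _, cross => Finsupp.single (EvenPartition.perm (Equiv.swap 0 1)) 1

lemma resp_block {x : Fin k → Bool} {y : Fin l → Bool} :
    (Partition.block k l).Resp x y ↔ ∀ v w, Sum.elim x y v = Sum.elim x y w :=
  ⟨fun h _ _ => h trivial, fun h _ _ _ => h _ _⟩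

lemma mat_zero (p : Partition k l) (x : Fin k → Bool) (y : Fin l → Bool) {P : Prop} [Decidable P]
    (h : p.Resp x y ↔ P) : mat 0 p x y = if P then 1 else 0 := by
  classical
  rw [mat, pow_zero]
  exact if_congr h rfl rfl

/-- Without sums and scalars, a formal morphism denotes a power of `t` times one partition. In its
matrix every loop counts `2`, so the matrix determines the exponent as well as the partition, and
`mat_inj` recovers both for every `t` at once. -/
lemma exists_eval_eq_single (t : ℂ) (f : Word k l) (h : f.IsMono) :
    ∃ (c : ℕ) (p : EvenPartition k l), eval t f = Finsupp.single p (t ^ c) ∧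
      ∀ x y, mat c p.1 x y = entry f x y := by
  induction f with
  | id k =>
    refine ⟨0, .perm (Equiv.refl _), by rw [pow_zero]; rfl, fun x y => mat_zero _ _ _ ?_⟩
    exact (resp_perm _ _ _).trans funext_iff
  | comp f g hf hg =>
    obtain ⟨c, p, e, hp⟩ := hf h.1
    obtain ⟨d, q, e', hq⟩ := hg h.2
    refine ⟨c + d + p.loops q, p.vcomp q, ?_, fun x z => ?_⟩
    · rw [eval, e, e', vcompLin_single, pow_add, pow_add]
    · rw [entry, colourSum_eq]
      simp only [← hp, ← hq]
      exact mat_vcomp c d p.1 q.1 x z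
  | tensor f g hk hl hf hg =>
    subst hk hl
    obtain ⟨c, p, e, hp⟩ := hf h.1
    obtain ⟨d, q, e', hq⟩ := hg h.2
    refine ⟨c + d, p.hcomp q, ?_, fun x z => ?_⟩
    · rw [eval, e, e', hcompLin_single, pow_add]
      rfl
    · rw [entry, ← hp, ← hq]
      exact mat_hcomp c d p.1 q.1 x z
  | zero => exact h.elim
  | add => exact h.elim
  | smul => exact h.elim
  | neutralizer =>
    refine ⟨0, _, by rw [eval, pow_zero], fun x y => mat_zero _ _ _ (resp_block.trans ?_)⟩
    simp only [Sum.forall, Fin.forall_fin_two, Sum.elim_inl, Sum.elim_inr]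
    generalize x 0 = p, x 1 = q, y 0 = r, y 1 = s
    revert p q r s
    decide
  | cap =>
    refine ⟨0, _, by rw [eval, pow_zero], fun x y => mat_zero _ _ _ (resp_block.trans ?_)⟩
    simp only [Sum.forall, Fin.forall_fin_two, Sum.elim_inl, Sum.elim_inr, IsEmpty.forall_iff]
    generalize x 0 = p, x 1 = q
    revert p q
    decide
  | cup =>
    refine ⟨0, _, by rw [eval, pow_zero], fun x y => mat_zero _ _ _ (resp_block.trans ?_)⟩
    simp only [Sum.forall, Fin.forall_fin_two, Sum.elim_inl, Sum.elim_inr, IsEmpty.forall_iff]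
    generalize y 0 = p, y 1 = q
    revert p q
    decide
  | cross =>
    refine ⟨0, _, by rw [eval, pow_zero], fun x y => mat_zero _ _ _ ((resp_perm _ _ _).trans ?_)⟩
    rw [funext_iff, Fin.forall_fin_two]
    rfl

lemma eval_eq_of_entry (t : ℂ) {f g : Word k l} (hf : f.IsMono) (hg : g.IsMono)
    (h : ∀ x y, entry f x y = entry g x y) : eval t f = eval t g := by
  obtain ⟨c, p, e, hp⟩ := exists_eval_eq_single t f hf
  obtain ⟨d, q, e', hq⟩ := exists_eval_eq_single t g hg
  obtain ⟨rfl, h⟩ := mat_inj (c := c) (d := d) (p := p.1) (q := q.1) fun x y => by rw [hp, hq, h]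
  rw [e, e', Subtype.ext h]

/-- The matrix of the circle has the single entry `2 = 2 ^ 1`, so the exponent of `t` is `1`. -/
lemma eval_circle (t : ℂ) : eval t (comp cup cap) = eval t (smul t (id 0)) := by
  obtain ⟨c, p, e, hp⟩ := exists_eval_eq_single t (comp cup cap) ⟨trivial, trivial⟩
  obtain ⟨rfl, h⟩ := mat_inj (c := c) (d := 1) (p := p.1)
    (q := Partition.perm (Equiv.refl (Fin 0))) fun x y => by
      rw [hp, Subsingleton.elim y x, mat, if_pos ((resp_perm _ _ _).2 (Subsingleton.elim _ _))]
      rfl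
  rw [e, pow_one, eval, eval, permLin, Finsupp.smul_single, smul_eq_mul, mul_one]
  exact single_congr h rfl

/-- The listed relations and their reflections hold for even partitions. -/
lemma Listed.eval_eq {t : ℂ} {f g : Word k l} (h : Listed t f g) :
    eval t f = eval t g ∧ eval t f.flipV = eval t g.flipV ∧ eval t f.flipH = eval t g.flipH ∧
      eval t f.flipV.flipH = eval t g.flipV.flipH := by
  by_cases hg : g.IsMono
  · have hf := h.isMono
    have e := h.entry_eq hg
    have eV : ∀ x y, entry f.flipV x y = entry g.flipV x y := fun x y => by
      rw [entry_flipV, entry_flipV, e]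
    refine ⟨eval_eq_of_entry t hf hg e,
      eval_eq_of_entry t (isMono_flipV f hf) (isMono_flipV g hg) eV,
      eval_eq_of_entry t (isMono_flipH f hf) (isMono_flipH g hg) fun x y => ?_,
      eval_eq_of_entry t (isMono_flipH _ (isMono_flipV f hf)) (isMono_flipH _ (isMono_flipV g hg))
        fun x y => ?_⟩
    · rw [entry_flipH, entry_flipH, e]
    · rw [entry_flipH, entry_flipH, eV]
  · cases h
    -- The circle is unchanged by both reflections.
    case circle => exact ⟨eval_circle t, eval_circle t, eval_circle t, eval_circle t⟩
    all_goals exact absurd (by simp [IsMono, strandLeft, strandRight]) hg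

/-- Soundness: the defining congruence of `Par_t` holds for even partitions, so evaluation descends
to the quotient. -/
lemma eval_eq_of_rel {t : ℂ} {f g : Word k l} (h : Rel t f g) : eval t f = eval t g := by
  induction h with
  | refl => rfl
  | symm _ ih => exact ih.symm
  | trans _ _ ih ih' => exact ih.trans ih'
  | comp _ _ ih ih' => rw [eval, eval, ih, ih']
  | tensor hk hl _ _ ih ih' => rw [eval, eval, ih, ih']
  | add _ _ ih ih' => rw [eval, eval, ih, ih']
  | smul c _ ih => rw [eval, eval, ih]
  | id_comp f => exact refl_vcompLin t _
  | comp_id f => exact vcompLin_refl t _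
  | comp_assoc f g h => exact vcompLin_assoc t _ _ _
  | add_assoc f g h => exact add_assoc _ _ _
  | add_comm f g => exact add_comm _ _
  | zero_add f => exact zero_add _
  | one_smul f => exact one_smul _ _
  | mul_smul c d f => exact mul_smul _ _ _
  | smul_add c f g => exact smul_add _ _ _
  | add_smul c d f => exact add_smul _ _ _
  | zero_smul f => exact zero_smul _ _
  | add_comp f f' g => exact vcompLin_add_left t _ _ _
  | comp_add f g g' => exact map_add _ _ _
  | smul_comp c f g => exact vcompLin_smul_left t _ _ _
  | comp_smul c f g => exact map_smul _ _ _
  | add_tensor f f' g hk hl => simp only [eval, map_add, LinearMap.add_apply]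
  | tensor_add f g g' hk hl => simp only [eval, map_add]
  | smul_tensor c f g hk hl => simp only [eval, map_smul, LinearMap.smul_apply]
  | tensor_smul c f g hk hl => simp only [eval, map_smul]
  | tensor_id a b => exact (permLin_hcomp _ _).trans (congrArg permLin sumPerm_refl)
  | interchange f g f' g' hk hl hm =>
    subst hk hl hm
    exact interchangeLin t _ _ _ _
  | tensor_assoc f g h hp hq hp' hq' hk hl hk' hl' =>
    subst hp hq hp' hq' hk hl
    exact eq_castLin_of_comp t hk' hl' (assocLin t _ _ _)
  | @unit_tensor k l f hk hl =>
    have h := eq_castLin_of_comp t (Nat.zero_add k) (Nat.zero_add l) (leftUnitLin t (eval t f))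
    simp only [eval, h]
    rw [castLin_castLin]
    rfl
  | @tensor_unit k l f hk hl =>
    have h := eq_castLin_of_comp t (Nat.add_zero k) (Nat.add_zero l) (rightUnitLin t (eval t f))
    simp only [eval, h]
    rw [castLin_castLin]
    rfl
  | listed h => exact h.eval_eq.1
  | listed_flipV h => exact h.eval_eq.2.1
  | listed_flipH h => exact h.eval_eq.2.2.1
  | listed_flipVH h => exact h.eval_eq.2.2.2

end Word

end PartitionDiagram

namespace PartitionDiagram

namespace ParHom

variable {t : ℂ} {a b c a' b' c' k l m n k' l' m' N M : ℕ}

/-! ### The functor on morphisms -/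

/-- The linear combination of even partitions that a morphism denotes. -/
noncomputable def toLin (t : ℂ) (k l : ℕ) : ParHom t k l →ₗ[ℂ] EvenLin k l where
  toFun := Quot.lift (Word.eval t) fun _ _ h => Word.eval_eq_of_rel h
  map_add' f g := by
    induction f using Quot.ind
    induction g using Quot.ind
    rfl
  map_smul' c f := by
    induction f using Quot.ind
    rfl

lemma toLin_one : toLin t k k (one t k) = permLin (Equiv.refl _) := rfl

lemma toLin_comp (f : ParHom t k l) (g : ParHom t l m) :
    toLin t k m (f.comp g) = vcompLin t k l m (toLin t k l f) (toLin t l m g) := by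
  induction f using Quot.ind
  induction g using Quot.ind
  rfl

lemma toLin_tensor (f : ParHom t a b) (g : ParHom t a' b') (hk : k = a + a') (hl : l = b + b') :
    toLin t k l (f.tensor g hk hl) = castLin hk hl (hcompLin _ _ _ _ (toLin t a b f)
      (toLin t a' b' g)) := by
  induction f using Quot.ind
  induction g using Quot.ind
  rfl

/-! ### Morphisms that denote a single partition -/

/-- The morphism denotes one partition, whose blocks are described by `R`. -/
def Rep (f : ParHom t k l) (R : (Fin k → Bool) → (Fin l → Bool) → Prop) : Prop :=
  ∃ p : EvenPartition k l, toLin t k l f = Finsupp.single p 1 ∧ ∀ x y, p.1.Resp x y ↔ R x y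

namespace Rep

variable {R R' : (Fin k → Bool) → (Fin l → Bool) → Prop} {S : (Fin l → Bool) → (Fin m → Bool) → Prop}

lemma congr {f : ParHom t k l} (h : Rep f R) (e : ∀ x y, R x y ↔ R' x y) : Rep f R' := by
  obtain ⟨p, h1, h2⟩ := h
  exact ⟨p, h1, fun x y => (h2 x y).trans (e x y)⟩

lemma one (t : ℂ) (n : ℕ) : Rep (ParHom.one t n) fun x y => x = y :=
  ⟨.perm (Equiv.refl _), rfl, fun x y => resp_perm _ x y⟩

lemma neut (t : ℂ) : Rep (ParHom.neut t) fun x y => x = y ∧ x 0 = x 1 := by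
  refine ⟨_, rfl, fun x y => Word.resp_block.trans ?_⟩
  simp only [Sum.forall, Fin.forall_fin_two, Sum.elim_inl, Sum.elim_inr, funext_iff]
  generalize x 0 = p, x 1 = q, y 0 = r, y 1 = s
  revert p q r s
  decide

lemma cap (t : ℂ) : Rep (ParHom.cap t) fun x _ => x 0 = x 1 := by
  refine ⟨_, rfl, fun x y => Word.resp_block.trans ?_⟩
  simp only [Sum.forall, Fin.forall_fin_two, Sum.elim_inl, Sum.elim_inr, IsEmpty.forall_iff]
  generalize x 0 = p, x 1 = q
  revert p q
  decide

lemma cup (t : ℂ) : Rep (ParHom.cup t) fun _ y => y 0 = y 1 := by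
  refine ⟨_, rfl, fun x y => Word.resp_block.trans ?_⟩
  simp only [Sum.forall, Fin.forall_fin_two, Sum.elim_inl, Sum.elim_inr, IsEmpty.forall_iff]
  generalize y 0 = p, y 1 = q
  revert p q
  decide

lemma cross (t : ℂ) : Rep (ParHom.cross t) fun x y => x = y ∘ Equiv.swap 0 1 :=
  ⟨_, rfl, fun x y => resp_perm _ x y⟩

/-- A composition without loops. -/
lemma comp {f : ParHom t k l} {g : ParHom t l m} (hf : Rep f R) (hg : Rep g S)
    (h : ∀ y, R (fun _ => true) y → S y (fun _ => true) → y = fun _ => true) :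
    Rep (f.comp g) fun x z => ∃ y, R x y ∧ S y z := by
  classical
  obtain ⟨p, hp, hR⟩ := hf
  obtain ⟨q, hq, hS⟩ := hg
  -- By `card_middle` the number of admissible `y` is a power of two or zero, so existence of one
  -- decides whether the outer colouring respects the composite.
  have hpos : ∀ x z, (p.1.vcomp q.1).Resp x z ↔ ∃ y, R x y ∧ S y z := by
    intro x z
    have e := card_middle p.1 q.1 x z
    simp only [hR, hS] at e
    rw [← Finset.card_filter] at e
    unfold mat at e
    constructor
    · intro hxz
      rw [if_pos hxz] at e
      obtain ⟨y, hy⟩ := Finset.card_pos.1 (e ▸ Nat.pow_pos two_pos)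
      exact ⟨y, (Finset.mem_filter.1 hy).2⟩
    · rintro ⟨y, hy⟩
      by_contra hxz
      rw [if_neg hxz, Finset.card_eq_zero] at e
      exact Finset.notMem_empty y (e ▸ Finset.mem_filter.2 ⟨Finset.mem_univ _, hy⟩)
  have htrue : ∀ {k l : ℕ} (p : Partition k l), p.Resp (fun _ => true) (fun _ => true) := by
    intro k l p v w _
    rw [Setoid.ker_def]
    rcases v with v | v <;> rcases w with w | w <;> rfl
  -- For the constant outer colouring the number of admissible `y` is `2 ^ loops`, and `h` leaves at
  -- most one.
  have h0 : p.1.loops q.1 = 0 := by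
    have e := card_middle p.1 q.1 (fun _ => true) (fun _ => true)
    simp only [hR, hS] at e
    rw [← Finset.card_filter, mat, if_pos (htrue _)] at e
    have : (2 : ℕ) ^ p.1.loops q.1 ≤ 1 := by
      rw [← e]
      refine Finset.card_le_one.2 fun y hy z hz => ?_
      have hy := (Finset.mem_filter.1 hy).2
      have hz := (Finset.mem_filter.1 hz).2
      rw [h y hy.1 hy.2, h z hz.1 hz.2]
    by_contra hne
    exact absurd this (not_le.2 (Nat.one_lt_two_pow hne))
  refine ⟨p.vcomp q, ?_, hpos⟩
  rw [toLin_comp, hp, hq, vcompLin_single]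
  refine single_congr rfl ?_
  change 1 * 1 * t ^ p.1.loops q.1 = 1
  rw [h0, pow_zero, one_mul, one_mul]

lemma tensor {f : ParHom t a b} {g : ParHom t a' b'}
    {R : (Fin a → Bool) → (Fin b → Bool) → Prop} {R' : (Fin a' → Bool) → (Fin b' → Bool) → Prop}
    (hf : Rep f R) (hg : Rep g R') (hk : k = a + a') (hl : l = b + b') :
    Rep (f.tensor g hk hl) fun x y =>
      R (fun i => x (Fin.cast hk.symm (Fin.castAdd a' i)))
        (fun i => y (Fin.cast hl.symm (Fin.castAdd b' i))) ∧
      R' (fun i => x (Fin.cast hk.symm (Fin.natAdd a i)))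
        (fun i => y (Fin.cast hl.symm (Fin.natAdd b i))) := by
  subst hk hl
  obtain ⟨p, hp, hR⟩ := hf
  obtain ⟨q, hq, hS⟩ := hg
  refine ⟨p.hcomp q, ?_, fun x y => (resp_hcomp p.1 q.1 x y).trans (and_congr (hR _ _) (hS _ _))⟩
  rw [toLin_tensor, hp, hq, hcompLin_single, one_mul]
  rfl

/-- The partition is determined by the description. -/
lemma eq_of_rep {f : ParHom t k l} {p : EvenPartition k l} (h : Rep f R)
    (hp : ∀ x y, p.1.Resp x y ↔ R x y) : toLin t k l f = Finsupp.single p 1 := by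
  obtain ⟨q, e, hq⟩ := h
  rw [e]
  exact single_congr (Partition.ext_resp fun x y => (hq x y).trans (hp x y).symm) rfl

lemma slice {f : ParHom t k l} (h : Rep f R) (a b : ℕ) :
    Rep (ParHom.slice a b f (N := a + k + b) (M := a + l + b) rfl rfl) fun x y =>
      ((∀ i, x (Fin.castAdd b (Fin.castAdd k i)) = y (Fin.castAdd b (Fin.castAdd l i))) ∧
        R (fun i => x (Fin.castAdd b (Fin.natAdd a i)))
          (fun i => y (Fin.castAdd b (Fin.natAdd a i)))) ∧
      ∀ i, x (Fin.natAdd (a + k) i) = y (Fin.natAdd (a + l) i) := by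
  refine (((one t a).tensor h rfl rfl).tensor (one t b) rfl rfl).congr fun x y => ?_
  rw [funext_iff, funext_iff]
  rfl

lemma perm (σ : Equiv.Perm (Fin n)) : Rep (ParHom.perm t n σ) fun x y => x = y ∘ σ := by
  have hσ : σ ∈ (⊤ : Submonoid (Equiv.Perm (Fin n))) := trivial
  rw [← CoxeterLift.adjacent_closure] at hσ
  induction hσ using Submonoid.closure_induction with
  | one =>
    rw [map_one]
    exact one t n
  | mul σ τ _ _ hσ hτ =>
    rw [map_mul, mul_def]
    refine (hτ.comp hσ fun y hy _ => ?_).congr fun x z => ?_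
    · funext i
      have := congrFun hy (τ⁻¹ i)
      simpa using this.symm
    · simp only [exists_eq_right]
      rfl
  | mem σ h =>
    obtain ⟨i, hi, rfl⟩ := h
    obtain ⟨b, rfl⟩ : ∃ b, n = i + 2 + b := ⟨n - (i + 2), by omega⟩
    rw [perm_adjacent, ← at2_eq (b := b) (ParHom.cross t) rfl rfl]
    refine ((cross t).slice i b).congr fun x y => ?_
    have e0 : (⟨i, by omega⟩ : Fin (i + 2 + b)) = Fin.castAdd b (Fin.natAdd i 0) := rfl
    have e1 : (⟨i + 1, hi⟩ : Fin (i + 2 + b)) = Fin.castAdd b (Fin.natAdd i 1) := rfl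
    have key : ∀ j, Equiv.swap (⟨i, by omega⟩ : Fin (i + 2 + b)) ⟨i + 1, hi⟩ j =
        if (j : ℕ) = i then ⟨i + 1, hi⟩ else if (j : ℕ) = i + 1 then ⟨i, by omega⟩ else j := by
      intro j
      rw [Equiv.swap_apply_def]
      simp only [Fin.ext_iff]
    constructor
    · rintro ⟨⟨h1, h2⟩, h3⟩
      funext j
      rw [Function.comp_apply, key]
      refine Fin.addCases (fun j => ?_) (fun j => ?_) j
      · refine Fin.addCases (fun j => ?_) (fun j => ?_) j
        · rw [if_neg (by simp; omega), if_neg (by simp; omega)]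
          exact h1 j
        · have := congrFun h2 j
          fin_cases j
          · simpa [e1] using this
          · simpa [e0] using this
      · rw [if_neg (by simp; omega), if_neg (by simp; omega)]
        exact h3 j
    · rintro rfl
      refine ⟨⟨fun j => ?_, ?_⟩, fun j => ?_⟩
      · rw [Function.comp_apply, key, if_neg (by simp; omega), if_neg (by simp; omega)]
      · funext j
        simp only [Function.comp_apply, key]
        fin_cases j
        · simp; rfl
        · simp; rfl
      · rw [Function.comp_apply, key, if_neg (by simp; omega), if_neg (by simp; omega)]

lemma at2_neut_zero (hn : 1 < n) : Rep (at2 (ParHom.neut t) n 0) fun x y =>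
    x = y ∧ y ⟨0, by omega⟩ = y ⟨1, hn⟩ := by
  obtain ⟨b, rfl⟩ : ∃ b, n = 0 + 2 + b := ⟨n - 2, by omega⟩
  rw [← at2_eq (b := b) (ParHom.neut t) rfl rfl]
  refine ((neut t).slice 0 b).congr fun x y => ?_
  constructor
  · rintro ⟨⟨-, h1, h2⟩, h3⟩
    have e : x = y := by
      funext j
      refine Fin.addCases (fun j => ?_) (fun j => ?_) j
      · refine Fin.addCases (fun j => j.elim0) (fun j => ?_) j
        exact congrFun h1 j
      · exact h3 j
    subst e
    exact ⟨rfl, h2⟩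
  · rintro ⟨rfl, h⟩
    exact ⟨⟨fun j => j.elim0, rfl, h⟩, fun _ => rfl⟩

lemma link (i j : Fin n) : Rep (ParHom.link t i j) fun x y => x = y ∧ y i = y j := by
  by_cases hij : i = j
  · subst hij
    rw [link_self, one_def]
    exact (one t n).congr fun x y => (and_iff_left rfl).symm
  · obtain ⟨σ, hn, rfl, rfl⟩ := exists_perm_pair hij
    rw [link_eq, mul_def, mul_def]
    -- A conjugate of the neutralizer at the first two positions. No loops arise, since permutations
    -- and links copy the outer colouring to the middle rows.
    refine ((perm σ⁻¹).comp ((at2_neut_zero hn).comp (perm σ) ?_) ?_).congr fun x z => ?_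
    · rintro y ⟨h, -⟩ -
      exact h.symm
    · rintro y h -
      funext i
      have := congrFun h (σ i)
      simpa using this.symm
    · constructor
      · rintro ⟨_, rfl, _, ⟨rfl, h⟩, rfl⟩
        refine ⟨funext fun i => by simp, h⟩
      · rintro ⟨rfl, h⟩
        exact ⟨x ∘ σ, funext fun i => by simp, _, ⟨rfl, h⟩, rfl⟩

end Rep

/-- The partition carried along in `Std` is the one denoted: each constructor matches an operation
on colourings, and none creates a loop. -/
lemma Std.rep {p : Setoid (Fin n)} {x : ParHom t 0 n} (h : Std t n p x) :
    Rep x fun _ y => p ≤ Setoid.ker y := by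
  induction h with
  | nil p => exact (Rep.one t 0).congr fun x y =>
      iff_of_true (Subsingleton.elim _ _) fun {i} => i.elim0
  | cup _ ih =>
    refine (ih.tensor (Rep.cup t) rfl rfl).congr fun _ y => ?_
    rw [sup_le_iff, map_le_iff, pairRel_le]
    rfl
  | perm σ _ ih =>
    refine (ih.comp (Rep.perm σ) fun y _ h => ?_).congr fun _ y => ?_
    · exact h
    · simp only [exists_eq_right, map_le_iff]
      rfl
  | link i j _ ih =>
    refine (ih.comp (Rep.link i j) fun y _ h => ?_).congr fun _ y => ?_
    · exact h.1
    · rw [sup_le_iff, pairRel_le]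
      constructor
      · rintro ⟨_, h, rfl, h'⟩
        exact ⟨h, h'⟩
      · rintro ⟨h, h'⟩
        exact ⟨y, h, rfl, h'⟩

/-! ### Bijectivity for morphisms out of the unit -/

/-- The partition of the upper row. -/
def upper (p : EvenPartition 0 n) : Setoid (Fin n) := p.1.comap Sum.inr

lemma upper_le_ker (p : EvenPartition 0 n) (x : Fin 0 → Bool) (y : Fin n → Bool) :
    p.1.Resp x y ↔ upper p ≤ Setoid.ker y := by
  constructor
  · intro h i j hij
    exact h hij
  · rintro h (i | i) (j | j) hij
    · exact i.elim0
    · exact i.elim0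
    · exact j.elim0
    · exact h hij

lemma evenRel_upper (p : EvenPartition 0 n) : EvenRel (upper p) := by
  intro y hy
  have := (isEven_iff p.1).1 p.2 Fin.elim0 y ((upper_le_ker _ _ _).2 hy)
  simpa using this

/-- An equivalence relation is determined by the colourings constant on its classes; the indicator
of the class of `i` is the one to test. -/
lemma le_of_ker_le {p q : Setoid (Fin n)} (h : ∀ y : Fin n → Bool, q ≤ Setoid.ker y →
    p ≤ Setoid.ker y) : p ≤ q := by
  classical
  intro i j hij
  have := h (fun k => decide (q i k)) (fun {a b} hab => by
    rw [Setoid.ker_def, decide_eq_decide]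
    exact ⟨fun h => q.trans' h hab, fun h => q.trans' h (q.symm' hab)⟩) hij
  rw [Setoid.ker_def, decide_eq_decide] at this
  exact this.1 (q.refl' i)

/-- A standard morphism that denotes a given partition. -/
noncomputable def std (t : ℂ) (p : EvenPartition 0 n) : ParHom t 0 n :=
  (exists_std (t := t) (upper p) (evenRel_upper p)).choose

lemma std_spec (t : ℂ) (p : EvenPartition 0 n) : Std t n (upper p) (std t p) :=
  (exists_std (t := t) (upper p) (evenRel_upper p)).choose_spec

lemma toLin_std (p : EvenPartition 0 n) : toLin t 0 n (std t p) = Finsupp.single p 1 :=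
  (std_spec t p).rep.eq_of_rep (upper_le_ker p)

lemma surjective_of_single (h : ∀ p : EvenPartition k l, ∃ f, toLin t k l f = Finsupp.single p 1) :
    Function.Surjective (toLin t k l) := by
  intro g
  induction g using Finsupp.induction_linear with
  | zero => exact ⟨0, map_zero _⟩
  | add f g hf hg =>
    obtain ⟨f', rfl⟩ := hf
    obtain ⟨g', rfl⟩ := hg
    exact ⟨f' + g', map_add _ _ _⟩
  | single p r =>
    obtain ⟨f, hf⟩ := h p
    exact ⟨r • f, by rw [map_smul, hf, Finsupp.smul_single, smul_eq_mul, mul_one]⟩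

lemma toLin_bijective_zero (t : ℂ) (n : ℕ) : Function.Bijective (toLin t 0 n) := by
  refine ⟨?_, surjective_of_single fun p => ⟨_, toLin_std p⟩⟩
  -- Sending each partition to its standard morphism gives a left inverse of evaluation; this can be
  -- checked on the spanning set of standard morphisms.
  let s : EvenLin 0 n →ₗ[ℂ] ParHom t 0 n := Finsupp.linearCombination ℂ (std t)
  have hs : ∀ x, s (toLin t 0 n x) = x := by
    intro x
    have hx : x ∈ stdSpan t n := stdSpan_eq_top t n ▸ trivial
    induction hx using Submodule.span_induction with
    | zero => rw [map_zero, map_zero]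
    | add x y _ _ hx hy => rw [map_add, map_add, hx, hy]
    | smul r x _ hx => rw [map_smul, map_smul, hx]
    | mem x h =>
      obtain ⟨p, hp⟩ := h
      obtain ⟨q, e, hq⟩ := hp.rep
      -- The denoted partition `q` has the same compatible colourings as `p`, so `std t q` and `x`
      -- represent the same partition and agree by `Std.unique`.
      have hpq : upper q = p := le_antisymm
        (le_of_ker_le fun y h => (upper_le_ker q Fin.elim0 y).1 ((hq _ _).2 h))
        (le_of_ker_le fun y h => (hq Fin.elim0 y).1 ((upper_le_ker _ _ _).2 h))
      rw [e, Finsupp.linearCombination_single, one_smul]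
      exact (hpq ▸ std_spec t q).unique hp
  exact Function.LeftInverse.injective hs

/-! ### Bending strands -/

/-- The last lower point is bent to the upper row. -/
def bendUp (f : ParHom t (k + 1) l) : ParHom t k (l + 1) :=
  (slice k 0 (cup t) (M := k + 1 + 1) rfl rfl).comp (f.tensor (one t 1) rfl rfl)

/-- The last upper point is bent to the lower row. -/
def bendDown (f : ParHom t k (l + 1)) : ParHom t (k + 1) l :=
  (f.tensor (one t 1) rfl rfl).comp (slice l 0 (cap t) (N := l + 1 + 1) rfl rfl)

lemma tensor_cap_eq (f : ParHom t k l) :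
    (f.tensor (one t 2) rfl rfl).comp (slice l 0 (cap t) rfl rfl) =
      (slice k 0 (cap t) rfl rfl).comp f := by
  have e : f.tensor (one t 0) rfl rfl = f := tensor_unit f _ _
  conv_rhs => rw [← e]
  rw [← one_tensor_eq, ← one_tensor_eq, interchange, interchange, one_comp, one_comp, comp_one,
    comp_one]

lemma comp_tensor_one (f : ParHom t k l) (g : ParHom t l m) (b : ℕ) :
    (f.comp g).tensor (one t b) rfl rfl =
      (f.tensor (one t b) rfl rfl).comp (g.tensor (one t b) rfl rfl) := by
  rw [interchange, one_comp]

lemma tensor_one_one (f : ParHom t k l) :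
    (f.tensor (one t 1) rfl rfl).tensor (one t 1) rfl rfl = f.tensor (one t 2) rfl rfl := by
  rw [← one_tensor_one (a := 1) (b := 1) (N := 2) rfl rfl]
  exact tensor_assoc _ _ _ _ _ _ _ _ _ _ _

lemma slice_tensor_one (f : ParHom t a b) :
    (slice k 0 f rfl rfl).tensor (one t 1) rfl rfl = slice k 1 f rfl rfl := by
  rw [← one_tensor_eq]
  rfl

/-- The cap slides past `f` on the remaining strands and meets the cup in a zigzag. -/
lemma bendDown_bendUp (f : ParHom t (k + 1) l) : bendDown (bendUp f) = f := by
  have h := congrArg (fun f => slice k 0 f (N := k + 1) (M := k + 1) rfl rfl) (zigzag_left (t := t))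
  simp only [← slice_comp k 0 _ _ (n := k + 1) (N := k + 1) (M := k + 3) rfl rfl rfl,
    slice_one] at h
  rw [slice_slice, slice_slice] at h
  rw [bendDown, bendUp, comp_tensor_one, tensor_one_one, comp_assoc]
  refine (congrArg _ (tensor_cap_eq f)).trans ?_
  rw [← comp_assoc]
  refine Eq.trans (congrArg (fun g => comp g f) ?_) (one_comp f)
  exact (congrArg (fun g => comp g _) (slice_tensor_one (cup t))).trans h

lemma bendUp_injective : Function.Injective (bendUp (t := t) (k := k) (l := l)) :=
  Function.LeftInverse.injective bendDown_bendUp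

/-- The evaluation of `bendUp f` depends on that of `f` only. -/
lemma toLin_injective_succ (h : Function.Injective (toLin t k (l + 1))) :
    Function.Injective (toLin t (k + 1) l) := by
  intro f g e
  refine bendUp_injective (h ?_)
  rw [bendUp, bendUp, toLin_comp, toLin_comp, toLin_tensor, toLin_tensor, e]

/-- The cap forces the last upper point of `f` to have the colour of the new lower strand, whence
the extension of `z`. The outer colouring determines the middle one, so no loop appears. -/
lemma Rep.bendDown {f : ParHom t k (l + 1)} {R : (Fin k → Bool) → (Fin (l + 1) → Bool) → Prop}
    (h : Rep f R) : Rep (bendDown f) fun x z =>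
      R (fun i => x (Fin.castAdd 1 i)) (Fin.append z fun _ : Fin 1 => x (Fin.natAdd k 0)) := by
  refine ((h.tensor (Rep.one t 1) rfl rfl).comp ((Rep.cap t).slice l 0) fun y h1 h2 => ?_).congr
    fun x (z : Fin l → Bool) => ?_
  · obtain ⟨-, h1⟩ := h1
    obtain ⟨⟨h2, h3⟩, -⟩ := h2
    have e1 : y (Fin.natAdd (l + 1) 0) = true := (congrFun h1 0).symm
    have e0 : y (Fin.castAdd 1 (Fin.natAdd l 0)) = true := h3.trans e1
    funext j
    refine Fin.addCases (fun j => ?_) (fun j => ?_) j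
    · refine Fin.addCases (fun j => ?_) (fun j => ?_) j
      · exact h2 j
      · rw [Subsingleton.elim j 0]
        exact e0
    · rw [Subsingleton.elim j 0]
      exact e1
  · constructor
    · rintro ⟨y, ⟨h1, h1'⟩, ⟨h2, h3⟩, -⟩
      have e : (fun j => y (Fin.castAdd 1 j)) =
          Fin.append z fun _ : Fin 1 => x (Fin.natAdd k 0) := by
        funext j
        refine Fin.addCases (fun j => ?_) (fun j => ?_) j
        · rw [Fin.append_left]
          exact h2 j
        · rw [Fin.append_right, Subsingleton.elim j 0]
          exact h3.trans (congrFun h1' 0).symm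
      exact (congrArg (R _) e).mp h1
    · intro h
      have e (v : Fin (l + 1) → Bool) (w : Fin 1 → Bool) :
          (fun j => Fin.append v w (Fin.castAdd 1 j)) = v :=
        funext fun j => Fin.append_left _ _ _
      refine ⟨Fin.append (Fin.append z fun _ : Fin 1 => x (Fin.natAdd k 0)) fun _ : Fin 1 =>
        x (Fin.natAdd k 0), ⟨(congrArg (R _) (e _ _)).mpr h, ?_⟩, ⟨fun i => ?_, ?_⟩,
        fun i => i.elim0⟩
      · funext j
        rw [Subsingleton.elim j 0]
        exact (Fin.append_right (Fin.append z fun _ : Fin 1 => x (Fin.natAdd k 0))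
          (fun _ : Fin 1 => x (Fin.natAdd k 0)) (0 : Fin 1)).symm
      · exact (Fin.append_left _ _ (Fin.castAdd 1 i)).trans (Fin.append_left _ _ _)
      · exact ((Fin.append_left _ _ (Fin.natAdd l (0 : Fin 1))).trans
          (Fin.append_right _ _ _)).trans
          (Fin.append_right (Fin.append z fun _ : Fin 1 => x (Fin.natAdd k 0))
          (fun _ : Fin 1 => x (Fin.natAdd k 0)) (0 : Fin 1)).symm

/-- The last lower point of a partition is bent to the upper row. -/
def bendVertex (k l : ℕ) : Fin k ⊕ Fin (l + 1) → Fin (k + 1) ⊕ Fin l :=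
  Sum.elim (fun i => Sum.inl (Fin.castAdd 1 i))
    (Fin.addCases (fun j => Sum.inr j) fun _ => Sum.inl (Fin.natAdd k 0))

lemma resp_bendVertex (p : Partition (k + 1) l) (x : Fin (k + 1) → Bool) (z : Fin l → Bool) :
    Partition.Resp (p.comap (bendVertex k l)) (fun i => x (Fin.castAdd 1 i))
      (Fin.append z fun _ : Fin 1 => x (Fin.natAdd k 0)) ↔ p.Resp x z := by
  have hcol : ∀ v, Sum.elim (fun i => x (Fin.castAdd 1 i))
      (Fin.append z fun _ : Fin 1 => x (Fin.natAdd k 0)) v = Sum.elim x z (bendVertex k l v) := by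
    rintro (v | v)
    · rfl
    · refine Fin.addCases (fun v => ?_) (fun v => ?_) v <;> simp [bendVertex]
  have hsurj : ∀ w, ∃ v, bendVertex k l v = w := by
    rintro (w | w)
    · refine Fin.addCases (fun w => ⟨Sum.inl w, rfl⟩) (fun w => ⟨Sum.inr (Fin.natAdd l w), ?_⟩) w
      rw [Subsingleton.elim w 0]
      simp [bendVertex]
    · exact ⟨Sum.inr (Fin.castAdd 1 w), by simp [bendVertex]⟩
  constructor
  · intro h v w hvw
    obtain ⟨v, rfl⟩ := hsurj v
    obtain ⟨w, rfl⟩ := hsurj w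
    rw [Setoid.ker_def, ← hcol, ← hcol]
    exact h hvw
  · intro h v w hvw
    rw [Setoid.ker_def, hcol, hcol]
    exact h hvw

/-- Bending moves a point to the other row and keeps its colour, so the number of coloured points is
unchanged. -/
lemma isEven_bendVertex {p : Partition (k + 1) l} (hp : p.IsEven) :
    Partition.IsEven (p.comap (bendVertex k l)) := by
  rw [isEven_iff] at hp ⊢
  intro x y h
  -- Every colouring of the bent vertices arises from one of the original vertices, the colour of
  -- the last upper point going to the last lower one.
  obtain ⟨x, z, rfl, rfl⟩ : ∃ (x' : Fin (k + 1) → Bool) (z : Fin l → Bool),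
      x = (fun i => x' (Fin.castAdd 1 i)) ∧
        y = Fin.append z fun _ : Fin 1 => x' (Fin.natAdd k 0) := by
    refine ⟨Fin.append x fun _ : Fin 1 => y (Fin.natAdd l 0), fun j => y (Fin.castAdd 1 j),
      funext fun i => (Fin.append_left _ _ _).symm, funext fun j => ?_⟩
    refine Fin.addCases (fun j => ?_) (fun j => ?_) j
    · rw [Fin.append_left]
    · rw [Fin.append_right, Fin.append_right, Subsingleton.elim j 0]
  have := hp _ _ ((resp_bendVertex p x z).1 h)
  simp only [Finset.card_filter, Fin.sum_univ_add, Fin.append_left, Fin.append_right,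
    Finset.univ_unique, Finset.sum_singleton, Fin.default_eq_zero] at this ⊢
  rw [Nat.even_iff] at *
  omega

/-- Induction on the number of lower points. Injectivity passes along `bendUp`; for surjectivity, a
partition is bent up, lifted by the induction hypothesis, and the lift is bent down. -/
lemma toLin_bijective (t : ℂ) : ∀ k l : ℕ, Function.Bijective (toLin t k l)
  | 0, l => toLin_bijective_zero t l
  | k + 1, l => by
    have ih := toLin_bijective t k (l + 1)
    refine ⟨toLin_injective_succ ih.1, surjective_of_single fun p => ?_⟩
    obtain ⟨f, hf⟩ := ih.2 (Finsupp.single ⟨_, isEven_bendVertex p.2⟩ 1)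
    exact ⟨bendDown f, Rep.eq_of_rep (Rep.bendDown ⟨_, hf, fun _ _ => Iff.rfl⟩)
      fun x y => (resp_bendVertex p.1 x y).symm⟩

end ParHom

end PartitionDiagram

namespace PartitionDiagram

variable {t : ℂ}

/-! ### The isomorphism of categories -/

/-- The functor from `Par_t` to the reflection category. -/
noncomputable def toReflection (t : ℂ) : ParCat t ⥤ ReflectionCat t where
  obj X := ⟨X.rank⟩
  map {X Y} f := ParHom.toLin t X.rank Y.rank f
  map_id _ := ParHom.toLin_one
  map_comp f g := ParHom.toLin_comp f g

instance : (toReflection t).Faithful where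
  map_injective h := (ParHom.toLin_bijective t _ _).1 h

instance : (toReflection t).Full where
  map_surjective := (ParHom.toLin_bijective t _ _).2

/-- The linear equivalence of the morphism spaces. -/
noncomputable def linEquiv (t : ℂ) (k l : ℕ) : ParHom t k l ≃ₗ[ℂ] EvenLin k l :=
  LinearEquiv.ofBijective (ParHom.toLin t k l) (ParHom.toLin_bijective t k l)

/-- The inverse functor. -/
noncomputable def ofReflection (t : ℂ) : ReflectionCat t ⥤ ParCat t where
  obj X := ⟨X.rank⟩
  map {X Y} f := (linEquiv t X.rank Y.rank).symm f
  map_id X := (linEquiv t X.rank X.rank).symm_apply_apply (ParHom.one t X.rank)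
  map_comp {X Y Z} f g := by
    refine (toReflection t).map_injective (X := ⟨X.rank⟩) (Y := ⟨Z.rank⟩) ?_
    rw [Functor.map_comp]
    refine ((linEquiv t X.rank Z.rank).apply_symm_apply _).trans ?_
    exact congrArg₂ (fun (f : X ⟶ Y) (g : Y ⟶ Z) => f ≫ g)
      ((linEquiv t X.rank Y.rank).apply_symm_apply f).symm
      ((linEquiv t Y.rank Z.rank).apply_symm_apply g).symm

lemma toReflection_comp_ofReflection : toReflection t ⋙ ofReflection t = 𝟭 (ParCat t) :=
  Functor.hext (fun _ => rfl) fun X Y f =>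
    heq_of_eq ((linEquiv t X.rank Y.rank).symm_apply_apply f)

lemma ofReflection_comp_toReflection : ofReflection t ⋙ toReflection t = 𝟭 (ReflectionCat t) :=
  Functor.hext (fun _ => rfl) fun X Y f =>
    heq_of_eq ((linEquiv t X.rank Y.rank).apply_symm_apply f)

instance : (toReflection t).Additive where
  map_add {X Y f g} := (ParHom.toLin t X.rank Y.rank).map_add f g

instance : (toReflection t).Linear ℂ where
  map_smul {X Y} f r := (ParHom.toLin t X.rank Y.rank).map_smul r f

lemma toReflection_map_whiskerRight {X Y : ParCat t} (f : X ⟶ Y) (Z : ParCat t) :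
    (toReflection t).map (f ▷ Z) = (toReflection t).map f ▷ (toReflection t).obj Z :=
  ParHom.toLin_tensor f (ParHom.one t Z.rank) rfl rfl

lemma toReflection_map_whiskerLeft (Z : ParCat t) {X Y : ParCat t} (f : X ⟶ Y) :
    (toReflection t).map (Z ◁ f) = (toReflection t).obj Z ◁ (toReflection t).map f :=
  ParHom.toLin_tensor (ParHom.one t Z.rank) f rfl rfl

noncomputable instance : (toReflection t).Monoidal :=
  Functor.CoreMonoidal.toMonoidal
    { εIso := Iso.refl (𝟙_ (ReflectionCat t))
      μIso := fun X Y => Iso.refl ((toReflection t).obj X ⊗ (toReflection t).obj Y)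
      μIso_hom_natural_left := fun f X' => by
        rw [toReflection_map_whiskerRight]
        exact (Category.comp_id _).trans (Category.id_comp _).symm
      μIso_hom_natural_right := fun X' f => by
        rw [toReflection_map_whiskerLeft]
        exact (Category.comp_id _).trans (Category.id_comp _).symm
      associativity := fun X Y Z => by
        -- Both associators are `eqToHom`s of equalities of ranks, which any functor preserves; what
        -- remains consists of identities.
        have h : (toReflection t).map (α_ X Y Z).hom = (α_ ((toReflection t).obj X)
          ((toReflection t).obj Y) ((toReflection t).obj Z)).hom :=
          eqToHom_map (toReflection t) (congrArg ParCat.mk (Nat.add_assoc X.rank Y.rank Z.rank))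
        rw [h]
        refine (congrArg (· ≫ _) (id_whiskerRight _ _)).trans ((Category.id_comp _).trans
          ((Category.id_comp _).trans ?_))
        refine Eq.symm ((congrArg (_ ≫ ·) ((Category.comp_id _).trans (whiskerLeft_id _ _))).trans
          (Category.comp_id _))
      left_unitality := fun X => by
        have h : (toReflection t).map (λ_ X).hom = (λ_ ((toReflection t).obj X)).hom :=
          eqToHom_map (toReflection t) (congrArg ParCat.mk (Nat.zero_add X.rank))
        rw [h]
        refine Eq.symm ((congrArg (fun g => g ≫ 𝟙 _ ≫ (λ_ ((toReflection t).obj X)).hom)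
          (id_whiskerRight (𝟙_ (ReflectionCat t)) ((toReflection t).obj X))).trans ?_)
        exact (Category.id_comp _).trans (Category.id_comp _)
      right_unitality := fun X => by
        have h : (toReflection t).map (ρ_ X).hom = (ρ_ ((toReflection t).obj X)).hom :=
          eqToHom_map (toReflection t) (congrArg ParCat.mk (Nat.add_zero X.rank))
        rw [h]
        refine Eq.symm ((congrArg (fun g => g ≫ 𝟙 _ ≫ (ρ_ ((toReflection t).obj X)).hom)
          (whiskerLeft_id ((toReflection t).obj X) (𝟙_ (ReflectionCat t)))).trans ?_)
        exact (Category.id_comp _).trans (Category.id_comp _) }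

/-! ### Transport of the symmetry -/

/-- The swap of two tensor powers of `W`. -/
noncomputable def parSwap (X Y : ParCat t) : X ⊗ Y ≅ Y ⊗ X :=
  (toReflection t).preimageIso (X := X ⊗ Y) (Y := Y ⊗ X)
    (β_ ((toReflection t).obj X) ((toReflection t).obj Y))

lemma map_parSwap (X Y : ParCat t) : (toReflection t).map (parSwap X Y).hom =
    (β_ ((toReflection t).obj X) ((toReflection t).obj Y)).hom :=
  (toReflection t).map_preimage _

lemma μ_comp_map_parSwap (X Y : ParCat t) :
    Functor.LaxMonoidal.μ (toReflection t) X Y ≫ (toReflection t).map (parSwap X Y).hom =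
      (β_ ((toReflection t).obj X) ((toReflection t).obj Y)).hom ≫
        Functor.LaxMonoidal.μ (toReflection t) Y X := by
  rw [map_parSwap]
  exact (Category.id_comp _).trans (Category.comp_id _).symm

/-- The symmetry of `Par_t`, transported from the reflection category. -/
@[reducible]
noncomputable def parBraided (t : ℂ) : BraidedCategory (ParCat t) :=
  .ofFaithful (toReflection t) parSwap μ_comp_map_parSwap

/-- The functor is compatible with the symmetries. -/
@[reducible]
noncomputable def toReflectionBraided (t : ℂ) :
    letI := parBraided t
    (toReflection t).Braided :=
  letI := parBraided t
  { braided := μ_comp_map_parSwap }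

/-- The symmetric monoidal category `Par_t`. -/
@[reducible]
noncomputable def parSymmetric (t : ℂ) : SymmetricCategory (ParCat t) :=
  letI := parBraided t
  letI := toReflectionBraided t
  .ofFaithful (toReflection t)

/-- The isomorphism of symmetric monoidal categories. -/
noncomputable def symmetricIso (t : ℂ) :
    letI := parSymmetric t
    SymmetricIso (ParCat t) (ReflectionCat t) :=
  letI := parSymmetric t
  { functor := toReflection t
    inverse := ofReflection t
    functor_inverse := toReflection_comp_ofReflection
    inverse_functor := ofReflection_comp_toReflection
    additive := inferInstance
    linear := inferInstance
    braided := toReflectionBraided t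
    unit_obj := rfl
    tensor_obj := fun _ _ => rfl
    ε_eq := rfl
    μ_eq := fun _ _ => rfl }

/-- By faithfulness it suffices to compare images, and moving one point past one point is the
transposition. -/
lemma parSwap_W (t : ℂ) : (parSwap (ParCat.W t) (ParCat.W t)).hom = ParCat.cross t := by
  apply (toReflection t).map_injective
  refine (map_parSwap _ _).trans ?_
  refine congrArg permLin (?_ : (finAddFlip : Fin (1 + 1) ≃ Fin (1 + 1)) = Equiv.swap 0 1)
  decide

/-! ### Endomorphisms of the unit -/

instance : Unique (EvenPartition 0 0) where
  default := EvenPartition.perm (Equiv.refl _)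
  uniq _ := Subtype.ext (Setoid.ext fun v => isEmptyElim v)

lemma scalarEndUnit_reflectionCat (t : ℂ) : ScalarEndUnit (ReflectionCat t) := by
  have e : (fun c : ℂ => c • 𝟙 (𝟙_ (ReflectionCat t))) =
      (fun c => (Finsupp.single default c : EvenLin 0 0)) :=
    funext fun c => (Finsupp.smul_single c _ _).trans (congrArg _ (mul_one c))
  rw [ScalarEndUnit, e]
  exact ⟨Finsupp.single_injective _, fun (f : EvenLin 0 0) => ⟨f default, (Finsupp.unique_single f).symm⟩⟩

/-- Transported along the linear bijection of the endomorphism spaces, which matches the identities.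
-/
lemma scalarEndUnit_parCat (t : ℂ) : ScalarEndUnit (ParCat t) := by
  have h := scalarEndUnit_reflectionCat t
  have e : (fun c : ℂ => c • 𝟙 (𝟙_ (ReflectionCat t))) =
      linEquiv t 0 0 ∘ fun c : ℂ => c • 𝟙 (𝟙_ (ParCat t)) :=
    funext fun c => ((linEquiv t 0 0).map_smul c (ParHom.one t 0)).symm
  rw [ScalarEndUnit, e] at h
  exact ((linEquiv t 0 0).bijective.of_comp_iff' _).1 h

end PartitionDiagram

open PartitionDiagram in
/-- For every `t : ℂ`, the category `Par_t` has a symmetry whose component at `W, W` is the crossing,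
and with it there is an isomorphism of `ℂ`-linear symmetric monoidal categories from `Par_t` to the
reflection category, which sends `W^{⊗k}` to `[k]` and the generators to the corresponding even
partitions. -/
theorem mainTheorem3 (t : ℂ) :
    ScalarEndUnit (ParCat t) ∧ ScalarEndUnit (ReflectionCat t) ∧
    ∃ _S : SymmetricCategory (ParCat t),
      (β_ (ParCat.W t) (ParCat.W t)).hom = ParCat.cross t ∧
      ∃ (G : SymmetricIso (ParCat t) (ReflectionCat t))
        (hobj : ∀ k : ℕ, G.functor.obj ⟨k⟩ = ⟨k⟩),
        G.functor.map (ParCat.neutralizer t) =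
          eqToHom (hobj 2) ≫ ReflectionCat.fourLegs t ≫ eqToHom (hobj 2).symm ∧
        G.functor.map (ParCat.cap t) =
          eqToHom (hobj 2) ≫ ReflectionCat.cap t ≫ eqToHom (hobj 0).symm ∧
        G.functor.map (ParCat.cup t) =
          eqToHom (hobj 0) ≫ ReflectionCat.cup t ≫ eqToHom (hobj 2).symm ∧
        G.functor.map (ParCat.cross t) =
          eqToHom (hobj 2) ≫ ReflectionCat.cross t ≫ eqToHom (hobj 2).symm := by
  refine ⟨scalarEndUnit_parCat t, scalarEndUnit_reflectionCat t, parSymmetric t, parSwap_W t,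
    symmetricIso t, fun _ => rfl, ?_, ?_, ?_, ?_⟩
  -- The objects correspond definitionally, so the `eqToHom`s are identities, and evaluation of a
  -- generator is its partition by definition.
  all_goals exact ((Category.id_comp _).trans (Category.comp_id _)).symm
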